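/- **Theorem 3.1 (categorical mirror symmetry on noncommutative two-tori).** *Objects.* Let $\theta\in\mathbb R$, $\tau\in\mathbb C$ with $\mathrm{Im}\,\tau>0$, and $\hat\rho=-1/\tau$. An object is $a=(g_a,\alpha_a,\beta_a)$ with $g_a=\begin{pmatrix} q_a&s_a\\ p_a&r_a\end{pmatrix}\in SL(2,\mathbb Z)$, $q_a+p_a\theta>0$ and $\alpha_a,\beta_a\in\mathbb R$. Consider any family of objects such that two different members $a,b$ never satisfy all of $(q_a,p_a)=(q_b,p_b)$, $\alpha_a-\alpha_b\in\mathbb Z$, $\beta_a-\beta_b\in\mathbb Z$. Put $A_a=q_a+p_a\theta$, $\theta_a=\frac{r_a\theta+s_a}{A_a}$, $g_a^{-1}g_b=\begin{pmatrix} q_{ab}&s_{ab}\\ p_{ab}&r_{ab}\end{pmatrix}$, $\mu_{ab}=\frac{p_{ab}}{q_{ab}+p_{ab}\theta_a}$, $\alpha_{ab}=\frac{\alpha_b}{A_b}-\frac{\alpha_a}{A_a}$, $\beta_{ab}=\frac{\beta_b}{A_b}-\frac{\beta_a}{A_a}$, $T=2\,\mathrm{Im}\,\hat\rho$. A *cyclic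 graded category* has $\mathbb Z$-graded complex vector spaces $V_{ab}$, an associative bilinear composition $V_{ab}^k\otimes V_{bc}^l\to V_{ac}^{k+l}$, $(x,y)\mapsto xy$, and a nondegenerate pairing $\eta:V^k_{ab}\otimes V^l_{ba}\to\mathbb C$ of degree $-1$ (zero unless $k+l=1$), with $\eta(x,y)=(-1)^{|x||y|}\eta(y,x)$ and $\eta(xy,z)=(-1)^{|x|(|y|+|z|)}\eta(yz,x)$. *A-side $(V^F,\eta^F,m_2^F)$.* The object $a$ is the geodesic cycle in $\mathbb R^2/\mathbb Z^2$ that is the image of $L_a:\ q_ax_2=p_ax_1+\alpha_a$, with the flat connection of holonomy $e^{2\pi i\beta_a}$ (that is, $d-2\pi i\beta_a\,dt$, where $t$ is the affine parameter along $(q_a,p_a)$). If $p_{ab}\neq0$, $V^F_{ab}$ has the basis $v_{ab}^j$, $j=0,\dots,|p_{ab}|-1$, the intersection points of the two cycles, $v_{ab}^j$ being the image of the intersection of $L_a$ with $q_bx_2=p_bx_1+\alpha_b-q_{ab}j$; its degree is $0$ if $\mu_{ab}>0$ and $1$ if $\mu_{ab}<0$. If $a=b$ the basis is $\mathbf 1_a$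 in degree $0$ and $\bar{\mathbf 1}_a$ in degree $1$ (both with label $j=0$). If $p_{ab}=0$ and $a\ne b$, $V^F_{ab}=0$. The pairing is $\eta^F(v_{ab}^j,v_{ba}^{j'})=1$ if $j'\equiv-q_{ab}j \pmod{p_{ab}}$ and the degrees add up to $1$, and $0$ otherwise. If $p_{ab},p_{bc},p_{ac}\ne0$, the product $m_2^F(v_{ab}^{j_1},v_{bc}^{j_2})$ is the sum, over the basis elements $v_{ac}^{j_3}$ of degree $\deg v_{ab}^{j_1}+\deg v_{bc}^{j_2}$, of $c\cdot v_{ac}^{j_3}$ with $$c=\sum_{\triangle}e^{2\pi i\hat\rho\,\mathrm{Area}(\triangle)}\,e^{2\pi i\int\beta(\triangle)} .$$ Here $\triangle$ runs over the triangles in $\mathbb R^2$, modulo $\mathbb Z^2$-translations and including those degenerate to a point, with vertices over $v_{ab}^{j_1},v_{bc}^{j_2},v_{ac}^{j_3}$ and sides in the preimages of the cycles of $a,b,c$; and $\int\beta(\triangle)=t_a\beta_a+t_b\beta_b+t_c\beta_c$, where $t_a(q_a,p_a)$ is the side on $a$, oriented from the vertex over $v_{ac}^{j_3}$ to that over $v_{ab}^{j_1}$,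 and $t_b(q_b,p_b)$, $t_c(q_c,p_c)$ are the following sides. Further $\mathbf 1_a$ is a unit, $m_2^F(v_{ab}^j,v_{ba}^{j'})=\eta^F(v_{ab}^j,v_{ba}^{j'})\,\bar{\mathbf 1}_a$ for $p_{ab}\ne0$, and all other products vanish. *B-side $(PV,\eta|_{PV},P\varphi)$.* If $p_{ab}\ne0$, $\mathrm{Hom}(E_a,E_b)=\mathcal S(\mathbb R\times\mathbb Z/|p_{ab}|)$ is the Heisenberg module over the noncommutative torus $\mathcal A_{\theta_a}$ ($U_1U_2=e^{-2\pi i\theta_a}U_2U_1$) with left action $$(U_1f)(x,j)=e^{2\pi i(x+jq_{ab}/p_{ab})}f(x,j),\qquad (U_2f)(x,j)=f(x+\tfrac{q_{ab}}{p_{ab}}+\theta_a,j-1)$$ and right action of $\mathcal A_{\theta_b}$ through $$(fZ_1)(x,j)=e^{2\pi i(\frac{x}{q_{ab}+p_{ab}\theta_a}+\frac{j}{p_{ab}})}f(x,j),\qquad (fZ_2)(x,j)=f(x+\tfrac1{p_{ab}},j-r_{ab});$$ if $p_{ab}=0$ it is $\mathcal A_{\theta_a}$, with Schwartz coefficients.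 The tensor product $\varphi:\mathrm{Hom}(E_a,E_b)\otimes\mathrm{Hom}(E_b,E_c)\to\mathrm{Hom}(E_a,E_c)$ is the product of $\mathcal A_{\theta_a}$ if $p_{ab}=p_{bc}=0$, the left action if only $p_{ab}=0$, the right action if only $p_{bc}=0$; if $p_{ab},p_{bc}\ne0=p_{ac}$ it is $$\sum_{n\in\mathbb Z^2}U_1^{n_1}U_2^{n_2}\sum_{j}\int dx\,(U_2^{-n_2}U_1^{-n_1}f)(x,j)\,f'\Big(\tfrac{x}{q_{ab}+p_{ab}\theta_a},-q_{ab}j\Big),$$ and if all three are nonzero, its value at $(x,j)$ is, with $w=u-\frac{p_{bc}}{p_{ac}}j$, $$\sum_{u\in\mathbb Z}f\Big(x+\tfrac{w}{p_{ab}},-r_{ab}u+j\Big)\,f'\Big(\tfrac{x}{q_{ab}+p_{ab}\theta_a}-\tfrac{q_{bc}+p_{bc}\theta_b}{p_{bc}}w,\,u\Big).$$ Put $\mathrm{Tr}_a(\sum c_nU_1^{n_1}U_2^{n_2})=|A_a|c_{00}$ and $\langle f'|f\rangle=\mathrm{Tr}_a\varphi(f\otimes f'^\dagger)$, where $f^\dagger(x,j)=\overline{f(\frac{x}{q_{ba}+p_{ba}\theta_b},-q_{ba}j)}$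 if $p_{ab}\ne0$ and $\dagger$ is the $*$-involution if $p_{ab}=0$. Let $\bar\nabla_{ab}=\nabla_{ab,1}+\hat\rho\nabla_{ab,2}$ with $$\nabla_{ab,1}=\tfrac1{A_a}\partial_x-2\pi i\beta_{ab},\qquad \nabla_{ab,2}=-\tfrac1{A_a}\tfrac{2\pi ip_{ab}x}{q_{ab}+p_{ab}\theta_a}-2\pi i\alpha_{ab}$$ if $p_{ab}\ne0$, and multiplication of the coefficient of $U_1^{n_1}U_2^{n_2}$ by $2\pi i(\frac{n_1}{A_a}-\beta_{ab})$, $2\pi i(\frac{n_2}{A_a}-\alpha_{ab})$ respectively if $p_{ab}=0$; let $\bar\nabla_{ab}^\dagger=-(\nabla_{ab,1}+\overline{\hat\rho}\,\nabla_{ab,2})$ be its adjoint. Put $V^0_{ab}=\mathrm{Hom}(E_a,E_b)$, $V^1_{ab}=\mathrm{Hom}(E_a,E_b)\,d\bar z$ and $V^k_{ab}=0$ otherwise, with $d=\bar\nabla_{ab}\,d\bar z$; extend $\varphi$ trivially ($d\bar z^2=0$), and let $\eta(x,y)=\mathrm{Tr}_a\varphi(x\otimes y)$ (coefficient of $d\bar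 z$) in total degree $1$, zero otherwise. Then $PV^0_{ab}=\ker\bar\nabla_{ab}$ and $PV^1_{ab}=(\ker\bar\nabla^\dagger_{ab})\,d\bar z$ are the harmonic representatives of the cohomology, and $P:V_{ab}\to PV_{ab}$ is the orthogonal projection for $\langle\ |\ \rangle$. *Claim.* $(V^F,\eta^F,m_2^F)$ and $(PV,\eta|_{PV},P\varphi)$ are cyclic graded categories, and they are equivalent: there are linear isomorphisms $\mathfrak f_1:V^{F,k}_{ab}\to PV^k_{ab}$ for all $a,b$ and all $k$ with $$\mathfrak f_1(m_2^F(x,y))=P\varphi(\mathfrak f_1(x)\otimes\mathfrak f_1(y)),\qquad \eta^F(x,y)=\eta(\mathfrak f_1(x),\mathfrak f_1(y)).$$ Moreover $\mathfrak f_1(v_{ab}^j)=|0\rangle_{ab}^j$ in degree $0$ and $\mathfrak f_1(v_{ab}^j)=N_{ab}|0\rangle_{ab}^j\,d\bar z$ in degree $1$. For $p_{ab}\neq0$, $|0\rangle_{ab}^j(x,i)$ is $0$ unless $i\equiv j\pmod{p_{ab}}$, and then it is $$\exp\Big(2\pi i\mu_{ab}\Big[\tfrac{\rho'}2y^2+\tfrac{A_b\beta_{ab}}{p_{ab}}y\Big]\Big),\quad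 y=x+\tfrac{A_b\alpha_{ab}}{p_{ab}},$$ with $\rho'=\hat\rho$ if $\mu_{ab}>0$, $\rho'=\overline{\hat\rho}$ if $\mu_{ab}<0$, and $N_{ab}=\sqrt{T|p_{ab}|/(A_aA_b)}$. For $a=b$, $|0\rangle_{aa}$ is the identity of $\mathcal A_{\theta_a}$ and $N_{aa}=1/A_a$. -/

import Mathlib

open scoped SchwartzMap

noncomputable section

/-! ### Cyclic graded categories -/

/-- The data of a graded category over `ℂ` with a pairing: graded spaces of morphisms
`V a b k` (`k` is the degree), a composition `V^k_ab × V^l_bc → V^(k+l)_ac`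
(written with a third index `m` and a proof of `k + l = m`) and a pairing `V^k_ab × V^l_ba → ℂ`.
The laws are in `IsCyclicGradedCategory`. -/
structure CyclicGradedData (Ob : Type*) where
  V : Ob → Ob → ℤ → Type
  addCommGroup : ∀ a b k, AddCommGroup (V a b k)
  module : ∀ a b k, Module ℂ (V a b k)
  comp : ∀ {a b c : Ob} {k l m : ℤ}, k + l = m → V a b k → V b c l → V a c m
  eta : ∀ {a b : Ob} {k l : ℤ}, V a b k → V b a l → ℂ

attribute [instance] CyclicGradedData.addCommGroup CyclicGradedData.module

/-- The laws of a cyclic graded category (a cyclic differential graded category with `d = 0`)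
whose inner product has degree `deg`: the composition is bilinear and associative; the inner
product is bilinear, nonzero only in total degree `-deg`, graded symmetric, nondegenerate and
cyclic. -/
structure IsCyclicGradedCategory {Ob : Type*} (C : CyclicGradedData Ob) (deg : ℤ) : Prop where
  comp_add_left : ∀ {a b c : Ob} {k l m : ℤ} (h : k + l = m) (x x' : C.V a b k) (y : C.V b c l),
    C.comp h (x + x') y = C.comp h x y + C.comp h x' y
  comp_smul_left : ∀ {a b c : Ob} {k l m : ℤ} (h : k + l = m) (z : ℂ) (x : C.V a b k)
    (y : C.V b c l), C.comp h (z • x) y = z • C.comp h x y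
  comp_add_right : ∀ {a b c : Ob} {k l m : ℤ} (h : k + l = m) (x : C.V a b k) (y y' : C.V b c l),
    C.comp h x (y + y') = C.comp h x y + C.comp h x y'
  comp_smul_right : ∀ {a b c : Ob} {k l m : ℤ} (h : k + l = m) (z : ℂ) (x : C.V a b k)
    (y : C.V b c l), C.comp h x (z • y) = z • C.comp h x y
  assoc : ∀ {a b c d : Ob} {k l m kl lm n : ℤ} (h₁ : k + l = kl) (h₂ : kl + m = n)
    (h₃ : l + m = lm) (h₄ : k + lm = n) (x : C.V a b k) (y : C.V b c l) (z : C.V c d m),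
    C.comp h₂ (C.comp h₁ x y) z = C.comp h₄ x (C.comp h₃ y z)
  eta_add_left : ∀ {a b : Ob} {k l : ℤ} (x x' : C.V a b k) (y : C.V b a l),
    C.eta (x + x') y = C.eta x y + C.eta x' y
  eta_smul_left : ∀ {a b : Ob} {k l : ℤ} (z : ℂ) (x : C.V a b k) (y : C.V b a l),
    C.eta (z • x) y = z * C.eta x y
  eta_degree : ∀ {a b : Ob} {k l : ℤ} (x : C.V a b k) (y : C.V b a l),
    k + l + deg ≠ 0 → C.eta x y = 0
  eta_symm : ∀ {a b : Ob} {k l : ℤ} (x : C.V a b k) (y : C.V b a l),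
    C.eta x y = (-1 : ℂ) ^ (k * l) * C.eta y x
  eta_nondegenerate : ∀ {a b : Ob} {k l : ℤ}, k + l + deg = 0 → ∀ x : C.V a b k,
    (∀ y : C.V b a l, C.eta x y = 0) → x = 0
  cyclic : ∀ {a b c : Ob} {k l m kl lm : ℤ} (h₁ : k + l = kl) (h₂ : l + m = lm)
    (x : C.V a b k) (y : C.V b c l) (z : C.V c a m),
    C.eta (C.comp h₁ x y) z = (-1 : ℂ) ^ (k * (l + m)) * C.eta (C.comp h₂ y z) x

/-- An equivalence of cyclic graded categories with the same objects that is the identity on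
objects: linear isomorphisms of the graded spaces of morphisms that intertwine the compositions
and the inner products. -/
structure CyclicGradedEquiv {Ob : Type*} (C D : CyclicGradedData Ob) where
  toEquiv : ∀ (a b : Ob) (k : ℤ), C.V a b k ≃ₗ[ℂ] D.V a b k
  map_comp : ∀ {a b c : Ob} {k l m : ℤ} (h : k + l = m) (x : C.V a b k) (y : C.V b c l),
    toEquiv a c m (C.comp h x y) = D.comp h (toEquiv a b k x) (toEquiv b c l y)
  map_eta : ∀ {a b : Ob} {k l : ℤ} (x : C.V a b k) (y : C.V b a l),
    C.eta x y = D.eta (toEquiv a b k x) (toEquiv b a l y)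

/-! ### Objects -/

/-- An object: `g = (q s; p r) ∈ SL(2, ℤ)` with `q + p θ > 0`, and `α, β ∈ ℝ`.

On the B-side it is the Heisenberg module `E_{g,θ}` with the constant curvature connection of
parameters `α, β`. On the A-side it is the geodesic cycle `q x₂ = p x₁ + α` with a flat
connection of parameter `β`; there `r, s` only serve to number the intersection points. -/
structure Brane (θ : ℝ) where
  g : Matrix.SpecialLinearGroup (Fin 2) ℤ
  α : ℝ
  β : ℝ
  pos : 0 < (g.1 0 0 : ℝ) + (g.1 1 0 : ℝ) * θ

namespace Brane

variable {θ : ℝ}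

def q (a : Brane θ) : ℤ := a.g.1 0 0
def s (a : Brane θ) : ℤ := a.g.1 0 1
def p (a : Brane θ) : ℤ := a.g.1 1 0
def r (a : Brane θ) : ℤ := a.g.1 1 1

/-- The rank `q + p θ`. -/
def rank (a : Brane θ) : ℝ := (a.q : ℝ) + (a.p : ℝ) * θ

/-- `θ_a = g_a θ = (r θ + s) / (q + p θ)`; the endomorphism algebra of `E_{g,θ}` is the
noncommutative torus with this parameter. -/
def ncpar (a : Brane θ) : ℝ := ((a.r : ℝ) * θ + (a.s : ℝ)) / a.rank

/-- Two objects have the same underlying geodesic cycle in the torus `ℝ² / ℤ²` and the same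
holonomy (equivalently, the same Heisenberg module with gauge equivalent connections). -/
def Same (a b : Brane θ) : Prop :=
  a.q = b.q ∧ a.p = b.p ∧ (∃ n : ℤ, b.α - a.α = n) ∧ (∃ n : ℤ, b.β - a.β = n)

/-- `g_ab = g_a⁻¹ g_b`, with entries `(q_ab s_ab; p_ab r_ab)`. -/
def gg (a b : Brane θ) : Matrix.SpecialLinearGroup (Fin 2) ℤ := a.g⁻¹ * b.g

def qq (a b : Brane θ) : ℤ := (gg a b).1 0 0
def ss (a b : Brane θ) : ℤ := (gg a b).1 0 1
def pp (a b : Brane θ) : ℤ := (gg a b).1 1 0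
def rr (a b : Brane θ) : ℤ := (gg a b).1 1 1

/-- `q_ab + p_ab θ_a`. -/
def rk (a b : Brane θ) : ℝ := (qq a b : ℝ) + (pp a b : ℝ) * a.ncpar

/-- `μ_ab = p_ab / (q_ab + p_ab θ_a)`. -/
def mu (a b : Brane θ) : ℝ := (pp a b : ℝ) / rk a b

/-- `α_ab = α_b / (q_b + p_b θ) - α_a / (q_a + p_a θ)`. -/
def αα (a b : Brane θ) : ℝ := b.α / b.rank - a.α / a.rank

/-- `β_ab = β_b / (q_b + p_b θ) - β_a / (q_a + p_a θ)`. -/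
def ββ (a b : Brane θ) : ℝ := b.β / b.rank - a.β / a.rank

end Brane

namespace NCTorus

open Brane

variable {θ : ℝ}

/-- `e(z) = exp(2π i z)`. -/
def ee (z : ℂ) : ℂ := Complex.exp (2 * Real.pi * Complex.I * z)

/-- The complexified symplectic parameter `ρ̂ = -1/τ`. -/
def rhoHat (τ : ℂ) : ℂ := -1 / τ

/-! ### Heisenberg modules -/

/-- Functions on `ℝ × ℤ`. Elements of a Heisenberg module are Schwartz functions on
`ℝ × ℤ/|p|`, written as functions on `ℝ × ℤ` that are `p`-periodic in the second variable. -/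
abbrev Fun := ℝ → ℤ → ℂ

/-- Arrays of coefficients `a_{n₁ n₂}`, for the elements `∑ a_{n₁ n₂} U₁^{n₁} U₂^{n₂}` of a
noncommutative torus. -/
abbrev Coeff := ℤ × ℤ → ℂ

/-- A space large enough for all the spaces of homomorphisms. The first component is used if
`p_ab ≠ 0`, the second one if `p_ab = 0`; the other component is zero. -/
abbrev Mor := Fun × Coeff

/-- Schwartz functions on `ℝ × ℤ/|p|`. -/
def IsSchwartz (p : ℤ) (f : Fun) : Prop :=
  (∀ x j, f x (j + p) = f x j) ∧ ∀ j, ∃ φ : 𝓢(ℝ, ℂ), ∀ x, φ x = f x j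

/-- Rapidly decreasing arrays, the Schwartz space of `ℤ²`. -/
def IsRapid (c : Coeff) : Prop :=
  ∀ N : ℕ, ∃ M : ℝ, ∀ n : ℤ × ℤ, (1 + |(n.1 : ℝ)| + |(n.2 : ℝ)|) ^ N * ‖c n‖ ≤ M

/-- `Hom(E_a, E_b)`: the Heisenberg module `E_{g_ab,θ_a} = 𝓢(ℝ × ℤ/|p_ab|)` if `p_ab ≠ 0`, the
noncommutative torus `𝒜_{θ_a}` if `p_ab = 0`. -/
def homSpace (a b : Brane θ) : Submodule ℂ Mor where
  carrier := {f | (pp a b ≠ 0 → IsSchwartz (pp a b) f.1 ∧ f.2 = 0) ∧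
    (pp a b = 0 → f.1 = 0 ∧ IsRapid f.2)}
  add_mem' := by
    rintro f f' ⟨h1, h2⟩ ⟨h1', h2'⟩
    refine ⟨fun hp => ?_, fun hp => ?_⟩
    · obtain ⟨⟨hper, hS⟩, h0⟩ := h1 hp
      obtain ⟨⟨hper', hS'⟩, h0'⟩ := h1' hp
      refine ⟨⟨fun x j => ?_, fun j => ?_⟩, by simp [h0, h0']⟩
      · simp [hper x j, hper' x j]
      · obtain ⟨φ, hφ⟩ := hS j
        obtain ⟨φ', hφ'⟩ := hS' j
        exact ⟨φ + φ', fun x => by simp [hφ, hφ']⟩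
    · obtain ⟨h0, hR⟩ := h2 hp
      obtain ⟨h0', hR'⟩ := h2' hp
      refine ⟨by simp [h0, h0'], fun N => ?_⟩
      obtain ⟨M, hM⟩ := hR N
      obtain ⟨M', hM'⟩ := hR' N
      refine ⟨M + M', fun n => ?_⟩
      calc (1 + |(n.1 : ℝ)| + |(n.2 : ℝ)|) ^ N * ‖(f + f').2 n‖
          ≤ (1 + |(n.1 : ℝ)| + |(n.2 : ℝ)|) ^ N * (‖f.2 n‖ + ‖f'.2 n‖) := by
            gcongr
            exact norm_add_le _ _
        _ = (1 + |(n.1 : ℝ)| + |(n.2 : ℝ)|) ^ N * ‖f.2 n‖ +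
            (1 + |(n.1 : ℝ)| + |(n.2 : ℝ)|) ^ N * ‖f'.2 n‖ := by ring
        _ ≤ M + M' := add_le_add (hM n) (hM' n)
  zero_mem' := by
    refine ⟨fun _ => ⟨⟨fun x j => rfl, fun j => ⟨0, fun x => rfl⟩⟩, rfl⟩,
      fun _ => ⟨rfl, fun N => ⟨0, fun n => by simp⟩⟩⟩
  smul_mem' := by
    rintro z f ⟨h1, h2⟩
    refine ⟨fun hp => ?_, fun hp => ?_⟩
    · obtain ⟨⟨hper, hS⟩, h0⟩ := h1 hp
      refine ⟨⟨fun x j => ?_, fun j => ?_⟩, by simp [h0]⟩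
      · simp [hper x j]
      · obtain ⟨φ, hφ⟩ := hS j
        exact ⟨z • φ, fun x => by simp [hφ]⟩
    · obtain ⟨h0, hR⟩ := h2 hp
      refine ⟨by simp [h0], fun N => ?_⟩
      obtain ⟨M, hM⟩ := hR N
      refine ⟨‖z‖ * M, fun n => ?_⟩
      calc (1 + |(n.1 : ℝ)| + |(n.2 : ℝ)|) ^ N * ‖(z • f).2 n‖
          = ‖z‖ * ((1 + |(n.1 : ℝ)| + |(n.2 : ℝ)|) ^ N * ‖f.2 n‖) := by
            simp only [Prod.smul_snd, Pi.smul_apply, norm_smul]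
            ring
        _ ≤ ‖z‖ * M := mul_le_mul_of_nonneg_left (hM n) (norm_nonneg z)

/-- The left action of `U₁^n` on `E_{g_ab,θ_a}`. -/
def actU₁ (a b : Brane θ) (n : ℤ) (f : Fun) : Fun := fun x j =>
  ee ((n : ℂ) * ((x : ℂ) + (j : ℂ) * (qq a b : ℂ) / (pp a b : ℂ))) * f x j

/-- The left action of `U₂^n` on `E_{g_ab,θ_a}`. -/
def actU₂ (a b : Brane θ) (n : ℤ) (f : Fun) : Fun := fun x j =>
  f (x + (n : ℝ) * ((qq a b : ℝ) / (pp a b : ℝ) + a.ncpar)) (j - n)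

/-- The right action of `Z₁^n` on `E_{g_ab,θ_a}`. -/
def actZ₁ (a b : Brane θ) (n : ℤ) (f : Fun) : Fun := fun x j =>
  ee ((n : ℂ) * ((x : ℂ) / (rk a b : ℂ) + (j : ℂ) / (pp a b : ℂ))) * f x j

/-- The right action of `Z₂^n` on `E_{g_ab,θ_a}`. -/
def actZ₂ (a b : Brane θ) (n : ℤ) (f : Fun) : Fun := fun x j =>
  f (x + (n : ℝ) / (pp a b : ℝ)) (j - n * rr a b)

/-- The product of the noncommutative torus `𝒜_t`, from `U₁ U₂ = exp(-2π i t) U₂ U₁`. -/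
def torusMul (t : ℝ) (c c' : Coeff) : Coeff := fun n =>
  ∑' m : ℤ × ℤ, c m * c' (n - m) * ee ((t : ℂ) * (m.2 : ℂ) * ((n.1 - m.1 : ℤ) : ℂ))

/-- The tensor product `φ : Hom(E_a, E_b) ⊗ Hom(E_b, E_c) → Hom(E_a, E_c)`. The cases are: the
product of the noncommutative torus, its left action, its right action, the pairing with values
in the noncommutative torus, and the general formula. -/
def tensor (a b c : Brane θ) (f f' : Mor) : Mor :=
  if pp a b = 0 then
    if pp b c = 0 then (0, torusMul a.ncpar f.2 f'.2)
    else (fun x j => ∑' n : ℤ × ℤ, f.2 n * actU₁ b c n.1 (actU₂ b c n.2 f'.1) x j, 0)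
  else
    if pp b c = 0 then
      (fun x j => ∑' n : ℤ × ℤ, f'.2 n * actZ₂ a b n.2 (actZ₁ a b n.1 f.1) x j, 0)
    else if pp a c = 0 then
      (0, fun n => ∑ j ∈ Finset.range (pp a b).natAbs,
        ∫ x : ℝ, actU₂ a b (-n.2) (actU₁ a b (-n.1) f.1) x j *
          f'.1 (x / rk a b) (-(qq a b) * j))
    else
      (fun x j => ∑' u : ℤ,
        f.1 (x + 1 / (pp a b : ℝ) * ((u : ℝ) - (pp b c : ℝ) / (pp a c : ℝ) * (j : ℝ)))
          (-(rr a b) * u + j) *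
        f'.1 (x / rk a b - rk b c / (pp b c : ℝ) *
          ((u : ℝ) - (pp b c : ℝ) / (pp a c : ℝ) * (j : ℝ))) u, 0)

/-- The trace on `𝒜_{θ_a} = Hom(E_a, E_a)`. -/
def trace (a : Brane θ) (f : Mor) : ℂ := ((|a.rank| : ℝ) : ℂ) * f.2 (0, 0)

/-- The conjugation `† : Hom(E_a, E_b) → Hom(E_b, E_a)`. -/
def dagger (a b : Brane θ) (f : Mor) : Mor :=
  if pp a b = 0 then
    (0, fun n => (starRingEnd ℂ) (f.2 (-n)) * ee ((a.ncpar : ℂ) * (n.1 : ℂ) * (n.2 : ℂ)))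
  else
    (fun x j => (starRingEnd ℂ) (f.1 (x / rk b a) (-(j * qq b a))), 0)

/-- The hermitian inner product `⟨f' | f⟩ = Tr φ(f ⊗ f'†)` on `Hom(E_a, E_b)`. -/
def herm (a b : Brane θ) (f' f : Mor) : ℂ := trace a (tensor a b a f (dagger a b f'))

/-! ### Holomorphic structures, harmonic spaces, the cohomology category -/

/-- The connection `∇_{ab,1}` on `Hom(E_a, E_b)`. -/
def nabla₁ (a b : Brane θ) (f : Mor) : Mor :=
  if pp a b = 0 then
    (0, fun n => 2 * Real.pi * Complex.I * ((n.1 : ℂ) / (a.rank : ℂ) - (ββ a b : ℂ)) * f.2 n)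
  else
    (fun x j => 1 / (a.rank : ℂ) * deriv (fun y : ℝ => f.1 y j) x -
      2 * Real.pi * Complex.I * (ββ a b : ℂ) * f.1 x j, 0)

/-- The connection `∇_{ab,2}` on `Hom(E_a, E_b)`. -/
def nabla₂ (a b : Brane θ) (f : Mor) : Mor :=
  if pp a b = 0 then
    (0, fun n => 2 * Real.pi * Complex.I * ((n.2 : ℂ) / (a.rank : ℂ) - (αα a b : ℂ)) * f.2 n)
  else
    (fun x j => (-(1 / (a.rank : ℂ)) *
      (2 * Real.pi * Complex.I * (pp a b : ℂ) * (x : ℂ) / (rk a b : ℂ)) -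
      2 * Real.pi * Complex.I * (αα a b : ℂ)) * f.1 x j, 0)

/-- `∇₁ + z ∇₂`. For `z = ρ̂` this is the holomorphic structure `∇̄_ab`, with differential
`d f = (∇̄_ab f) ⊗ dz̄`. For `z = conj ρ̂` it is `-∇̄_ab†`, where `∇̄_ab†` is the adjoint of `∇̄_ab`
for the hermitian inner product. -/
def nablaBar (z : ℂ) (a b : Brane θ) (f : Mor) : Mor := nabla₁ a b f + z • nabla₂ a b f

/-- The kernel of `∇₁ + z ∇₂` in `Hom(E_a, E_b)`. -/
def kerNabla (z : ℂ) (a b : Brane θ) : Submodule ℂ Mor where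
  carrier := {f | f ∈ homSpace a b ∧ nablaBar z a b f = 0}
  add_mem' := by
    rintro f f' ⟨hf, h⟩ ⟨hf', h'⟩
    refine ⟨add_mem hf hf', ?_⟩
    have key : nablaBar z a b (f + f') = nablaBar z a b f + nablaBar z a b f' := by
      by_cases hp : pp a b = 0
      · refine Prod.ext ?_ ?_
        · simp [nablaBar, nabla₁, nabla₂, hp]
        · funext n
          simp [nablaBar, nabla₁, nabla₂, hp]
          ring
      · refine Prod.ext ?_ ?_
        · funext x j
          obtain ⟨φ, hφ⟩ := (hf.1 hp).1.2 j
          obtain ⟨φ', hφ'⟩ := (hf'.1 hp).1.2 j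
          have e : (fun y : ℝ => f.1 y j) = φ := funext fun y => (hφ y).symm
          have e' : (fun y : ℝ => f'.1 y j) = φ' := funext fun y => (hφ' y).symm
          have d : deriv (fun y : ℝ => f.1 y j + f'.1 y j) x =
              deriv (fun y : ℝ => f.1 y j) x + deriv (fun y : ℝ => f'.1 y j) x := by
            apply deriv_fun_add
            · rw [e]; exact φ.differentiable.differentiableAt
            · rw [e']; exact φ'.differentiable.differentiableAt
          simp [nablaBar, nabla₁, nabla₂, hp, d]
          ring
        · simp [nablaBar, nabla₁, nabla₂, hp]
    rw [key, h, h', add_zero]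
  zero_mem' := by
    refine ⟨zero_mem _, ?_⟩
    by_cases hp : pp a b = 0
    · refine Prod.ext ?_ ?_
      · simp [nablaBar, nabla₁, nabla₂, hp]
      · funext n
        simp [nablaBar, nabla₁, nabla₂, hp]
    · refine Prod.ext ?_ ?_
      · funext x j
        simp [nablaBar, nabla₁, nabla₂, hp]
      · simp [nablaBar, nabla₁, nabla₂, hp]
  smul_mem' := by
    rintro w f ⟨hf, h⟩
    refine ⟨Submodule.smul_mem _ w hf, ?_⟩
    have key : nablaBar z a b (w • f) = w • nablaBar z a b f := by
      by_cases hp : pp a b = 0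
      · refine Prod.ext ?_ ?_
        · simp [nablaBar, nabla₁, nabla₂, hp]
        · funext n
          simp [nablaBar, nabla₁, nabla₂, hp]
          ring
      · refine Prod.ext ?_ ?_
        · funext x j
          simp [nablaBar, nabla₁, nabla₂, hp]
          ring
        · simp [nablaBar, nabla₁, nabla₂, hp]
    rw [key, h, smul_zero]

/-- The harmonic space `PV^k_ab`: the kernel of `d` in degree `0` and, in degree `1`, the
elements annihilated by the adjoint of `d`, which represent the cokernel of `d`.
An element `f ⊗ dz̄` of degree `1` is written as `f`. -/
def harm (τ : ℂ) (a b : Brane θ) (k : ℤ) : Submodule ℂ Mor :=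
  if k = 0 then kerNabla (rhoHat τ) a b
  else if k = 1 then kerNabla ((starRingEnd ℂ) (rhoHat τ)) a b
  else ⊥

open Classical in
/-- The projection `P : V^k_ab → PV^k_ab` of the Hodge-Kodaira decomposition: the orthogonal
projection, for the hermitian inner product, onto the finite-dimensional harmonic space. -/
def proj (τ : ℂ) (a b : Brane θ) (k : ℤ) (f : Mor) : harm τ a b k :=
  if h : ∃ f₀ : harm τ a b k, ∀ f' : harm τ a b k, herm a b f' (f - f₀) = 0
  then h.choose else 0

/-- The cohomology category `(PV, η|_PV, P φ)` of holomorphic Heisenberg modules, on the objects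
of a family `obj`. The inner product is `η = Tr ∫ dz φ` with `∫ dz dz̄ = 1`. -/
def heisenbergCat (τ : ℂ) {Ob : Type*} (obj : Ob → Brane θ) : CyclicGradedData Ob where
  V a b k := harm τ (obj a) (obj b) k
  addCommGroup _ _ _ := inferInstance
  module _ _ _ := inferInstance
  comp {a b c _ _ m} _ x y := proj τ (obj a) (obj c) m (tensor (obj a) (obj b) (obj c) x y)
  eta {a b k l} x y :=
    if k + l = 1 then trace (obj a) (tensor (obj a) (obj b) (obj a) x y) else 0

/-- A morphism of degree `k` of the cohomology category as an element of `Hom(E_a, E_b)`. -/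
def toMor {τ : ℂ} {Ob : Type*} {obj : Ob → Brane θ} {a b : Ob} {k : ℤ}
    (x : (heisenbergCat τ obj).V a b k) : Mor := Subtype.val (p := (· ∈ harm τ (obj a) (obj b) k)) x

/-! ### The Fukaya category -/

/-- The number of basis elements `v_ab^j`: the number `|p_ab|` of intersection points if
`p_ab ≠ 0`, and one label if `p_ab = 0`. -/
def numLabels (a b : Brane θ) : ℕ := if pp a b = 0 then 1 else (pp a b).natAbs

/-- `Hom(a, b)` has basis elements of degree `k`: for `μ_ab > 0` only of degree `0`, for
`μ_ab < 0` only of degree `1`, for `a = b` of degrees `0` and `1`, for `μ_ab = 0` and `a ≠ b`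
none. -/
def HasDegree {Ob : Type*} (obj : Ob → Brane θ) (a b : Ob) (k : ℤ) : Prop :=
  (0 < mu (obj a) (obj b) ∧ k = 0) ∨ (mu (obj a) (obj b) < 0 ∧ k = 1) ∨
    (a = b ∧ (k = 0 ∨ k = 1))

/-- The labels `j` of the basis elements `v_ab^j` of degree `k`. For `a = b` the one element
is the unit `1_a` if `k = 0` and its dual if `k = 1`. -/
abbrev Label {Ob : Type*} (obj : Ob → Brane θ) (a b : Ob) (k : ℤ) : Type :=
  {_j : Fin (numLabels (obj a) (obj b)) // HasDegree obj a b k}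

/-- The label as an integer. -/
def Label.num {Ob : Type*} {obj : Ob → Brane θ} {a b : Ob} {k : ℤ} (j : Label obj a b k) : ℤ :=
  ((j.1 : ℕ) : ℤ)

noncomputable instance {Ob : Type*} (obj : Ob → Brane θ) (a b : Ob) (k : ℤ) :
    Fintype (Label obj a b k) := Fintype.ofFinite _

/-- The lines `q x₂ = p x₁ + α + n`, `n ∈ ℤ`, are the components of the inverse image in `ℝ²` of
the geodesic cycle of `a`. -/
def OnLine (a : Brane θ) (n : ℤ) (v : ℝ × ℝ) : Prop :=
  (a.q : ℝ) * v.2 = (a.p : ℝ) * v.1 + a.α + (n : ℝ)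

/-- The point of `ℝ²` over the intersection point `v_ab^j`: the intersection of the lines
`L_a : q_a x₂ = p_a x₁ + α_a` and
`L_b' : q_b (x₂ - p_a q_ab j / p_ab) = p_b (x₁ - q_a q_ab j / p_ab) + α_b`. -/
def vertex (a b : Brane θ) (j : ℤ) : ℝ × ℝ :=
  (((a.q : ℝ) * (qq a b : ℝ) * (j : ℝ) - (a.q : ℝ) * b.α + (b.q : ℝ) * a.α) / (pp a b : ℝ),
   ((a.p : ℝ) * (qq a b : ℝ) * (j : ℝ) - (a.p : ℝ) * b.α + (b.p : ℝ) * a.α) / (pp a b : ℝ))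

theorem pp_eq (a b : Brane θ) : pp a b = a.q * b.p - a.p * b.q := by
  simp only [pp, gg, Brane.q, Brane.p, Matrix.SpecialLinearGroup.coe_mul,
    Matrix.SpecialLinearGroup.coe_inv, Matrix.adjugate_fin_two, Matrix.mul_apply,
    Fin.sum_univ_two]
  simp
  ring

/-- `vertex a b j` is the intersection of `L_a` and `L_b'`. -/
theorem vertex_spec (a b : Brane θ) (j : ℤ) (h : pp a b ≠ 0) :
    (a.q : ℝ) * (vertex a b j).2 = (a.p : ℝ) * (vertex a b j).1 + a.α ∧
    (b.q : ℝ) * ((vertex a b j).2 - (a.p : ℝ) * ((qq a b : ℝ) * (j : ℝ) / (pp a b : ℝ))) =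
      (b.p : ℝ) * ((vertex a b j).1 - (a.q : ℝ) * ((qq a b : ℝ) * (j : ℝ) / (pp a b : ℝ))) +
        b.α := by
  have h' : (pp a b : ℝ) ≠ 0 := by exact_mod_cast h
  have e : (pp a b : ℝ) = (a.q : ℝ) * b.p - a.p * b.q := by exact_mod_cast pp_eq a b
  constructor
  · simp only [vertex]
    field_simp
    rw [e]
    ring
  · simp only [vertex]
    field_simp
    rw [e]
    ring

/-- `v ∈ ℝ²` lies over the intersection point `v_ab^j` of `ℝ² / ℤ²`. -/
def IsLift (a b : Brane θ) (j : ℤ) (v : ℝ × ℝ) : Prop :=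
  ∃ m n : ℤ, v = vertex a b j + ((m : ℝ), (n : ℝ))

/-- The triangles, up to translation: the first vertex is the chosen point over `v_ab^{j₁}`, the
second one `v.1` lies over `v_bc^{j₂}` and the third one `v.2` over
`v_ac^{j₃} = v_ca^{-q_ac j₃}`; the sides lie in the inverse images of the cycles of `a`, `b`, `c`.
The triangle may degenerate to a point. -/
def Triangle (a b c : Brane θ) (j₁ j₂ j₃ : ℤ) : Type :=
  {v : (ℝ × ℝ) × (ℝ × ℝ) // IsLift b c j₂ v.1 ∧ IsLift a c j₃ v.2 ∧
    (∃ n : ℤ, OnLine a n v.2 ∧ OnLine a n (vertex a b j₁)) ∧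
    (∃ n : ℤ, OnLine b n (vertex a b j₁) ∧ OnLine b n v.1) ∧
    (∃ n : ℤ, OnLine c n v.1 ∧ OnLine c n v.2)}

/-- The area of the triangle with vertices `u, v, w`. -/
def area (u v w : ℝ × ℝ) : ℝ :=
  |(v.1 - u.1) * (w.2 - u.2) - (v.2 - u.2) * (w.1 - u.1)| / 2

/-- The contribution to `∫ β` of the side of a polygon in the inverse image of the cycle of `a`,
from `v` to `w`: `β_a t` if `w - v = t (q_a, p_a)`. Here `t` is computed from the coordinate
`x₁ + θ x₂`, which `(q_a, p_a)` increases by `q_a + p_a θ`. So the flat connection is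
`d - 2π i β_a dt` and its holonomy around the cycle is `exp(2π i β_a)`. -/
def sideBeta (a : Brane θ) (v w : ℝ × ℝ) : ℝ :=
  ((w.1 + θ * w.2) - (v.1 + θ * v.2)) / a.rank * a.β

/-- The weight `exp(2π i ρ̂ A) exp(2π i ∫ β)` of a triangle. -/
def weight (τ : ℂ) (a b c : Brane θ) {j₁ j₂ j₃ : ℤ} (t : Triangle a b c j₁ j₂ j₃) : ℂ :=
  ee (rhoHat τ * (area (vertex a b j₁) t.1.1 t.1.2 : ℂ)) *
    ee ((sideBeta a t.1.2 (vertex a b j₁) + sideBeta b (vertex a b j₁) t.1.1 +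
      sideBeta c t.1.1 t.1.2 : ℝ) : ℂ)

/-- The coefficient of `v_ac^{j₃}` in `m₂(v_ab^{j₁}, v_bc^{j₂})`. If one of `a, b`; `b, c`; `a, c`
are equal, it is given by the rules that `1_a` is a unit and that
`m₂(v_ab^{j₁}, v_ba^{j₂})` is the dual of `1_a` if `v_ab^{j₁}` and `v_ba^{j₂}` are the same point
of the torus and zero otherwise. -/
def structureConst (τ : ℂ) (a b c : Brane θ) (j₁ j₂ j₃ : ℤ) : ℂ :=
  if pp a b = 0 then (if j₂ = j₃ then 1 else 0)
  else if pp b c = 0 then (if j₁ = j₃ then 1 else 0)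
  else if pp a c = 0 then (if j₂ ≡ -(qq a b) * j₁ [ZMOD pp a b] then 1 else 0)
  else ∑' t : Triangle a b c j₁ j₂ j₃, weight τ a b c t

/-- The cyclic graded category `(V^F, η^F, m₂^F)` of the Fukaya category of `θ`-tilted geodesic
lines, on the objects of a family `obj`. An element of `V^{F,k}_ab` is given by its
coefficients in the basis `v_ab^j`. -/
def fukayaCat (τ : ℂ) {Ob : Type*} (obj : Ob → Brane θ) : CyclicGradedData Ob where
  V a b k := Label obj a b k → ℂ
  addCommGroup _ _ _ := inferInstance
  module _ _ _ := inferInstance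
  comp {a b c k l _} _ x y := fun j₃ => ∑ j₁ : Label obj a b k, ∑ j₂ : Label obj b c l,
    x j₁ * y j₂ * structureConst τ (obj a) (obj b) (obj c) j₁.num j₂.num j₃.num
  eta {a b k l} x y := ∑ j : Label obj a b k, ∑ j' : Label obj b a l,
    x j * y j' * (if k + l = 1 ∧
      j'.num ≡ -(qq (obj a) (obj b)) * j.num [ZMOD pp (obj a) (obj b)] then 1 else 0)

open Classical in
/-- The basis element `v_ab^j` of `V^{F,k}_ab`. -/
def basisVec {Ob : Type*} (obj : Ob → Brane θ) {a b : Ob} {k : ℤ} (j : Label obj a b k) :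
    Label obj a b k → ℂ := Pi.single j 1

/-! ### Theta vectors -/

/-- The vector `|0⟩_ab^j`: for `p_ab ≠ 0` the Gaussian supported on the residue class of `j`
(with `ρ̂` if `μ_ab > 0`, with its complex conjugate if `μ_ab < 0`), for `p_ab = 0` the identity
of the noncommutative torus. -/
def vacuum (τ : ℂ) (a b : Brane θ) (j : ℤ) : Mor :=
  if pp a b = 0 then (0, fun n => if n = 0 then 1 else 0)
  else (fun x i =>
    if i ≡ j [ZMOD pp a b] then
      ee ((mu a b : ℂ) *
        ((if 0 < mu a b then rhoHat τ else (starRingEnd ℂ) (rhoHat τ)) / 2 *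
          ((x + b.rank / (pp a b : ℝ) * αα a b : ℝ) : ℂ) ^ 2 +
        ((b.rank / (pp a b : ℝ) * ββ a b : ℝ) : ℂ) *
          ((x + b.rank / (pp a b : ℝ) * αα a b : ℝ) : ℂ)))
    else 0, 0)

/-- The normalization `N_ab(0)`, with `T = 2 Im ρ̂`. -/
def normConst (τ : ℂ) (a b : Brane θ) : ℝ :=
  if pp a b = 0 then 1 / a.rank
  else Real.sqrt (2 * (rhoHat τ).im * |(pp a b : ℝ)| / (a.rank * b.rank))

/-- The theta vector `|0⟩_ab^j` in degree `0`, and its normalized version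
`N_ab(0) |0⟩_ab^j ⊗ dz̄` in degree `1`. -/
def thetaVec (τ : ℂ) (a b : Brane θ) (k j : ℤ) : Mor :=
  if k = 0 then vacuum τ a b j else (normConst τ a b : ℂ) • vacuum τ a b j

end NCTorus

end

/-!
The isomorphism `𝔣₁` sends the intersection points `v_ab^j` to normalized Gaussians, and both
products become sums over the integers of the same weights of triangles.

*Weights.* In the coordinate `X = x₁ + θ x₂` an object has a slope `p / (q + p θ)`, and `p_ab` is a
positive multiple of the difference of the slopes (`pp_eq_slope`). For three lines with pairwise
different slopes, `ρ̂ Area + ∫ β` is a sum over the three corners of quadratic and linear functions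
of `X` minus the coordinate of the corner, and this sum does not depend on `X`
(`triWeight_eq_edges`). The contribution of the corner `ab`, as a function of `X = (q_a + p_a θ) x`,
is the exponent of the Gaussian `|0⟩_ab` (`vacuum_eq_gaussian`).

*The Fukaya category.* The trilinear form `η(xy, z)` on basis elements is a sum over triangles
without a preferred corner (`thetaSum`), hence cyclic (`thetaSum_rotate`, `fukaya_cyclic`). Since
the pairing is nondegenerate, associativity may be checked after pairing with a fourth morphism,
and then a rotation reduces it to morphisms of degree `0` (`fukaya_assoc_eta`). There it says that
a quadrilateral can be cut along either diagonal (`triWeight_mul_triWeight`, `thetaSum_assoc`).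

*The Heisenberg side.* For `p_ab ≠ 0`, `∇₁ + z ∇₂` is a first order operator whose kernel on smooth
functions is spanned by a Gaussian on each residue class, which decays exactly in the degree where
the intersection points live. For `p_ab = 0` it acts on Fourier coefficients by multiplication, and
has a kernel, the scalars, only for `a = b`. So theta vectors are bases of the harmonic spaces
(`thetaEquiv`).

*The comparison.* The projection of a product of theta vectors to the harmonic space is computed
by integrals against a third Gaussian. Term by term, the product of the three Gaussians is the
weight of a triangle times a real Gaussian in `x`: all three corners carry `ρ̂`, except one that
carries its complex conjugate (`exists_gaussian_mul_gaussian_mul_conj`). Its integral does not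
depend on the summation index, and is what the constants `N_ab` compensate. The sum of the
remaining weights is the product in the Fukaya category (`labelFun_fukayaComp`,
`proj_tensor_thetaEquiv`). The pairing is the same computation with two Gaussians
(`tensor_thetaEquiv_zero`). Finally the laws of a cyclic graded category are carried over to the
Heisenberg side along the equivalence (`IsCyclicGradedCategory.transport`).
-/

noncomputable section

/-! ### Arithmetic of pairs of objects -/

namespace Brane

variable {θ : ℝ}

theorem det_eq_one (a : Brane θ) : a.q * a.r - a.s * a.p = 1 := by
  have h := a.g.2
  rw [Matrix.det_fin_two] at h
  exact h

theorem qq_eq (a b : Brane θ) : qq a b = a.r * b.q - a.s * b.p := by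
  simp only [qq, gg, q, p, r, s, Matrix.SpecialLinearGroup.coe_mul,
    Matrix.SpecialLinearGroup.coe_inv, Matrix.adjugate_fin_two, Matrix.mul_apply, Fin.sum_univ_two]
  simp
  ring

theorem rr_eq (a b : Brane θ) : rr a b = a.q * b.r - a.p * b.s := by
  simp only [rr, gg, q, p, r, s, Matrix.SpecialLinearGroup.coe_mul,
    Matrix.SpecialLinearGroup.coe_inv, Matrix.adjugate_fin_two, Matrix.mul_apply, Fin.sum_univ_two]
  simp
  ring

theorem qq_swap (a b : Brane θ) : qq b a = rr a b := by rw [qq_eq, rr_eq]; ring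

theorem rr_swap (a b : Brane θ) : rr b a = qq a b := by rw [qq_eq, rr_eq]; ring

theorem pp_swap (a b : Brane θ) : pp b a = -pp a b := by
  rw [NCTorus.pp_eq, NCTorus.pp_eq]; ring

theorem pp_self (a : Brane θ) : pp a a = 0 := by rw [NCTorus.pp_eq]; ring

theorem rank_pos (a : Brane θ) : 0 < a.rank := a.pos

theorem rank_ne (a : Brane θ) : a.rank ≠ 0 := a.rank_pos.ne'

theorem qq_mul_rr (a b : Brane θ) : ∃ t : ℤ, qq a b * rr a b = 1 + pp a b * t := by
  refine ⟨a.r * b.s - a.s * b.r, ?_⟩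
  rw [qq_eq, rr_eq, NCTorus.pp_eq]
  linear_combination (b.q * b.r - b.s * b.p) * det_eq_one a + det_eq_one b

theorem rk_eq (a b : Brane θ) : rk a b = b.rank / a.rank := by
  have ha := a.rank_ne
  have hd : (a.q : ℝ) * a.r - a.s * a.p = 1 := by exact_mod_cast det_eq_one a
  have hq : (qq a b : ℝ) = a.r * b.q - a.s * b.p := by exact_mod_cast qq_eq a b
  have hp : (pp a b : ℝ) = a.q * b.p - a.p * b.q := by exact_mod_cast NCTorus.pp_eq a b
  rw [rk, ncpar, hq, hp]
  field_simp
  simp only [rank]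
  linear_combination ((b.q : ℝ) + b.p * θ) * hd

theorem rk_pos (a b : Brane θ) : 0 < rk a b := by
  rw [rk_eq]; exact div_pos b.rank_pos a.rank_pos

/-- The slope of the lines of `a` in the coordinates `X = x₁ + θ x₂`, `Y = x₂`. -/
def slope (a : Brane θ) : ℝ := a.p / a.rank

/-- The intercept, in the coordinates `X = x₁ + θ x₂`, `Y = x₂`, of the line
`q x₂ = p x₁ + α + m`. The index `m` may be any real number. -/
def icpt (a : Brane θ) (m : ℝ) : ℝ := (a.α + m) / a.rank

theorem pp_eq_slope (a b : Brane θ) :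
    (pp a b : ℝ) = a.rank * b.rank * (b.slope - a.slope) := by
  have ha := a.rank_ne
  have hb := b.rank_ne
  have hp : (pp a b : ℝ) = a.q * b.p - a.p * b.q := by exact_mod_cast NCTorus.pp_eq a b
  rw [hp, slope, slope]
  field_simp
  simp only [rank]
  ring

theorem pp_pos_iff (a b : Brane θ) : 0 < pp a b ↔ a.slope < b.slope := by
  have h := pp_eq_slope a b
  have hab := mul_pos a.rank_pos b.rank_pos
  rw [← Int.cast_pos (R := ℝ), h, mul_pos_iff_of_pos_left hab, sub_pos]

theorem pp_neg_iff (a b : Brane θ) : pp a b < 0 ↔ b.slope < a.slope := by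
  rw [← pp_pos_iff, pp_swap a b]; omega

theorem pp_ne_iff (a b : Brane θ) : pp a b ≠ 0 ↔ b.slope - a.slope ≠ 0 := by
  have h := pp_eq_slope a b
  have ha := a.rank_ne
  have hb := b.rank_ne
  rw [← Int.cast_ne_zero (α := ℝ), h]
  simp [ha, hb]

theorem mu_eq (a b : Brane θ) : mu a b = a.rank ^ 2 * (b.slope - a.slope) := by
  have ha := a.rank_ne
  have hb := b.rank_ne
  rw [mu, rk_eq, pp_eq_slope]
  field_simp

theorem mu_pos_iff (a b : Brane θ) : 0 < mu a b ↔ 0 < pp a b := by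
  rw [mu, div_pos_iff_of_pos_right (rk_pos a b), Int.cast_pos]

theorem mu_neg_iff (a b : Brane θ) : mu a b < 0 ↔ pp a b < 0 := by
  rw [mu, div_neg_iff]
  have h := rk_pos a b
  constructor
  · rintro (⟨_, h'⟩ | ⟨h', _⟩)
    · exact absurd h' h.not_gt
    · exact_mod_cast h'
  · exact fun h' => Or.inr ⟨by exact_mod_cast h', h⟩

/-- Parallel lines: primitive vectors `(q, p)` of positive rank on one ray coincide. -/
theorem eq_of_pp_eq_zero {a b : Brane θ} (h : pp a b = 0) : a.q = b.q ∧ a.p = b.p := by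
  have hda := det_eq_one a
  have hdb := det_eq_one b
  have hp : a.q * b.p - a.p * b.q = 0 := by rw [← NCTorus.pp_eq]; exact h
  -- `(q_b, p_b) = u (q_a, p_a)` and conversely with `v`
  set u := a.r * b.q - a.s * b.p with hu
  set v := b.r * a.q - b.s * a.p with hv
  have h1 : b.q = u * a.q := by linear_combination -b.q * hda + a.s * hp
  have h2 : b.p = u * a.p := by linear_combination -b.p * hda + a.r * hp
  have huv : u * v = 1 := by linear_combination hdb - b.r * h1 + b.s * h2
  have ha := a.pos
  have hb : 0 < b.rank := b.rank_pos
  have e : b.rank = u * a.rank := by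
    have h1' : (b.q : ℝ) = u * a.q := by exact_mod_cast h1
    have h2' : (b.p : ℝ) = u * a.p := by exact_mod_cast h2
    simp only [rank]
    rw [h1', h2']
    ring
  rw [e] at hb
  have hu0 : (0 : ℝ) < u := pos_of_mul_pos_left hb a.rank_pos.le
  have hu0' : 0 < u := by exact_mod_cast hu0
  have hu1 : u = 1 := by
    rcases Int.isUnit_iff.1 (IsUnit.of_mul_eq_one v huv) with h | h
    · exact h
    · omega
  rw [hu1] at h1 h2
  exact ⟨by linarith, by linarith⟩

theorem rank_eq_of_pp_eq_zero {a b : Brane θ} (h : pp a b = 0) : a.rank = b.rank := by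
  obtain ⟨h1, h2⟩ := eq_of_pp_eq_zero h
  simp only [rank, h1, h2]

theorem pp_congr_left {a b : Brane θ} (h : pp a b = 0) (c : Brane θ) : pp a c = pp b c := by
  obtain ⟨h1, h2⟩ := eq_of_pp_eq_zero h
  rw [NCTorus.pp_eq, NCTorus.pp_eq, h1, h2]

end Brane

namespace NCTorus

open Brane

variable {θ : ℝ}

/-! ### Labels of intersection points -/

/-- The line of `a` with index `m` and the line of `b` with index `n` meet over the intersection
point with label `j`. The quantity `m - r_ab n` modulo `p_ab` is invariant under translations. -/
def Inc (a b : Brane θ) (j m n : ℤ) : Prop := ∃ t : ℤ, m - rr a b * n = j + pp a b * t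

/-- The change of the index of a line of `a` under translation by `(x, y) ∈ ℤ²`. -/
def shiftIdx (a : Brane θ) (x y : ℤ) : ℤ := a.q * y - a.p * x

theorem inc_shift {a b : Brane θ} {j m n : ℤ} (x y : ℤ) (h : Inc a b j m n) :
    Inc a b j (m + shiftIdx a x y) (n + shiftIdx b x y) := by
  obtain ⟨t, ht⟩ := h
  refine ⟨t - b.s * y + b.r * x, ?_⟩
  rw [rr_eq, pp_eq] at *
  simp only [shiftIdx]
  linear_combination ht - (a.q * y - a.p * x) * det_eq_one b

/-- A lift of an intersection point is unique up to translation by `ℤ²`. -/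
theorem exists_shift {a b : Brane θ} {j m n m' n' : ℤ} (h : Inc a b j m n)
    (h' : Inc a b j m' n') :
    ∃ x y : ℤ, m' = m + shiftIdx a x y ∧ n' = n + shiftIdx b x y := by
  obtain ⟨t, ht⟩ := h
  obtain ⟨t', ht'⟩ := h'
  refine ⟨(n' - n) * b.s + (t' - t) * b.q, (n' - n) * b.r + (t' - t) * b.p, ?_, ?_⟩
  · rw [rr_eq, pp_eq] at *
    simp only [shiftIdx]
    linear_combination ht' - ht
  · simp only [shiftIdx]
    linear_combination -(n' - n) * det_eq_one b

/-- The labels of an intersection point as a point of `ab` and as a point of `ba`. -/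
theorem inc_swap {a b : Brane θ} {j j' m n : ℤ} (hj : Inc a b j m n)
    (h : j' ≡ -(qq a b) * j [ZMOD pp a b]) : Inc b a j' n m := by
  obtain ⟨t, ht⟩ := hj
  obtain ⟨u, hu⟩ := h.dvd
  obtain ⟨v, hv⟩ := qq_mul_rr a b
  refine ⟨qq a b * t + v * n - u, ?_⟩
  rw [rr_swap, pp_swap a b]
  linear_combination -qq a b * ht + hu - hv * n

theorem inc_swap_iff {a b : Brane θ} {j j' m n : ℤ} (hj : Inc a b j m n) :
    Inc b a j' n m ↔ j' ≡ -(qq a b) * j [ZMOD pp a b] := by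
  refine ⟨fun h => ?_, inc_swap hj⟩
  obtain ⟨t, ht⟩ := hj
  obtain ⟨t', ht'⟩ := h
  obtain ⟨v, hv⟩ := qq_mul_rr a b
  refine Int.ModEq.symm ((Int.modEq_iff_dvd).2 ⟨t' - qq a b * t - v * n, ?_⟩)
  rw [rr_swap, pp_swap a b] at ht'
  linear_combination -qq a b * ht - ht' - hv * n

theorem inc_swap_label {a b : Brane θ} {j m n : ℤ} :
    Inc b a (-(qq a b) * j) n m ↔ Inc a b j m n := by
  refine ⟨fun h => inc_swap h ?_, fun h => inc_swap h rfl⟩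
  obtain ⟨v, hv⟩ := qq_mul_rr a b
  rw [qq_swap, pp_swap a b]
  exact (Int.modEq_iff_dvd).2 ⟨-(v * j), by linear_combination j * hv⟩

theorem inc_iff_modEq {a b : Brane θ} {j m n : ℤ} :
    Inc a b j m n ↔ m - rr a b * n ≡ j [ZMOD pp a b] := by
  rw [Int.modEq_comm, Int.modEq_iff_dvd]
  constructor
  · rintro ⟨t, ht⟩
    exact ⟨t, by linear_combination ht⟩
  · rintro ⟨t, ht⟩
    exact ⟨t, by linear_combination ht⟩

theorem inc_congr {a b : Brane θ} {j j' m n : ℤ} (h : j ≡ j' [ZMOD pp a b]) :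
    Inc a b j m n ↔ Inc a b j' m n := by
  rw [inc_iff_modEq, inc_iff_modEq]
  exact ⟨fun h' => h'.trans h, fun h' => h'.trans h.symm⟩

/-- Modulo `p ≠ 0`, each integer is congruent to exactly one of `0, …, |p| - 1`. -/
theorem existsUnique_label {p : ℤ} (hp : p ≠ 0) (i : ℤ) :
    ∃! j : Fin p.natAbs, i ≡ ((j : ℕ) : ℤ) [ZMOD p] := by
  have h0 := Int.emod_nonneg i hp
  have h1 : i % p < p.natAbs := by
    have := Int.emod_lt i hp
    omega
  refine ⟨⟨(i % p).toNat, by omega⟩, ?_, ?_⟩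
  · show i % p = (((i % p).toNat : ℕ) : ℤ) % p
    rw [Int.toNat_of_nonneg h0, Int.emod_emod]
  · intro j hj
    ext
    have hj' : i % p = ((j : ℕ) : ℤ) % p := hj
    have h2 : ((j : ℕ) : ℤ) % p = j := by
      rw [← Int.emod_abs, Int.abs_eq_natAbs]
      have := j.2
      exact Int.emod_eq_of_lt (by omega) (by omega)
    simp only
    omega

/-! ### Triangles and theta sums -/

theorem pp_cast (a b : Brane θ) : (pp a b : ℝ) = (a.q : ℝ) * b.p - a.p * b.q := by
  exact_mod_cast pp_eq a b

/-- The intersection of the line of `a` with index `m` and the line of `b` with index `n`. -/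
def crossPt (a b : Brane θ) (m n : ℝ) : ℝ × ℝ :=
  ((b.q * (a.α + m) - a.q * (b.α + n)) / pp a b, (b.p * (a.α + m) - a.p * (b.α + n)) / pp a b)

theorem onLine_crossPt_left {a b : Brane θ} (h : pp a b ≠ 0) (m n : ℤ) :
    OnLine a m (crossPt a b m n) := by
  have h' : (pp a b : ℝ) ≠ 0 := by exact_mod_cast h
  simp only [OnLine, crossPt]
  field_simp
  rw [pp_cast]
  ring

theorem onLine_crossPt_right {a b : Brane θ} (h : pp a b ≠ 0) (m n : ℤ) :
    OnLine b n (crossPt a b m n) := by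
  have h' : (pp a b : ℝ) ≠ 0 := by exact_mod_cast h
  simp only [OnLine, crossPt]
  field_simp
  rw [pp_cast]
  ring

theorem eq_crossPt {a b : Brane θ} (h : pp a b ≠ 0) {m n : ℤ} {v : ℝ × ℝ}
    (ha : OnLine a m v) (hb : OnLine b n v) : v = crossPt a b m n := by
  have h' : (pp a b : ℝ) ≠ 0 := by exact_mod_cast h
  simp only [OnLine] at ha hb
  refine Prod.ext ?_ ?_
  · simp only [crossPt]
    rw [eq_div_iff h', pp_cast]
    linear_combination b.q * ha - a.q * hb
  · simp only [crossPt]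
    rw [eq_div_iff h', pp_cast]
    linear_combination b.p * ha - a.p * hb

theorem crossPt_swap (a b : Brane θ) (m n : ℝ) : crossPt b a n m = crossPt a b m n := by
  simp only [crossPt, pp_swap a b, Int.cast_neg, div_neg, ← neg_div, neg_sub]

/-- The chosen lift of `v_ab^j` lies on the line of `b` with index `-q_ab j`. -/
theorem vertex_eq_crossPt {a b : Brane θ} (h : pp a b ≠ 0) (j : ℤ) :
    vertex a b j = crossPt a b ((0 : ℤ) : ℝ) ((-(qq a b) * j : ℤ) : ℝ) := by
  obtain ⟨h1, h2⟩ := vertex_spec a b j h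
  have h' : (pp a b : ℝ) ≠ 0 := by exact_mod_cast h
  apply eq_crossPt h
  · simp only [OnLine]
    push_cast
    linear_combination h1
  · simp only [OnLine]
    push_cast
    have e : (pp a b : ℝ) * (qq a b * j / pp a b) = qq a b * j := by field_simp
    rw [pp_cast] at e
    rw [pp_cast] at h2
    linear_combination h2 - e

theorem onLine_unique {a : Brane θ} {m n : ℤ} {v : ℝ × ℝ} (h : OnLine a m v)
    (h' : OnLine a n v) : m = n := by
  simp only [OnLine] at h h'
  have : (m : ℝ) = n := by linear_combination h' - h
  exact_mod_cast this

theorem onLine_add {a : Brane θ} {m : ℤ} {v : ℝ × ℝ} (x y : ℤ) (h : OnLine a m v) :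
    OnLine a (m + shiftIdx a x y) (v + ((x : ℝ), (y : ℝ))) := by
  simp only [OnLine, shiftIdx, Prod.fst_add, Prod.snd_add] at *
  push_cast
  linear_combination h

theorem inc_vertex (a b : Brane θ) (j : ℤ) : Inc a b j 0 (-(qq a b) * j) := by
  obtain ⟨t, ht⟩ := qq_mul_rr a b
  exact ⟨t * j, by linear_combination j * ht⟩

theorem isLift_crossPt_iff {a b : Brane θ} (h : pp a b ≠ 0) (j m n : ℤ) :
    IsLift a b j (crossPt a b m n) ↔ Inc a b j m n := by
  have hv := inc_vertex a b j
  have h1 : OnLine a 0 (vertex a b j) := by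
    rw [vertex_eq_crossPt h]; exact onLine_crossPt_left h _ _
  have h2 : OnLine b (-(qq a b) * j) (vertex a b j) := by
    rw [vertex_eq_crossPt h]; exact onLine_crossPt_right h _ _
  constructor
  · rintro ⟨x, y, e⟩
    have h3 := onLine_crossPt_left h m n
    have h4 := onLine_crossPt_right h m n
    rw [e] at h3 h4
    rw [onLine_unique h3 (onLine_add x y h1), onLine_unique h4 (onLine_add x y h2)]
    exact inc_shift x y hv
  · intro hi
    obtain ⟨x, y, e1, e2⟩ := exists_shift hv hi
    refine ⟨x, y, (eq_crossPt h ?_ ?_).symm⟩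
    · rw [e1]; exact onLine_add x y h1
    · rw [e2]; exact onLine_add x y h2

/-- For lines of `a`, `b`, `c` with indices `m`, `n`, `k`: a determinant that vanishes iff the
three lines meet in a point. Its square is proportional to the area of the triangle. -/
def disc (a b c : Brane θ) (m n k : ℝ) : ℝ :=
  (a.α + m) * pp b c + (b.α + n) * pp c a + (c.α + k) * pp a b

/-- The product `p_ab p_bc p_ca`. -/
def pppCyc (a b c : Brane θ) : ℝ := pp a b * pp b c * pp c a

/-- The weight of a triangle whose three sides have determinant `D`. If `p_ab p_bc p_ca < 0`,
which holds when the degrees of the three corners add up to `1`, the first exponent is `ρ̂` times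
the area. -/
def triWeight (τ : ℂ) (a b c : Brane θ) (D : ℝ) : ℂ :=
  ee (rhoHat τ * ((-(D ^ 2 / (2 * pppCyc a b c)) : ℝ) : ℂ)) *
    ee ((-(D * (a.β * pp b c + b.β * pp c a + c.β * pp a b) / pppCyc a b c) : ℝ) : ℂ)

theorem disc_rotate (a b c : Brane θ) (m n k : ℝ) : disc b c a n k m = disc a b c m n k := by
  simp only [disc]; ring

theorem pppCyc_rotate (a b c : Brane θ) : pppCyc b c a = pppCyc a b c := by
  simp only [pppCyc]; ring

theorem triWeight_rotate (τ : ℂ) (a b c : Brane θ) (D : ℝ) :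
    triWeight τ b c a D = triWeight τ a b c D := by
  simp only [triWeight, pppCyc_rotate a b c]
  congr 4
  ring

theorem q_cyclic (a b c : Brane θ) :
    (a.q : ℝ) * pp b c + b.q * pp c a + c.q * pp a b = 0 := by
  simp only [pp_cast]; ring

theorem p_cyclic (a b c : Brane θ) :
    (a.p : ℝ) * pp b c + b.p * pp c a + c.p * pp a b = 0 := by
  simp only [pp_cast]; ring

/-- The side of the triangle on the line of `b`. -/
theorem crossPt_sub {a b c : Brane θ} (hab : pp a b ≠ 0) (hbc : pp b c ≠ 0) (m n k : ℝ) :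
    (crossPt b c n k).1 - (crossPt a b m n).1 =
      -(disc a b c m n k / (pp a b * pp b c)) * b.q ∧
    (crossPt b c n k).2 - (crossPt a b m n).2 =
      -(disc a b c m n k / (pp a b * pp b c)) * b.p := by
  have hab' : (pp a b : ℝ) ≠ 0 := by exact_mod_cast hab
  have hbc' : (pp b c : ℝ) ≠ 0 := by exact_mod_cast hbc
  simp only [crossPt, disc]
  constructor
  · field_simp
    linear_combination (b.α + n) * q_cyclic a b c
  · field_simp
    linear_combination (b.α + n) * p_cyclic a b c

theorem sideBeta_of_sub {a : Brane θ} {v w : ℝ × ℝ} {t : ℝ} (h1 : w.1 - v.1 = t * a.q)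
    (h2 : w.2 - v.2 = t * a.p) : sideBeta a v w = t * a.β := by
  have ha := a.rank_ne
  simp only [sideBeta]
  have e : w.1 + θ * w.2 - (v.1 + θ * v.2) = t * a.rank := by
    simp only [rank]
    linear_combination h1 + θ * h2
  rw [e]
  field_simp

/-- A triangle, up to translation, is determined by the index `k` of the line of `c`, once the
lines of `a` and `b` through the first vertex are fixed. -/
def triangleOfIndex {a b c : Brane θ} (hab : pp a b ≠ 0) (hbc : pp b c ≠ 0) (hac : pp a c ≠ 0)
    (j₁ j₂ j₃ : ℤ) (k : {k : ℤ // Inc b c j₂ (-(qq a b) * j₁) k ∧ Inc a c j₃ 0 k}) :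
    Triangle a b c j₁ j₂ j₃ :=
  ⟨(crossPt b c ((-(qq a b) * j₁ : ℤ) : ℝ) (k : ℤ), crossPt a c ((0 : ℤ) : ℝ) (k : ℤ)),
    (isLift_crossPt_iff hbc _ _ _).2 k.2.1, (isLift_crossPt_iff hac _ _ _).2 k.2.2,
    ⟨0, onLine_crossPt_left hac _ _, by
      rw [vertex_eq_crossPt hab]; exact onLine_crossPt_left hab _ _⟩,
    ⟨-(qq a b) * j₁, by
      rw [vertex_eq_crossPt hab]; exact onLine_crossPt_right hab _ _,
      onLine_crossPt_left hbc _ _⟩,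
    ⟨k, onLine_crossPt_right hbc _ _, onLine_crossPt_right hac _ _⟩⟩

theorem triangleOfIndex_bijective {a b c : Brane θ} (hab : pp a b ≠ 0) (hbc : pp b c ≠ 0)
    (hac : pp a c ≠ 0) (j₁ j₂ j₃ : ℤ) :
    Function.Bijective (triangleOfIndex hab hbc hac j₁ j₂ j₃) := by
  constructor
  · intro k k' e
    have e1 : crossPt b c ((-(qq a b) * j₁ : ℤ) : ℝ) (k : ℤ) =
        crossPt b c ((-(qq a b) * j₁ : ℤ) : ℝ) (k' : ℤ) := congrArg (fun t => t.1.1) e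
    have h := onLine_crossPt_right hbc (-(qq a b) * j₁) k
    rw [e1] at h
    exact Subtype.ext (onLine_unique h (onLine_crossPt_right hbc _ _))
  · rintro ⟨⟨v, w⟩, hv, hw, ⟨m, hm, hm'⟩, ⟨n, hn, hn'⟩, ⟨k, hk, hk'⟩⟩
    rw [vertex_eq_crossPt hab] at hm' hn
    obtain rfl := onLine_unique hm' (onLine_crossPt_left hab _ _)
    obtain rfl := onLine_unique hn (onLine_crossPt_right hab _ _)
    have ev := eq_crossPt hbc hn' hk
    have ew := eq_crossPt hac hm hk'
    dsimp only at ev ew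
    subst ev ew
    exact ⟨⟨k, (isLift_crossPt_iff hbc _ _ _).1 hv, (isLift_crossPt_iff hac _ _ _).1 hw⟩, rfl⟩

theorem weight_triangleOfIndex (τ : ℂ) {a b c : Brane θ} (hab : pp a b ≠ 0) (hbc : pp b c ≠ 0)
    (hac : pp a c ≠ 0) (hP : pppCyc a b c < 0) (j₁ j₂ j₃ : ℤ)
    (k : {k : ℤ // Inc b c j₂ (-(qq a b) * j₁) k ∧ Inc a c j₃ 0 k}) :
    weight τ a b c (triangleOfIndex hab hbc hac j₁ j₂ j₃ k) =
      triWeight τ a b c (disc a b c ((0 : ℤ) : ℝ) ((-(qq a b) * j₁ : ℤ) : ℝ) (k : ℤ)) := by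
  have hca : pp c a ≠ 0 := by rw [pp_swap a c]; simpa using hac
  have hab' : (pp a b : ℝ) ≠ 0 := by exact_mod_cast hab
  have hbc' : (pp b c : ℝ) ≠ 0 := by exact_mod_cast hbc
  have hca' : (pp c a : ℝ) ≠ 0 := by exact_mod_cast hca
  simp only [weight, triangleOfIndex]
  rw [vertex_eq_crossPt hab, ← crossPt_swap a c]
  set m : ℝ := ((0 : ℤ) : ℝ)
  set n : ℝ := ((-(qq a b) * j₁ : ℤ) : ℝ)
  set l : ℝ := ((k : ℤ) : ℝ)
  set D := disc a b c m n l with hD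
  obtain ⟨hb1, hb2⟩ := crossPt_sub hab hbc m n l
  obtain ⟨hc1, hc2⟩ := crossPt_sub hbc hca n l m
  obtain ⟨ha1, ha2⟩ := crossPt_sub hca hab l m n
  rw [disc_rotate a b c] at hc1 hc2
  rw [← disc_rotate c a b, ← hD] at ha1 ha2
  rw [← hD] at hb1 hb2 hc1 hc2
  have harea : area (crossPt a b m n) (crossPt b c n l) (crossPt c a l m) =
      -(D ^ 2 / (2 * pppCyc a b c)) := by
    have hw1 : (crossPt c a l m).1 - (crossPt a b m n).1 = D / (pp c a * pp a b) * a.q := by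
      linear_combination -ha1
    have hw2 : (crossPt c a l m).2 - (crossPt a b m n).2 = D / (pp c a * pp a b) * a.p := by
      linear_combination -ha2
    have hdet : -(D / (pp a b * pp b c)) * b.q * (D / (pp c a * pp a b) * a.p) -
        -(D / (pp a b * pp b c)) * b.p * (D / (pp c a * pp a b) * a.q) =
        D ^ 2 / pppCyc a b c := by
      simp only [pppCyc]
      field_simp
      rw [pp_cast a b]
      ring
    simp only [area]
    rw [hb1, hb2, hw1, hw2, hdet,
      abs_of_nonpos (div_nonpos_of_nonneg_of_nonpos (sq_nonneg D) hP.le)]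
    ring
  have hbeta : sideBeta a (crossPt c a l m) (crossPt a b m n) +
      sideBeta b (crossPt a b m n) (crossPt b c n l) +
      sideBeta c (crossPt b c n l) (crossPt c a l m) =
      -(D * (a.β * pp b c + b.β * pp c a + c.β * pp a b) / pppCyc a b c) := by
    rw [sideBeta_of_sub ha1 ha2, sideBeta_of_sub hb1 hb2, sideBeta_of_sub hc1 hc2]
    simp only [pppCyc]
    field_simp
    ring
  rw [harea, hbeta]
  rfl

/-- The integral parts of the determinants `disc` of all triangles with vertices labelled by
`j₁`, `j₂`, `j₃`. -/
def triSet (a b c : Brane θ) (j₁ j₂ j₃ : ℤ) : Set ℤ :=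
  {d | ∃ m n k : ℤ, Inc a b j₁ m n ∧ Inc b c j₂ n k ∧ Inc c a j₃ k m ∧
    d = m * pp b c + n * pp c a + k * pp a b}

/-- The sum of the weights of the triangles with labels `j₁` of `ab`, `j₂` of `bc`, `j₃` of
`ca`. -/
def thetaSum (τ : ℂ) (a b c : Brane θ) (j₁ j₂ j₃ : ℤ) : ℂ :=
  ∑' d : triSet a b c j₁ j₂ j₃, triWeight τ a b c (disc a b c 0 0 0 + ((d : ℤ) : ℝ))

theorem triSet_rotate (a b c : Brane θ) (j₁ j₂ j₃ : ℤ) :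
    triSet b c a j₂ j₃ j₁ = triSet a b c j₁ j₂ j₃ := by
  ext d
  constructor
  · rintro ⟨n, k, m, h1, h2, h3, e⟩
    exact ⟨m, n, k, h3, h1, h2, by rw [e]; ring⟩
  · rintro ⟨m, n, k, h1, h2, h3, e⟩
    exact ⟨n, k, m, h2, h3, h1, by rw [e]; ring⟩

/-- The cyclic symmetry of the product: triangles have no preferred corner. -/
theorem thetaSum_rotate (τ : ℂ) (a b c : Brane θ) (j₁ j₂ j₃ : ℤ) :
    thetaSum τ b c a j₂ j₃ j₁ = thetaSum τ a b c j₁ j₂ j₃ := by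
  simp only [thetaSum, triWeight_rotate τ a b c, disc_rotate a b c]
  rw [triSet_rotate]

theorem disc_add (a b c : Brane θ) (m n k : ℤ) :
    disc a b c m n k =
      disc a b c 0 0 0 + ((m * pp b c + n * pp c a + k * pp a b : ℤ) : ℝ) := by
  simp only [disc]
  push_cast
  ring

/-- A theta sum as a sum over the index of the line of `c`, the indices of the lines of `a` and
`b` being fixed in an arbitrary way compatible with the label `j₁`. -/
theorem thetaSum_eq_tsum (τ : ℂ) {a b c : Brane θ} (hab : pp a b ≠ 0) {j₁ : ℤ} (j₂ j₃ : ℤ)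
    {m n : ℤ} (h : Inc a b j₁ m n) :
    thetaSum τ a b c j₁ j₂ j₃ = ∑' k : {k : ℤ // Inc b c j₂ n k ∧ Inc c a j₃ k m},
      triWeight τ a b c (disc a b c m n (k : ℤ)) := by
  let f : {k : ℤ // Inc b c j₂ n k ∧ Inc c a j₃ k m} → triSet a b c j₁ j₂ j₃ := fun k =>
    ⟨m * pp b c + n * pp c a + k * pp a b, m, n, k, h, k.2.1, k.2.2, rfl⟩
  have hf : Function.Bijective f := by
    constructor
    · intro k k' e
      have e' : m * pp b c + n * pp c a + k * pp a b = m * pp b c + n * pp c a + k' * pp a b :=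
        congrArg Subtype.val e
      exact Subtype.ext (mul_right_cancel₀ hab (add_left_cancel e'))
    · rintro ⟨d, m', n', k', h1, h2, h3, e⟩
      obtain ⟨x, y, e1, e2⟩ := exists_shift h1 h
      refine ⟨⟨k' + shiftIdx c x y, ?_, ?_⟩, Subtype.ext ?_⟩
      · rw [e2]; exact inc_shift x y h2
      · rw [e1]; exact inc_shift x y h3
      · simp only [f]
        rw [e, e1, e2]
        simp only [shiftIdx, pp_eq]
        ring
  rw [thetaSum, ← (Equiv.ofBijective f hf).tsum_eq]
  refine tsum_congr fun k => ?_
  rw [disc_add]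
  rfl

/-- The sign of `p_ab p_bc p_ca` makes the absolute value in the area a negation. The third label is
that of `v_ac^{j₃}` seen as a point of `ca`. -/
theorem structureConst_eq_thetaSum (τ : ℂ) {a b c : Brane θ} (hab : pp a b ≠ 0)
    (hbc : pp b c ≠ 0) (hac : pp a c ≠ 0) (hP : pppCyc a b c < 0) (j₁ j₂ j₃ : ℤ) :
    structureConst τ a b c j₁ j₂ j₃ = thetaSum τ a b c j₁ j₂ (-(qq a c) * j₃) := by
  rw [structureConst, if_neg hab, if_neg hbc, if_neg hac,
    thetaSum_eq_tsum τ hab _ _ (inc_vertex a b j₁),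
    ← (Equiv.ofBijective _ (triangleOfIndex_bijective hab hbc hac j₁ j₂ j₃)).tsum_eq]
  rw [← (Equiv.subtypeEquivRight fun k => and_congr_right fun _ => inc_swap_label).tsum_eq]
  exact tsum_congr fun k => weight_triangleOfIndex τ hab hbc hac hP j₁ j₂ j₃ _

/-! ### Areas and phases as sums over the edges of a polygon -/

theorem ee_add (z w : ℂ) : ee (z + w) = ee z * ee w := by
  simp only [ee]
  rw [← Complex.exp_add]
  ring_nf

theorem norm_ee (z : ℂ) : ‖ee z‖ = Real.exp (-(2 * Real.pi * z.im)) := by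
  rw [ee, Complex.norm_exp]
  congr 1
  simp

theorem ee_zero : ee 0 = 1 := by simp [ee]

/-- The coordinate `X = x₁ + θ x₂` of the intersection of the line of `a` with index `m` and the
line of `b` with index `n`. -/
def crossX (a b : Brane θ) (m n : ℝ) : ℝ := (icpt a m - icpt b n) / (b.slope - a.slope)

/-- The signed area between the lines of `a` and `b`, from their intersection up to `X`. -/
def edgeArea (a b : Brane θ) (m n X : ℝ) : ℝ := (b.slope - a.slope) / 2 * (X - crossX a b m n) ^ 2

/-- The contribution of the corner of the lines of `a` and `b` to the integral of the flat
connections along the boundary of a polygon. -/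
def edgePhase (a b : Brane θ) (m n X : ℝ) : ℝ := ββ a b * (X - crossX a b m n)

theorem crossX_swap (a b : Brane θ) (m n : ℝ) : crossX b a n m = crossX a b m n := by
  rw [crossX, crossX, ← neg_sub b.slope, ← neg_sub (icpt a m), neg_div_neg_eq]

theorem edgeArea_swap (a b : Brane θ) (m n X : ℝ) :
    edgeArea b a n m X = -edgeArea a b m n X := by
  simp only [edgeArea, crossX_swap a b]; ring

theorem edgePhase_swap (a b : Brane θ) (m n X : ℝ) :
    edgePhase b a n m X = -edgePhase a b m n X := by
  simp only [edgePhase, crossX_swap a b, ββ]; ring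

theorem edgeArea_sum_aux {u v i₁ i₂ i₃ X : ℝ} (hu : u ≠ 0) (hv : v ≠ 0) (huv : u + v ≠ 0) :
    u / 2 * (X - (i₁ - i₂) / u) ^ 2 + v / 2 * (X - (i₂ - i₃) / v) ^ 2 +
      -(u + v) / 2 * (X - (i₃ - i₁) / -(u + v)) ^ 2 =
    -((i₁ * v + i₂ * -(u + v) + i₃ * u) ^ 2 / (2 * (u * v * -(u + v)))) := by
  field_simp
  ring

theorem edgePhase_sum_aux {u v i₁ i₂ i₃ b₁ b₂ b₃ X : ℝ} (hu : u ≠ 0) (hv : v ≠ 0)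
    (huv : u + v ≠ 0) :
    (b₂ - b₁) * (X - (i₁ - i₂) / u) + (b₃ - b₂) * (X - (i₂ - i₃) / v) +
      (b₁ - b₃) * (X - (i₃ - i₁) / -(u + v)) =
    -((i₁ * v + i₂ * -(u + v) + i₃ * u) * (b₁ * v + b₂ * -(u + v) + b₃ * u) /
      (u * v * -(u + v))) := by
  field_simp
  ring

theorem disc_eq_slope (a b c : Brane θ) (m n k : ℝ) :
    disc a b c m n k = a.rank * b.rank * c.rank *
      (icpt a m * (c.slope - b.slope) + icpt b n * (a.slope - c.slope) +
        icpt c k * (b.slope - a.slope)) := by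
  have ha := a.rank_ne
  have hb := b.rank_ne
  have hc := c.rank_ne
  simp only [disc, icpt, pp_eq_slope]
  field_simp

theorem pppCyc_eq_slope (a b c : Brane θ) :
    pppCyc a b c = (a.rank * b.rank * c.rank) ^ 2 *
      ((b.slope - a.slope) * (c.slope - b.slope) * (a.slope - c.slope)) := by
  simp only [pppCyc, pp_eq_slope]
  ring

theorem slope_sub_ne {a b : Brane θ} (h : pp a b ≠ 0) : b.slope - a.slope ≠ 0 :=
  (pp_ne_iff a b).1 h

/-- The area of a triangle is a sum over its corners, for every choice of the base point `X`. -/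
theorem edgeArea_sum {a b c : Brane θ} (hab : pp a b ≠ 0) (hbc : pp b c ≠ 0) (hac : pp a c ≠ 0)
    (m n k X : ℝ) :
    edgeArea a b m n X + edgeArea b c n k X + edgeArea c a k m X =
      -(disc a b c m n k ^ 2 / (2 * pppCyc a b c)) := by
  have ha := a.rank_ne
  have hb := b.rank_ne
  have hc := c.rank_ne
  have hu := slope_sub_ne hab
  have hv := slope_sub_ne hbc
  have e : a.slope - c.slope = -((b.slope - a.slope) + (c.slope - b.slope)) := by ring
  have huv : (b.slope - a.slope) + (c.slope - b.slope) ≠ 0 := by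
    have := slope_sub_ne hac
    contrapose! this
    linarith
  have key := edgeArea_sum_aux (X := X) (i₁ := icpt a m) (i₂ := icpt b n) (i₃ := icpt c k) hu hv huv
  rw [← e] at key
  simp only [edgeArea, crossX]
  rw [key, disc_eq_slope, pppCyc_eq_slope]
  rw [mul_pow, mul_left_comm 2 ((a.rank * b.rank * c.rank) ^ 2), mul_div_mul_left]
  positivity

theorem edgePhase_sum {a b c : Brane θ} (hab : pp a b ≠ 0) (hbc : pp b c ≠ 0) (hac : pp a c ≠ 0)
    (m n k X : ℝ) :
    edgePhase a b m n X + edgePhase b c n k X + edgePhase c a k m X =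
      -(disc a b c m n k * (a.β * pp b c + b.β * pp c a + c.β * pp a b) / pppCyc a b c) := by
  have ha := a.rank_ne
  have hb := b.rank_ne
  have hc := c.rank_ne
  have hu := slope_sub_ne hab
  have hv := slope_sub_ne hbc
  have e : a.slope - c.slope = -((b.slope - a.slope) + (c.slope - b.slope)) := by ring
  have huv : (b.slope - a.slope) + (c.slope - b.slope) ≠ 0 := by
    have := slope_sub_ne hac
    contrapose! this
    linarith
  have key := edgePhase_sum_aux (X := X) (i₁ := icpt a m) (i₂ := icpt b n) (i₃ := icpt c k)
    (b₁ := a.β / a.rank) (b₂ := b.β / b.rank) (b₃ := c.β / c.rank) hu hv huv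
  rw [← e] at key
  have hB : a.β * pp b c + b.β * pp c a + c.β * pp a b = a.rank * b.rank * c.rank *
      (a.β / a.rank * (c.slope - b.slope) + b.β / b.rank * (a.slope - c.slope) +
        c.β / c.rank * (b.slope - a.slope)) := by
    simp only [pp_eq_slope]
    field_simp
  simp only [edgePhase, crossX, ββ]
  rw [key, disc_eq_slope, pppCyc_eq_slope, hB, mul_mul_mul_comm, ← sq, mul_div_mul_left]
  positivity

/-- The base point `X` is arbitrary. With `X = 0` this shows the associativity of theta sums, with
`X` the variable of a Heisenberg module it relates them to Gaussians. -/
theorem triWeight_eq_edges (τ : ℂ) {a b c : Brane θ} (hab : pp a b ≠ 0) (hbc : pp b c ≠ 0)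
    (hac : pp a c ≠ 0) (m n k X : ℝ) :
    triWeight τ a b c (disc a b c m n k) =
      ee (rhoHat τ * ((edgeArea a b m n X + edgeArea b c n k X + edgeArea c a k m X : ℝ) : ℂ) +
        ((edgePhase a b m n X + edgePhase b c n k X + edgePhase c a k m X : ℝ) : ℂ)) := by
  rw [edgeArea_sum hab hbc hac, edgePhase_sum hab hbc hac, ee_add]
  rfl

/-- The two ways to cut a quadrilateral into two triangles. -/
theorem triWeight_mul_triWeight (τ : ℂ) {a b c d : Brane θ} (hab : pp a b ≠ 0)
    (hbc : pp b c ≠ 0) (hac : pp a c ≠ 0) (hcd : pp c d ≠ 0) (had : pp a d ≠ 0)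
    (hbd : pp b d ≠ 0) (m n k l : ℝ) :
    triWeight τ a b c (disc a b c m n k) * triWeight τ a c d (disc a c d m k l) =
      triWeight τ a b d (disc a b d m n l) * triWeight τ b c d (disc b c d n k l) := by
  rw [triWeight_eq_edges τ hab hbc hac m n k 0, triWeight_eq_edges τ hac hcd had m k l 0,
    triWeight_eq_edges τ hab hbd had m n l 0, triWeight_eq_edges τ hbc hcd hbd n k l 0,
    ← ee_add, ← ee_add, edgeArea_swap a c, edgePhase_swap a c, edgeArea_swap b d,
    edgePhase_swap b d]
  congr 1
  push_cast
  ring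

/-! ### Convergence of theta sums -/

theorem rhoHat_im_pos {τ : ℂ} (hτ : 0 < τ.im) : 0 < (rhoHat τ).im := by
  have h : rhoHat τ = -τ⁻¹ := by rw [rhoHat]; ring
  have hτ0 : τ ≠ 0 := by rintro rfl; simp at hτ
  rw [h, Complex.neg_im, Complex.inv_im, neg_div, neg_neg]
  exact div_pos hτ (Complex.normSq_pos.2 hτ0)

theorem norm_triWeight (τ : ℂ) (a b c : Brane θ) (D : ℝ) :
    ‖triWeight τ a b c D‖ =
      Real.exp (-(Real.pi * (rhoHat τ).im / (-pppCyc a b c)) * D ^ 2) := by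
  rw [triWeight, norm_mul, norm_ee, norm_ee, ← Real.exp_add]
  congr 1
  rw [Complex.ofReal_im, Complex.im_mul_ofReal]
  field_simp
  ring

theorem summable_exp_neg_mul_sq_int {c : ℝ} (hc : 0 < c) :
    Summable fun k : ℤ => Real.exp (-c * (k : ℝ) ^ 2) := by
  have h := summable_pow_mul_jacobiTheta₂_term_bound 0 (div_pos hc Real.pi_pos) 0
  refine h.congr fun k => ?_
  simp only [pow_zero, one_mul]
  congr 1
  field_simp
  push_cast
  ring

/-- Sums of a Gaussian over the translates of a lattice are bounded uniformly. -/
theorem exists_bound_tsum_exp {c κ : ℝ} (hc : 0 < c) (hκ : κ ≠ 0) :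
    ∃ M : ℝ, ∀ l : ℝ, (Summable fun k : ℤ => Real.exp (-c * (κ * k + l) ^ 2)) ∧
      ∑' k : ℤ, Real.exp (-c * (κ * k + l) ^ 2) ≤ M := by
  have hs := summable_exp_neg_mul_sq_int (c := c * κ ^ 2 / 2) (by positivity)
  have hs' := hs.mul_left (Real.exp (c * κ ^ 2))
  refine ⟨∑' k : ℤ, Real.exp (c * κ ^ 2) * Real.exp (-(c * κ ^ 2 / 2) * (k : ℝ) ^ 2),
    fun l => ?_⟩
  set k₀ : ℤ := ⌊l / κ⌋ with hk₀
  -- translation by `k₀` reduces to `0 ≤ l / κ < 1`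
  have hle : ∀ k : ℤ, Real.exp (-c * (κ * ((k - k₀ : ℤ) : ℝ) + l) ^ 2) ≤
      Real.exp (c * κ ^ 2) * Real.exp (-(c * κ ^ 2 / 2) * (k : ℝ) ^ 2) := by
    intro k
    rw [← Real.exp_add]
    apply Real.exp_le_exp.2
    set f := l / κ - k₀ with hf
    have hf0 : 0 ≤ f := by rw [hf, hk₀]; exact Int.fract_nonneg _
    have hf1 : f < 1 := by rw [hf, hk₀]; exact Int.fract_lt_one _
    have hl : κ * ((k - k₀ : ℤ) : ℝ) + l = κ * (k + f) := by
      rw [hf]; push_cast; field_simp; ring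
    rw [hl]
    have h1 : (k : ℝ) ^ 2 / 2 - 1 ≤ (k + f) ^ 2 := by
      have : f ^ 2 ≤ 1 := by nlinarith
      nlinarith [sq_nonneg ((k : ℝ) + 2 * f)]
    have h2 : 0 ≤ c * κ ^ 2 := by positivity
    nlinarith [mul_le_mul_of_nonneg_left h1 h2]
  have hsum : Summable fun k : ℤ => Real.exp (-c * (κ * ((k - k₀ : ℤ) : ℝ) + l) ^ 2) :=
    hs'.of_nonneg_of_le (fun _ => (Real.exp_pos _).le) hle
  have e := (Equiv.subRight k₀).tsum_eq fun k : ℤ => Real.exp (-c * (κ * (k : ℝ) + l) ^ 2)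
  refine ⟨(Equiv.subRight k₀).summable_iff.1 hsum, ?_⟩
  rw [← e]
  exact hsum.tsum_le_tsum hle hs'

theorem disc_linear_right (a b c : Brane θ) (m n k : ℝ) :
    disc a b c m n k = pp a b * k + disc a b c m n 0 := by
  simp only [disc]; ring

theorem weight_exponent_pos {τ : ℂ} (hτ : 0 < τ.im) {a b c : Brane θ} (hP : pppCyc a b c < 0) :
    0 < Real.pi * (rhoHat τ).im / (-pppCyc a b c) :=
  div_pos (mul_pos Real.pi_pos (rhoHat_im_pos hτ)) (neg_pos.2 hP)

theorem exists_bound_tsum_triWeight {τ : ℂ} (hτ : 0 < τ.im) {a b c : Brane θ} (hab : pp a b ≠ 0)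
    (hP : pppCyc a b c < 0) : ∃ M : ℝ, ∀ m n : ℝ,
      (Summable fun k : ℤ => ‖triWeight τ a b c (disc a b c m n k)‖) ∧
      ∑' k : ℤ, ‖triWeight τ a b c (disc a b c m n k)‖ ≤ M := by
  have hab' : (pp a b : ℝ) ≠ 0 := by exact_mod_cast hab
  obtain ⟨M, hM⟩ := exists_bound_tsum_exp (weight_exponent_pos hτ hP) hab'
  refine ⟨M, fun m n => ?_⟩
  have e : ∀ k : ℤ, ‖triWeight τ a b c (disc a b c m n k)‖ = _ := fun k => by
    rw [norm_triWeight, disc_linear_right a b c m n k]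
  simp only [e]
  exact hM _

theorem summable_triWeight {τ : ℂ} (hτ : 0 < τ.im) {a b c : Brane θ} (hab : pp a b ≠ 0)
    (hP : pppCyc a b c < 0) (m n : ℝ) :
    Summable fun k : ℤ => ‖triWeight τ a b c (disc a b c m n k)‖ :=
  ((exists_bound_tsum_triWeight hτ hab hP).choose_spec m n).1

theorem summable_triWeight_mul_triWeight {τ : ℂ} (hτ : 0 < τ.im) {a b c d : Brane θ}
    (hab : pp a b ≠ 0) (hac : pp a c ≠ 0) (hP : pppCyc a b c < 0) (hP' : pppCyc a c d < 0)
    (m n : ℝ) : Summable fun x : ℤ × ℤ => triWeight τ a b c (disc a b c m n x.1) *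
      triWeight τ a c d (disc a c d m x.1 x.2) := by
  obtain ⟨M, hM⟩ := exists_bound_tsum_triWeight hτ hac hP'
  refine Summable.of_norm ?_
  simp only [norm_mul]
  rw [summable_prod_of_nonneg fun _ => mul_nonneg (norm_nonneg _) (norm_nonneg _)]
  dsimp only
  refine ⟨fun k => (hM m k).1.mul_left _, ?_⟩
  simp only [tsum_mul_left]
  refine ((summable_triWeight hτ hab hP m n).mul_right M).of_nonneg_of_le
    (fun k => mul_nonneg (norm_nonneg _) (tsum_nonneg fun _ => norm_nonneg _)) fun k => ?_
  exact mul_le_mul_of_nonneg_left (hM m k).2 (norm_nonneg _)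

/-! ### Associativity of theta sums -/

theorem tsum_subtype_eq_tsum_ite {α : Type*} (p : α → Prop) [DecidablePred p] (f : α → ℂ) :
    ∑' k : {k // p k}, f k = ∑' k, if p k then f k else 0 :=
  (tsum_subtype {k | p k} f).trans (tsum_congr fun k => by simp [Set.indicator_apply])

theorem tsum_subtype_congr {p p' : ℤ → Prop} (h : ∀ k, p k ↔ p' k) (f : ℝ → ℂ) :
    ∑' k : {k // p k}, f ((k : ℤ) : ℝ) = ∑' k : {k // p' k}, f ((k : ℤ) : ℝ) :=
  (Equiv.subtypeEquivRight h).tsum_eq fun k : {k // p' k} => f ((k : ℤ) : ℝ)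

/-- The label of the inner corner is determined by the index of the third line, so summing over
the label removes the constraint. -/
theorem sum_tsum_mul_of_existsUnique {ι : Type*} [Fintype ι] {A : ℤ → Prop} {L : ι → ℤ → Prop}
    (hL : ∀ k, ∃! j, L j k) {T R : ℤ → ℂ} {S : ι → ℂ} (hS : ∀ j k, L j k → A k → S j = R k)
    (hT : Summable fun k => ‖T k‖) :
    ∑ j, (∑' k : {k : ℤ // A k ∧ L j k}, T k) * S j = ∑' k : {k : ℤ // A k}, T k * R k := by
  classical
  have h1 : ∀ j, (∑' k : {k : ℤ // A k ∧ L j k}, T k) * S j =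
      ∑' k : ℤ, if A k ∧ L j k then T k * S j else 0 := by
    intro j
    rw [← tsum_mul_right]
    exact tsum_subtype_eq_tsum_ite (fun k : ℤ => A k ∧ L j k) fun k => T k * S j
  have hsum : ∀ j, Summable fun k : ℤ => if A k ∧ L j k then T k * S j else 0 := by
    intro j
    refine (hT.mul_right ‖S j‖).of_norm_bounded fun k => ?_
    split_ifs
    · rw [norm_mul]
    · rw [norm_zero]; positivity
  have h2 : ∑' k : {k : ℤ // A k}, T k * R k = ∑' k : ℤ, if A k then T k * R k else 0 :=
    tsum_subtype_eq_tsum_ite (fun k : ℤ => A k) fun k => T k * R k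
  rw [Finset.sum_congr rfl fun j _ => h1 j, h2, ← Summable.tsum_finsetSum fun j _ => hsum j]
  refine tsum_congr fun k => ?_
  by_cases hA : A k
  · obtain ⟨j, hj, huniq⟩ := hL k
    rw [Finset.sum_eq_single j]
    · rw [if_pos ⟨hA, hj⟩, if_pos hA, hS j k hj hA]
    · intro j' _ hne
      exact if_neg fun h => hne (huniq j' h.2)
    · simp
  · simp [hA]

theorem tsum_subtype_tsum_subtype_comm {A B : ℤ → Prop} {G : ℤ → ℤ → Prop} {F : ℤ → ℤ → ℂ}
    (hF : Summable fun x : ℤ × ℤ => F x.1 x.2) :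
    ∑' k : {k : ℤ // A k}, ∑' l : {l : ℤ // G k l ∧ B l}, F k l =
      ∑' l : {l : ℤ // B l}, ∑' k : {k : ℤ // A k ∧ G k l}, F k l := by
  classical
  have h1 : ∀ k : ℤ, ∑' l : {l : ℤ // G k l ∧ B l}, F k l =
      ∑' l : ℤ, if G k l ∧ B l then F k l else 0 := fun k =>
    tsum_subtype_eq_tsum_ite (fun l : ℤ => G k l ∧ B l) fun l => F k l
  have h2 : ∀ l : ℤ, ∑' k : {k : ℤ // A k ∧ G k l}, F k l =
      ∑' k : ℤ, if A k ∧ G k l then F k l else 0 := fun l =>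
    tsum_subtype_eq_tsum_ite (fun k : ℤ => A k ∧ G k l) fun k => F k l
  simp only [h1, h2]
  have h3 : ∑' k : {k : ℤ // A k}, ∑' l : ℤ, (if G k l ∧ B l then F k l else 0) =
      ∑' k : ℤ, if A k then ∑' l : ℤ, (if G k l ∧ B l then F k l else 0) else 0 :=
    tsum_subtype_eq_tsum_ite (fun k : ℤ => A k) fun k =>
      ∑' l : ℤ, (if G k l ∧ B l then F k l else 0)
  have h4 : ∑' l : {l : ℤ // B l}, ∑' k : ℤ, (if A k ∧ G k l then F k l else 0) =
      ∑' l : ℤ, if B l then ∑' k : ℤ, (if A k ∧ G k l then F k l else 0) else 0 :=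
    tsum_subtype_eq_tsum_ite (fun l : ℤ => B l) fun l =>
      ∑' k : ℤ, (if A k ∧ G k l then F k l else 0)
  rw [h3, h4]
  have h5 : ∀ k : ℤ, (if A k then ∑' l : ℤ, (if G k l ∧ B l then F k l else 0) else 0) =
      ∑' l : ℤ, if A k ∧ G k l ∧ B l then F k l else 0 := by
    intro k
    by_cases h : A k <;> simp [h]
  have h6 : ∀ l : ℤ, (if B l then ∑' k : ℤ, (if A k ∧ G k l then F k l else 0) else 0) =
      ∑' k : ℤ, if A k ∧ G k l ∧ B l then F k l else 0 := by
    intro l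
    by_cases h : B l <;> simp [h]
  simp only [h5, h6]
  refine Summable.tsum_comm (f := fun l k => if A k ∧ G k l ∧ B l then F k l else 0) ?_
  refine ((Equiv.prodComm ℤ ℤ).summable_iff (f := fun x : ℤ × ℤ =>
    if A x.1 ∧ G x.1 x.2 ∧ B x.2 then F x.1 x.2 else 0)).2 ?_
  refine (hF.norm).of_norm_bounded fun x => ?_
  split_ifs
  · exact le_rfl
  · rw [norm_zero]; exact norm_nonneg _

/-- The equality of the two sums over the ways to build a quadrilateral with labels `j₁`, `j₂`,
`j₃`, `j₄` of `ab`, `bc`, `cd`, `da` from two triangles. -/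
theorem thetaSum_assoc {τ : ℂ} (hτ : 0 < τ.im) {a b c d : Brane θ} (hab : pp a b ≠ 0)
    (hbc : pp b c ≠ 0) (hac : pp a c ≠ 0) (hcd : pp c d ≠ 0) (had : pp a d ≠ 0)
    (hbd : pp b d ≠ 0) (h₁ : pppCyc a b c < 0) (h₂ : pppCyc a c d < 0) (h₃ : pppCyc a b d < 0)
    {ι κ : Type*} [Fintype ι] [Fintype κ] {num : ι → ℤ} {num' : κ → ℤ}
    (hnum : ∀ i, ∃! j, i ≡ num j [ZMOD pp a c]) (hnum' : ∀ i, ∃! j, i ≡ num' j [ZMOD pp b d])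
    (j₁ j₂ j₃ j₄ : ℤ) :
    ∑ j, thetaSum τ a b c j₁ j₂ (-(qq a c) * num j) * thetaSum τ a c d (num j) j₃ j₄ =
      ∑ j, thetaSum τ a b d j₁ (num' j) j₄ * thetaSum τ b c d j₂ j₃ (-(qq b d) * num' j) := by
  obtain ⟨m, n, hmn⟩ : ∃ m n, Inc a b j₁ m n := ⟨_, _, inc_vertex a b j₁⟩
  have hca : pp c a ≠ 0 := by rw [pp_swap a c]; simpa using hac
  have hdb : pp d b ≠ 0 := by rw [pp_swap b d]; simpa using hbd
  have hL : ∀ k, ∃! j, Inc a c (num j) m k := fun k => by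
    simpa only [inc_iff_modEq] using hnum (m - rr a c * k)
  have hL' : ∀ l, ∃! j, Inc b d (num' j) n l := fun l => by
    simpa only [inc_iff_modEq] using hnum' (n - rr b d * l)
  have e1 : ∀ j, thetaSum τ a b c j₁ j₂ (-(qq a c) * num j) =
      ∑' k : {k : ℤ // Inc b c j₂ n k ∧ Inc a c (num j) m k},
        triWeight τ a b c (disc a b c m n (k : ℤ)) := fun j => by
    rw [thetaSum_eq_tsum τ hab _ _ hmn]
    exact tsum_subtype_congr (fun k => and_congr_right fun _ => inc_swap_label)
      (fun k => triWeight τ a b c (disc a b c m n k))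
  have e2 : ∀ j k, Inc a c (num j) m k → Inc b c j₂ n k → thetaSum τ a c d (num j) j₃ j₄ =
      ∑' l : {l : ℤ // Inc c d j₃ k l ∧ Inc d a j₄ l m},
        triWeight τ a c d (disc a c d m k (l : ℤ)) := fun j k h _ =>
    thetaSum_eq_tsum τ hac _ _ h
  have e3 : ∀ j, thetaSum τ a b d j₁ (num' j) j₄ =
      ∑' l : {l : ℤ // Inc d a j₄ l m ∧ Inc b d (num' j) n l},
        triWeight τ a b d (disc a b d m n (l : ℤ)) := fun j => by
    rw [thetaSum_eq_tsum τ hab _ _ hmn]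
    exact tsum_subtype_congr (fun l => and_comm)
      (fun l => triWeight τ a b d (disc a b d m n l))
  have e4 : ∀ j l, Inc b d (num' j) n l → Inc d a j₄ l m →
      thetaSum τ b c d j₂ j₃ (-(qq b d) * num' j) =
      ∑' k : {k : ℤ // Inc b c j₂ n k ∧ Inc c d j₃ k l},
        triWeight τ b c d (disc b c d n (k : ℤ) l) := fun j l h _ => by
    rw [← thetaSum_rotate, ← thetaSum_rotate, thetaSum_eq_tsum τ hdb _ _ (inc_swap_label.2 h)]
    refine tsum_congr fun k => ?_
    rw [← triWeight_rotate τ d b c, ← disc_rotate d b c]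
  rw [Finset.sum_congr rfl fun j _ => by rw [e1 j],
    sum_tsum_mul_of_existsUnique hL e2 (summable_triWeight hτ hab h₁ m n),
    Finset.sum_congr rfl fun j _ => by rw [e3 j],
    sum_tsum_mul_of_existsUnique hL' e4 (summable_triWeight hτ hab h₃ m n)]
  simp only [← tsum_mul_left]
  rw [tsum_subtype_tsum_subtype_comm (A := fun k => Inc b c j₂ n k) (B := fun l => Inc d a j₄ l m)
    (G := fun k l => Inc c d j₃ k l)
    (F := fun k l => triWeight τ a b c (disc a b c m n k) * triWeight τ a c d (disc a c d m k l))
    (summable_triWeight_mul_triWeight hτ hab hac h₁ h₂ m n)]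
  exact tsum_congr fun l => tsum_congr fun k =>
    triWeight_mul_triWeight τ hab hbc hac hcd had hbd m n k l

/-! ### The laws of the Fukaya category -/

/-- The labels `j` of `ab` and `j'` of `ba` belong to the same intersection point. -/
def Adj (a b : Brane θ) (j j' : ℤ) : Prop := j' ≡ -(qq a b) * j [ZMOD pp a b]

theorem adj_symm {a b : Brane θ} {j j' : ℤ} (h : Adj a b j j') : Adj b a j' j :=
  (inc_swap_iff (inc_swap (inc_vertex a b j) h)).1 (inc_vertex a b j)

theorem adj_comm {a b : Brane θ} {j j' : ℤ} : Adj a b j j' ↔ Adj b a j' j :=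
  ⟨adj_symm, adj_symm⟩

theorem adj_zero (a b : Brane θ) : Adj a b 0 0 := by simp [Adj, Int.ModEq.refl]

theorem thetaSum_congr_right (τ : ℂ) {a b c : Brane θ} {j₁ j₂ j₃ j₃' : ℤ}
    (h : j₃ ≡ j₃' [ZMOD pp c a]) : thetaSum τ a b c j₁ j₂ j₃ = thetaSum τ a b c j₁ j₂ j₃' := by
  have e : triSet a b c j₁ j₂ j₃ = triSet a b c j₁ j₂ j₃' := by
    ext d
    simp only [triSet, inc_congr h]
  simp only [thetaSum]
  rw [e]

section Labels

variable {Ob : Type*} {obj : Ob → Brane θ} {a b c d : Ob} {k l m n : ℤ}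

theorem HasDegree.eq_zero_or_one (h : HasDegree obj a b k) : k = 0 ∨ k = 1 := by
  rcases h with ⟨_, h⟩ | ⟨_, h⟩ | ⟨_, h⟩
  · exact Or.inl h
  · exact Or.inr h
  · exact h

theorem HasDegree.eq_of_pp_eq_zero (h : HasDegree obj a b k) (hp : pp (obj a) (obj b) = 0) :
    a = b := by
  rcases h with ⟨h, _⟩ | ⟨h, _⟩ | ⟨h, _⟩
  · rw [mu_pos_iff] at h; omega
  · rw [mu_neg_iff] at h; omega
  · exact h

theorem hasDegree_iff (hp : pp (obj a) (obj b) ≠ 0) : HasDegree obj a b k ↔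
    (0 < pp (obj a) (obj b) ∧ k = 0) ∨ (pp (obj a) (obj b) < 0 ∧ k = 1) := by
  have : a ≠ b := by rintro rfl; exact hp (pp_self _)
  simp [HasDegree, mu_pos_iff, mu_neg_iff, this]

theorem HasDegree.swap (h : HasDegree obj a b k) (hkl : k + l = 1) : HasDegree obj b a l := by
  by_cases hp : pp (obj a) (obj b) = 0
  · have hab := h.eq_of_pp_eq_zero hp
    have := h.eq_zero_or_one
    exact Or.inr (Or.inr ⟨hab.symm, by omega⟩)
  · rw [hasDegree_iff hp] at h
    have hs := pp_swap (obj a) (obj b)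
    rw [hasDegree_iff (by omega)]
    omega

theorem Label.num_injective : Function.Injective (Label.num : Label obj a b k → ℤ) := by
  intro j j' h
  exact Subtype.ext (Fin.ext (by simpa [Label.num] using h))

theorem Label.num_eq_zero (hp : pp (obj a) (obj b) = 0) (j : Label obj a b k) : j.num = 0 := by
  have h1 : numLabels (obj a) (obj b) = 1 := if_pos hp
  have h2 := j.1.2
  simp only [Label.num]
  omega

/-- A label seen as a label of another degree or of an equal pair of objects. -/
theorem Label.exists_num_eq (j : Label obj a b k) (h : HasDegree obj a b l) :
    ∃ j' : Label obj a b l, j'.num = j.num := ⟨⟨j.1, h⟩, rfl⟩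

/-- For `p_ab = 0` congruence is equality and `0` is the only label. -/
theorem existsUnique_num (h : HasDegree obj a b k) (i : ℤ)
    (hi : pp (obj a) (obj b) = 0 → i = 0) :
    ∃! j : Label obj a b k, i ≡ j.num [ZMOD pp (obj a) (obj b)] := by
  by_cases hp : pp (obj a) (obj b) = 0
  · have h1 : numLabels (obj a) (obj b) = 1 := if_pos hp
    refine ⟨⟨⟨0, by omega⟩, h⟩, ?_, fun j _ => Label.num_injective ?_⟩
    · rw [hi hp]; rfl
    · rw [Label.num_eq_zero hp, Label.num_eq_zero hp]
  · have h1 : numLabels (obj a) (obj b) = (pp (obj a) (obj b)).natAbs := if_neg hp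
    obtain ⟨j, hj, hu⟩ := existsUnique_label hp i
    refine ⟨⟨⟨j, by rw [h1]; exact j.2⟩, h⟩, hj, fun j' hj' => Label.num_injective ?_⟩
    have := hu ⟨j'.1, by rw [← h1]; exact j'.1.2⟩ hj'
    simp only [Label.num, ← this]

theorem existsUnique_adj (h : HasDegree obj a b k) (i : ℤ)
    (hi : pp (obj a) (obj b) = 0 → i = 0) :
    ∃! j : Label obj a b k, Adj (obj a) (obj b) j.num i := by
  have key : ∀ j : Label obj a b k, Adj (obj a) (obj b) j.num i ↔
      -(qq (obj b) (obj a)) * i ≡ j.num [ZMOD pp (obj a) (obj b)] := by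
    intro j
    rw [adj_comm, Adj, pp_swap, Int.modEq_neg, Int.modEq_comm]
  simp only [key]
  exact existsUnique_num h _ fun hp => by rw [hi hp, mul_zero]

/-- If the degrees of three corners add up to `1`, exactly one of them is `1`, so exactly one of
the three integers is negative. -/
theorem pppCyc_neg (h₁ : HasDegree obj a b k) (h₂ : HasDegree obj b c l)
    (h₃ : HasDegree obj c a m) (hdeg : k + l + m = 1) (hab : pp (obj a) (obj b) ≠ 0)
    (hbc : pp (obj b) (obj c) ≠ 0) (hca : pp (obj c) (obj a) ≠ 0) :
    pppCyc (obj a) (obj b) (obj c) < 0 := by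
  rw [hasDegree_iff hab] at h₁
  rw [hasDegree_iff hbc] at h₂
  rw [hasDegree_iff hca] at h₃
  have key : pp (obj a) (obj b) * pp (obj b) (obj c) * pp (obj c) (obj a) < 0 := by
    rcases h₁ with ⟨h₁, rfl⟩ | ⟨h₁, rfl⟩ <;> rcases h₂ with ⟨h₂, rfl⟩ | ⟨h₂, rfl⟩ <;>
      rcases h₃ with ⟨h₃, rfl⟩ | ⟨h₃, rfl⟩ <;> first | omega | skip
    · exact mul_neg_of_pos_of_neg (mul_pos h₁ h₂) h₃
    · exact mul_neg_of_neg_of_pos (mul_neg_of_pos_of_neg h₁ h₂) h₃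
    · exact mul_neg_of_neg_of_pos (mul_neg_of_neg_of_pos h₁ h₂) h₃
  simp only [pppCyc]
  exact_mod_cast key

open Classical in
/-- The value of the cyclically symmetric trilinear form `η(xy, z)` on basis elements with labels
`j₁`, `j₂`, `j₃` of `ab`, `bc`, `ca`. -/
def triProd (τ : ℂ) (a b c : Brane θ) (j₁ j₂ j₃ : ℤ) : ℂ :=
  if pp a b = 0 then (if Adj b c j₂ j₃ then 1 else 0)
  else if pp b c = 0 then (if Adj c a j₃ j₁ then 1 else 0)
  else if pp c a = 0 then (if Adj a b j₁ j₂ then 1 else 0)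
  else thetaSum τ a b c j₁ j₂ j₃

theorem triProd_rotate (τ : ℂ) {a b c : Brane θ} {j₁ j₂ j₃ : ℤ} (h₁ : pp a b = 0 → j₁ = 0)
    (h₂ : pp b c = 0 → j₂ = 0) (h₃ : pp c a = 0 → j₃ = 0) :
    triProd τ b c a j₂ j₃ j₁ = triProd τ a b c j₁ j₂ j₃ := by
  by_cases hab : pp a b = 0
  · by_cases hbc : pp b c = 0
    · have hac : pp a c = 0 := by rw [pp_congr_left hab]; exact hbc
      have hca : pp c a = 0 := by rw [pp_swap a c, hac, neg_zero]
      simp [triProd, hab, hbc, h₁ hab, h₂ hbc, h₃ hca, adj_zero]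
    · have hac : pp a c ≠ 0 := by rw [pp_congr_left hab]; exact hbc
      have hca : pp c a ≠ 0 := by rw [pp_swap a c]; simpa using hac
      simp [triProd, hab, hbc, hca]
  · by_cases hbc : pp b c = 0
    · simp [triProd, hab, hbc]
    · by_cases hca : pp c a = 0
      · simp [triProd, hab, hbc, hca]
      · simp [triProd, hab, hbc, hca, thetaSum_rotate]

open Classical in
/-- The value of `η(xy, z)` on basis elements: the labels `j` and `j₃` in `η` determine each
other, and `structureConst` becomes the cyclically symmetric `triProd`. -/
theorem sum_structureConst_mul (τ : ℂ) (hn : k + l = n) (hm : n + m = 1) (j₁ : Label obj a b k)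
    (j₂ : Label obj b c l) (j₃ : Label obj c a m) :
    ∑ j : Label obj a c n, structureConst τ (obj a) (obj b) (obj c) j₁.num j₂.num j.num *
      (if Adj (obj a) (obj c) j.num j₃.num then 1 else 0) =
    triProd τ (obj a) (obj b) (obj c) j₁.num j₂.num j₃.num := by
  have hac : HasDegree obj a c n := j₃.2.swap (by omega)
  have hz : pp (obj a) (obj c) = 0 → j₃.num = 0 := fun h =>
    Label.num_eq_zero (by rw [pp_swap (obj a), h, neg_zero]) _
  obtain ⟨j₀, hj₀, hu⟩ := existsUnique_adj hac j₃.num hz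
  rw [Finset.sum_eq_single j₀, if_pos hj₀, mul_one]
  · by_cases hab : pp (obj a) (obj b) = 0
    · obtain rfl := j₁.2.eq_of_pp_eq_zero hab
      simp only [structureConst, triProd, if_pos hab]
      obtain ⟨j₂', e⟩ := j₂.exists_num_eq hac
      refine if_congr ?_ rfl rfl
      rw [← e]
      exact ⟨fun h => by rw [h]; exact hj₀, fun h => by rw [hu _ h]⟩
    · by_cases hbc : pp (obj b) (obj c) = 0
      · obtain rfl := j₂.2.eq_of_pp_eq_zero hbc
        simp only [structureConst, triProd, if_pos hbc, if_neg hab]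
        obtain ⟨j₁', e⟩ := j₁.exists_num_eq hac
        refine if_congr ?_ rfl rfl
        rw [← e, adj_comm]
        exact ⟨fun h => by rw [h]; exact hj₀, fun h => by rw [hu _ h]⟩
      · by_cases hca : pp (obj c) (obj a) = 0
        · have hca' : pp (obj a) (obj c) = 0 := by rw [pp_swap (obj c), hca, neg_zero]
          simp only [structureConst, triProd, if_neg hab, if_neg hbc, if_pos hca, if_pos hca']
          exact if_congr Iff.rfl rfl rfl
        · have hca' : pp (obj a) (obj c) ≠ 0 := by rw [pp_swap (obj c)]; simpa using hca
          rw [structureConst_eq_thetaSum τ hab hbc hca'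
            (pppCyc_neg j₁.2 j₂.2 j₃.2 (by omega) hab hbc hca)]
          simp only [triProd, if_neg hab, if_neg hbc, if_neg hca]
          refine thetaSum_congr_right τ ?_
          rw [pp_swap (obj a) (obj c), Int.modEq_neg]
          exact hj₀.symm
  · intro j _ hne
    rw [if_neg fun h => hne (hu j h), mul_zero]
  · simp

/-- The composition of `fukayaCat`, on coefficients. -/
def fukayaComp (τ : ℂ) (x : Label obj a b k → ℂ) (y : Label obj b c l → ℂ) :
    Label obj a c m → ℂ := fun j₃ => ∑ j₁ : Label obj a b k, ∑ j₂ : Label obj b c l,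
  x j₁ * y j₂ * structureConst τ (obj a) (obj b) (obj c) j₁.num j₂.num j₃.num

/-- The pairing of `fukayaCat`, on coefficients. -/
def fukayaEta (x : Label obj a b k → ℂ) (y : Label obj b a l → ℂ) : ℂ :=
  ∑ j : Label obj a b k, ∑ j' : Label obj b a l, x j * y j' * (if k + l = 1 ∧
    j'.num ≡ -(qq (obj a) (obj b)) * j.num [ZMOD pp (obj a) (obj b)] then 1 else 0)

open Classical in
theorem fukaya_eta_eq (h : k + l = 1) (x : Label obj a b k → ℂ)
    (y : Label obj b a l → ℂ) :
    fukayaEta x y =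
      ∑ j : Label obj a b k, ∑ j' : Label obj b a l,
        x j * y j' * (if Adj (obj a) (obj b) j.num j'.num then 1 else 0) := by
  simp only [fukayaEta, h, true_and]
  exact Finset.sum_congr rfl fun j _ => Finset.sum_congr rfl fun j' _ =>
    congrArg _ (if_congr Iff.rfl rfl rfl)

theorem fukaya_eta_of_ne (h : k + l ≠ 1) (x : Label obj a b k → ℂ)
    (y : Label obj b a l → ℂ) :
    fukayaEta x y = 0 := by
  simp [fukayaEta, h]

theorem fukaya_eta_comm (x : Label obj a b k → ℂ) (y : Label obj b a l → ℂ) :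
    fukayaEta x y =
      fukayaEta y x := by
  classical
  by_cases h : k + l = 1
  · rw [fukaya_eta_eq h, fukaya_eta_eq (by omega), Finset.sum_comm]
    refine Finset.sum_congr rfl fun j _ => Finset.sum_congr rfl fun j' _ => ?_
    rw [mul_comm (x j'), if_congr adj_comm rfl rfl]
  · rw [fukaya_eta_of_ne h, fukaya_eta_of_ne (by omega)]

theorem fukaya_eta_comp (τ : ℂ) (hn : k + l = n) (hm : n + m = 1) (x : Label obj a b k → ℂ)
    (y : Label obj b c l → ℂ) (z : Label obj c a m → ℂ) :
    fukayaEta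
      (fukayaComp (m := n) τ x y) z =
    ∑ j₁ : Label obj a b k, ∑ j₂ : Label obj b c l, ∑ j₃ : Label obj c a m,
      x j₁ * y j₂ * z j₃ * triProd τ (obj a) (obj b) (obj c) j₁.num j₂.num j₃.num := by
  classical
  rw [fukaya_eta_eq hm]
  simp only [← sum_structureConst_mul τ hn hm, fukayaComp, Finset.sum_mul, Finset.mul_sum]
  rw [Finset.sum_comm]
  rw [Finset.sum_congr rfl fun j₃ _ => Finset.sum_comm]
  rw [Finset.sum_comm]
  refine Finset.sum_congr rfl fun j₁ _ => ?_
  rw [Finset.sum_congr rfl fun j₃ _ => Finset.sum_comm]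
  rw [Finset.sum_comm]
  refine Finset.sum_congr rfl fun j₂ _ => Finset.sum_congr rfl fun j₃ _ =>
    Finset.sum_congr rfl fun j _ => ?_
  ring

theorem fukaya_cyclic (τ : ℂ) {kl lm : ℤ} (h₁ : k + l = kl) (h₂ : l + m = lm)
    (x : Label obj a b k → ℂ) (y : Label obj b c l → ℂ) (z : Label obj c a m → ℂ) :
    fukayaEta
      (fukayaComp (m := kl) τ x y) z =
    fukayaEta
      (fukayaComp (m := lm) τ y z) x := by
  by_cases h : kl + m = 1
  · rw [fukaya_eta_comp τ h₁ h, fukaya_eta_comp τ h₂ (by omega)]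
    rw [Finset.sum_comm]
    refine Finset.sum_congr rfl fun j₂ _ => ?_
    rw [Finset.sum_comm]
    refine Finset.sum_congr rfl fun j₃ _ => Finset.sum_congr rfl fun j₁ _ => ?_
    rw [triProd_rotate τ (fun h => Label.num_eq_zero h j₁) (fun h => Label.num_eq_zero h j₂)
      (fun h => Label.num_eq_zero h j₃)]
    ring
  · rw [fukaya_eta_of_ne h, fukaya_eta_of_ne (by omega)]

theorem fukaya_nondegenerate (h : k + l = 1) (x : Label obj a b k → ℂ)
    (hx : ∀ y : Label obj b a l → ℂ,
      fukayaEta x y = 0) : x = 0 := by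
  classical
  funext j
  obtain ⟨j', hj', hu⟩ := existsUnique_adj (obj := obj) (j.2.swap h) j.num fun hp =>
    Label.num_eq_zero (by rw [pp_swap (obj b), hp, neg_zero]) j
  have e := hx (Pi.single j' 1)
  rw [fukaya_eta_eq h, Finset.sum_eq_single j, Finset.sum_eq_single j'] at e
  · simpa [if_pos (adj_symm hj')] using e
  · intro j'' _ hne
    simp [Pi.single_eq_of_ne hne]
  · simp
  · intro i _ hne
    refine Finset.sum_eq_zero fun i' _ => ?_
    by_cases hi : i' = j'
    · subst hi
      rw [if_neg, mul_zero]
      intro hadj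
      refine hne ?_
      have hz : pp (obj a) (obj b) = 0 → i'.num = 0 := fun hp =>
        Label.num_eq_zero (by rw [pp_swap (obj a), hp, neg_zero]) i'
      exact (existsUnique_adj j.2 i'.num hz).unique hadj (adj_symm hj')
    · simp [Pi.single_eq_of_ne hi]
  · simp

theorem pp_pos_of_hasDegree_zero (h : HasDegree obj a b 0) (hp : pp (obj a) (obj b) ≠ 0) :
    0 < pp (obj a) (obj b) := by
  rw [hasDegree_iff hp] at h
  omega

theorem pppCyc_neg_of_pos {a b c : Brane θ} (hab : 0 < pp a b) (hbc : 0 < pp b c) :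
    pppCyc a b c < 0 := by
  have h1 := (pp_pos_iff a b).1 hab
  have h2 := (pp_pos_iff b c).1 hbc
  have hca := (pp_neg_iff c a).2 (h1.trans h2)
  have : pp a b * pp b c * pp c a < 0 := mul_neg_of_pos_of_neg (mul_pos hab hbc) hca
  simp only [pppCyc]
  exact_mod_cast this

theorem HasDegree.trans_zero (h₁ : HasDegree obj a b 0) (h₂ : HasDegree obj b c 0) :
    HasDegree obj a c 0 := by
  by_cases hab : pp (obj a) (obj b) = 0
  · obtain rfl := h₁.eq_of_pp_eq_zero hab
    exact h₂
  by_cases hbc : pp (obj b) (obj c) = 0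
  · obtain rfl := h₂.eq_of_pp_eq_zero hbc
    exact h₁
  have h1 := (pp_pos_iff _ _).1 (pp_pos_of_hasDegree_zero h₁ hab)
  have h2 := (pp_pos_iff _ _).1 (pp_pos_of_hasDegree_zero h₂ hbc)
  have h3 := (pp_pos_iff _ _).2 (h1.trans h2)
  exact (hasDegree_iff h3.ne').2 (Or.inl ⟨h3, rfl⟩)

theorem sum_ite_num_eq {f : ℤ → ℂ} (j : Label obj a b k) :
    ∑ i : Label obj a b k, (if j.num = i.num then f i.num else 0) = f j.num := by
  rw [Finset.sum_eq_single j]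
  · simp
  · intro i _ hne
    exact if_neg fun h => hne (Label.num_injective h).symm
  · simp

/-- Associativity of the product in degree `0`. -/
theorem structureConst_assoc {τ : ℂ} (hτ : 0 < τ.im) (j₁ : Label obj a b 0)
    (j₂ : Label obj b c 0) (j₃ : Label obj c d 0) (j₄ : Label obj a d 0) :
    ∑ j : Label obj a c 0, structureConst τ (obj a) (obj b) (obj c) j₁.num j₂.num j.num *
        structureConst τ (obj a) (obj c) (obj d) j.num j₃.num j₄.num =
      ∑ j : Label obj b d 0, structureConst τ (obj a) (obj b) (obj d) j₁.num j.num j₄.num *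
        structureConst τ (obj b) (obj c) (obj d) j₂.num j₃.num j.num := by
  by_cases hab : pp (obj a) (obj b) = 0
  · obtain rfl := j₁.2.eq_of_pp_eq_zero hab
    have e1 : ∀ i j, structureConst τ (obj a) (obj a) (obj c) j₁.num i j =
      if i = j then 1 else 0 := fun i j => by rw [structureConst, if_pos hab]
    have e2 : ∀ i j, structureConst τ (obj a) (obj a) (obj d) j₁.num i j =
      if j = i then 1 else 0 := fun i j => by
        rw [structureConst, if_pos hab]
        exact if_congr eq_comm rfl rfl
    simp only [e1, e2, ite_mul, one_mul, zero_mul]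
    rw [sum_ite_num_eq j₂ (f := fun j => structureConst τ (obj a) (obj c) (obj d) j j₃.num j₄.num),
      sum_ite_num_eq j₄ (f := fun j => structureConst τ (obj a) (obj c) (obj d) j₂.num j₃.num j)]
  by_cases hbc : pp (obj b) (obj c) = 0
  · obtain rfl := j₂.2.eq_of_pp_eq_zero hbc
    have e1 : ∀ i j, structureConst τ (obj a) (obj b) (obj b) i j₂.num j =
      if i = j then 1 else 0 := fun i j => by rw [structureConst, if_neg hab, if_pos hbc]
    have e2 : ∀ i j, structureConst τ (obj b) (obj b) (obj d) j₂.num i j =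
      if i = j then 1 else 0 := fun i j => by rw [structureConst, if_pos hbc]
    simp only [e1, e2, ite_mul, mul_ite, one_mul, zero_mul, mul_one, mul_zero]
    rw [sum_ite_num_eq j₁ (f := fun j => structureConst τ (obj a) (obj b) (obj d) j j₃.num j₄.num),
      sum_ite_num_eq j₃ (f := fun j => structureConst τ (obj a) (obj b) (obj d) j₁.num j j₄.num)]
  have pab := pp_pos_of_hasDegree_zero j₁.2 hab
  have pbc := pp_pos_of_hasDegree_zero j₂.2 hbc
  have hac' := j₁.2.trans_zero j₂.2
  have pac : 0 < pp (obj a) (obj c) := (pp_pos_iff _ _).2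
    (((pp_pos_iff _ _).1 pab).trans ((pp_pos_iff _ _).1 pbc))
  by_cases hcd : pp (obj c) (obj d) = 0
  · obtain rfl := j₃.2.eq_of_pp_eq_zero hcd
    have e1 : ∀ i j, structureConst τ (obj a) (obj c) (obj c) i j₃.num j =
      if j = i then 1 else 0 := fun i j => by
        rw [structureConst, if_neg pac.ne', if_pos hcd]
        exact if_congr eq_comm rfl rfl
    have e2 : ∀ i j, structureConst τ (obj b) (obj c) (obj c) i j₃.num j =
      if i = j then 1 else 0 := fun i j => by rw [structureConst, if_neg hbc, if_pos hcd]
    simp only [e1, e2, mul_ite, mul_one, mul_zero]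
    rw [sum_ite_num_eq j₄ (f := fun j => structureConst τ (obj a) (obj b) (obj c) j₁.num j₂.num j),
      sum_ite_num_eq j₂ (f := fun j => structureConst τ (obj a) (obj b) (obj c) j₁.num j j₄.num)]
  have pcd := pp_pos_of_hasDegree_zero j₃.2 hcd
  have pbd : 0 < pp (obj b) (obj d) := (pp_pos_iff _ _).2
    (((pp_pos_iff _ _).1 pbc).trans ((pp_pos_iff _ _).1 pcd))
  have pad : 0 < pp (obj a) (obj d) := (pp_pos_iff _ _).2
    (((pp_pos_iff _ _).1 pac).trans ((pp_pos_iff _ _).1 pcd))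
  have habc := pppCyc_neg_of_pos pab pbc
  have hacd := pppCyc_neg_of_pos pac pcd
  have habd := pppCyc_neg_of_pos pab pbd
  have hbcd := pppCyc_neg_of_pos pbc pcd
  simp only [structureConst_eq_thetaSum τ hab hbc pac.ne' habc,
    structureConst_eq_thetaSum τ pac.ne' hcd pad.ne' hacd,
    structureConst_eq_thetaSum τ hab pbd.ne' pad.ne' habd,
    structureConst_eq_thetaSum τ hbc hcd pbd.ne' hbcd]
  exact thetaSum_assoc hτ hab hbc pac.ne' hcd pad.ne' pbd.ne' habc hacd habd
    (fun i => existsUnique_num hac' i fun h => absurd h pac.ne')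
    (fun i => existsUnique_num (j₂.2.trans_zero j₃.2) i fun h => absurd h pbd.ne') _ _ _ _

theorem fukaya_assoc_zero {τ : ℂ} (hτ : 0 < τ.im) {k l m kl lm n : ℤ} (hk : k = 0) (hl : l = 0)
    (hm : m = 0) (h₁ : k + l = kl) (h₂ : kl + m = n) (h₃ : l + m = lm) (h₄ : k + lm = n)
    (x : Label obj a b k → ℂ) (y : Label obj b c l → ℂ) (z : Label obj c d m → ℂ) :
    fukayaComp (m := n) τ
      (fukayaComp (m := kl) τ x y) z =
    fukayaComp (m := n) τ x
      (fukayaComp (m := lm) τ y z) := by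
  subst hk hl hm
  obtain rfl : kl = 0 := by omega
  obtain rfl : lm = 0 := by omega
  obtain rfl : n = 0 := by omega
  funext j₄
  simp only [fukayaComp, Finset.sum_mul, Finset.mul_sum]
  have hL : ∀ (j₁ : Label obj a b 0) (j₂ : Label obj b c 0) (j₃ : Label obj c d 0),
      ∑ j : Label obj a c 0, x j₁ * y j₂ * structureConst τ (obj a) (obj b) (obj c) j₁.num j₂.num
        j.num * z j₃ * structureConst τ (obj a) (obj c) (obj d) j.num j₃.num j₄.num =
      ∑ j : Label obj b d 0, x j₁ * (y j₂ * z j₃ * structureConst τ (obj b) (obj c) (obj d) j₂.num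
        j₃.num j.num) * structureConst τ (obj a) (obj b) (obj d) j₁.num j.num j₄.num := by
    intro j₁ j₂ j₃
    have h := congrArg (fun w => x j₁ * y j₂ * z j₃ * w) (structureConst_assoc hτ j₁ j₂ j₃ j₄)
    simp only [Finset.mul_sum] at h
    refine Eq.trans ?_ (h.trans ?_)
    · exact Finset.sum_congr rfl fun j _ => by ring
    · exact Finset.sum_congr rfl fun j _ => by ring
  rw [Finset.sum_comm]
  rw [Finset.sum_congr rfl fun j₃ _ => Finset.sum_comm]
  rw [Finset.sum_comm]
  refine Finset.sum_congr rfl fun j₁ _ => ?_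
  rw [Finset.sum_congr rfl fun j₃ _ => Finset.sum_comm, Finset.sum_comm]
  rw [Finset.sum_comm (s := (Finset.univ : Finset (Label obj b d 0)))]
  refine Finset.sum_congr rfl fun j₂ _ => ?_
  rw [Finset.sum_comm (s := (Finset.univ : Finset (Label obj b d 0)))]
  exact Finset.sum_congr rfl fun j₃ _ => hL j₁ j₂ j₃

end Labels

section FukayaLaws

variable {Ob : Type*} {obj : Ob → Brane θ} {a b c d : Ob} {k l m n : ℤ}

theorem fukayaComp_zero_left (τ : ℂ) (y : Label obj b c l → ℂ) :
    fukayaComp (m := m) τ (0 : Label obj a b k → ℂ) y = 0 := by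
  funext j; simp [fukayaComp]

theorem fukayaComp_zero_right (τ : ℂ) (x : Label obj a b k → ℂ) :
    fukayaComp (m := m) τ x (0 : Label obj b c l → ℂ) = 0 := by
  funext j; simp [fukayaComp]

theorem fukayaEta_zero_left (y : Label obj b a l → ℂ) :
    fukayaEta (0 : Label obj a b k → ℂ) y = 0 := by simp [fukayaEta]

theorem fukayaEta_zero_right (x : Label obj a b k → ℂ) :
    fukayaEta x (0 : Label obj b a l → ℂ) = 0 := by simp [fukayaEta]

theorem fukayaComp_add_left (τ : ℂ) (x x' : Label obj a b k → ℂ) (y : Label obj b c l → ℂ) :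
    fukayaComp (m := m) τ (x + x') y = fukayaComp τ x y + fukayaComp τ x' y := by
  funext j
  simp only [fukayaComp, Pi.add_apply, add_mul, Finset.sum_add_distrib]

theorem fukayaComp_smul_left (τ : ℂ) (w : ℂ) (x : Label obj a b k → ℂ) (y : Label obj b c l → ℂ) :
    fukayaComp (m := m) τ (w • x) y = w • fukayaComp τ x y := by
  funext j
  simp only [fukayaComp, Pi.smul_apply, smul_eq_mul, mul_assoc, Finset.mul_sum]

theorem fukayaComp_add_right (τ : ℂ) (x : Label obj a b k → ℂ) (y y' : Label obj b c l → ℂ) :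
    fukayaComp (m := m) τ x (y + y') = fukayaComp τ x y + fukayaComp τ x y' := by
  funext j
  simp only [fukayaComp, Pi.add_apply, mul_add, add_mul, Finset.sum_add_distrib]

theorem fukayaComp_smul_right (τ : ℂ) (w : ℂ) (x : Label obj a b k → ℂ)
    (y : Label obj b c l → ℂ) :
    fukayaComp (m := m) τ x (w • y) = w • fukayaComp τ x y := by
  funext j
  simp only [fukayaComp, Pi.smul_apply, smul_eq_mul, Finset.mul_sum]
  exact Finset.sum_congr rfl fun _ _ => Finset.sum_congr rfl fun _ _ => by ring

theorem fukayaEta_add_left (x x' : Label obj a b k → ℂ) (y : Label obj b a l → ℂ) :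
    fukayaEta (x + x') y = fukayaEta x y + fukayaEta x' y := by
  simp only [fukayaEta, Pi.add_apply, add_mul, Finset.sum_add_distrib]

theorem fukayaEta_smul_left (w : ℂ) (x : Label obj a b k → ℂ) (y : Label obj b a l → ℂ) :
    fukayaEta (w • x) y = w * fukayaEta x y := by
  simp only [fukayaEta, Pi.smul_apply, smul_eq_mul, mul_assoc, Finset.mul_sum]

theorem fukayaEta_sub_left (x x' : Label obj a b k → ℂ) (y : Label obj b a l → ℂ) :
    fukayaEta (x - x') y = fukayaEta x y - fukayaEta x' y := by
  simp only [fukayaEta, Pi.sub_apply, sub_mul, Finset.sum_sub_distrib]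

theorem eq_zero_of_not_hasDegree (h : ¬HasDegree obj a b k) (x : Label obj a b k → ℂ) : x = 0 := by
  funext j; exact absurd j.2 h

/-- The associativity constraint, paired with a fourth morphism, is invariant under rotations. -/
theorem fukaya_assoc_rotate (τ : ℂ) {kl lm mn s t : ℤ} (h₁ : k + l = kl) (h₂ : kl + m = s)
    (h₄ : k + lm = s) (h₅ : m + n = mn) (h₆ : lm + n = t) (h₇ : l + mn = t)
    (x : Label obj a b k → ℂ) (y : Label obj b c l → ℂ) (z : Label obj c d m → ℂ)
    (w : Label obj d a n → ℂ)
    (h : fukayaEta (fukayaComp (m := t) τ (fukayaComp (m := lm) τ y z) w) x =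
      fukayaEta (fukayaComp (m := t) τ y (fukayaComp (m := mn) τ z w)) x) :
    fukayaEta (fukayaComp (m := s) τ (fukayaComp (m := kl) τ x y) z) w =
      fukayaEta (fukayaComp (m := s) τ x (fukayaComp (m := lm) τ y z)) w := by
  rw [fukaya_cyclic τ h₂ h₅, fukaya_eta_comm, fukaya_cyclic τ h₁ h₇, ← h,
    fukaya_cyclic τ h₄ h₆]

/-- By rotation this reduces to the case where the first three morphisms have degree `0`. -/
theorem fukaya_assoc_eta {τ : ℂ} (hτ : 0 < τ.im) {kl lm s : ℤ} (h₁ : k + l = kl) (h₂ : kl + m = s)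
    (h₃ : l + m = lm) (h₄ : k + lm = s) (h₅ : s + n = 1)
    (x : Label obj a b k → ℂ) (y : Label obj b c l → ℂ) (z : Label obj c d m → ℂ)
    (w : Label obj d a n → ℂ) :
    fukayaEta (fukayaComp (m := s) τ (fukayaComp (m := kl) τ x y) z) w =
      fukayaEta (fukayaComp (m := s) τ x (fukayaComp (m := lm) τ y z)) w := by
  by_cases hx : HasDegree obj a b k
  swap
  · simp only [eq_zero_of_not_hasDegree hx x, fukayaComp_zero_left, fukayaEta_zero_left]
  by_cases hy : HasDegree obj b c l
  swap
  · simp only [eq_zero_of_not_hasDegree hy y, fukayaComp_zero_left, fukayaComp_zero_right,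
      fukayaEta_zero_left]
  by_cases hz : HasDegree obj c d m
  swap
  · simp only [eq_zero_of_not_hasDegree hz z, fukayaComp_zero_right, fukayaEta_zero_left]
  by_cases hw : HasDegree obj d a n
  swap
  · simp only [eq_zero_of_not_hasDegree hw w, fukayaEta_zero_right]
  -- exactly one of the four degrees is `1`; rotate it to the last place
  have ek := hx.eq_zero_or_one
  have el := hy.eq_zero_or_one
  have em := hz.eq_zero_or_one
  have en := hw.eq_zero_or_one
  by_cases hn : n = 1
  · rw [fukaya_assoc_zero hτ (by omega) (by omega) (by omega) h₁ h₂ h₃ h₄]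
  by_cases hk : k = 1
  · refine fukaya_assoc_rotate τ h₁ h₂ h₄ rfl rfl (by omega) x y z w ?_
    rw [fukaya_assoc_zero hτ (by omega) (by omega) (by omega) h₃ rfl rfl (by omega)]
  by_cases hl : l = 1
  · refine fukaya_assoc_rotate τ h₁ h₂ h₄ rfl rfl (by omega) x y z w ?_
    refine fukaya_assoc_rotate τ h₃ rfl (by omega) rfl rfl (by omega) y z w x ?_
    rw [fukaya_assoc_zero hτ (by omega) (by omega) (by omega) rfl rfl rfl (by omega)]
  · refine fukaya_assoc_rotate τ h₁ h₂ h₄ rfl rfl (by omega) x y z w ?_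
    refine fukaya_assoc_rotate τ h₃ rfl (by omega) rfl rfl (by omega) y z w x ?_
    refine fukaya_assoc_rotate τ rfl rfl (by omega) h₁ rfl (by omega) z w x y ?_
    rw [fukaya_assoc_zero hτ (by omega) (by omega) (by omega) rfl rfl h₁ (by omega)]

theorem fukaya_assoc {τ : ℂ} (hτ : 0 < τ.im) {kl lm s : ℤ} (h₁ : k + l = kl) (h₂ : kl + m = s)
    (h₃ : l + m = lm) (h₄ : k + lm = s) (x : Label obj a b k → ℂ) (y : Label obj b c l → ℂ)
    (z : Label obj c d m → ℂ) :
    fukayaComp (m := s) τ (fukayaComp (m := kl) τ x y) z =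
      fukayaComp (m := s) τ x (fukayaComp (m := lm) τ y z) := by
  rw [← sub_eq_zero]
  refine fukaya_nondegenerate (l := 1 - s) (by omega) _ fun w => ?_
  rw [fukayaEta_sub_left, sub_eq_zero]
  exact fukaya_assoc_eta hτ h₁ h₂ h₃ h₄ (by omega) x y z w

theorem neg_one_zpow_mul_of_add_eq_one (h : k + l = 1) : (-1 : ℂ) ^ (k * l) = 1 := by
  refine Even.neg_one_zpow ?_
  obtain rfl : l = 1 - k := by omega
  rw [show k * (1 - k) = -((k - 1) * (k - 1 + 1)) by ring]
  exact (Int.even_mul_succ_self (k - 1)).neg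

end FukayaLaws

/-- All signs in the axioms are trivial: a nonzero pairing has arguments of degrees `0` and `1`. -/
theorem fukayaCat_isCyclic {τ : ℂ} (hτ : 0 < τ.im) {Ob : Type*} (obj : Ob → Brane θ) :
    IsCyclicGradedCategory (fukayaCat τ obj) (-1) where
  comp_add_left _ x x' y := fukayaComp_add_left τ x x' y
  comp_smul_left _ w x y := fukayaComp_smul_left τ w x y
  comp_add_right _ x y y' := fukayaComp_add_right τ x y y'
  comp_smul_right _ w x y := fukayaComp_smul_right τ w x y
  assoc h₁ h₂ h₃ h₄ x y z := fukaya_assoc hτ h₁ h₂ h₃ h₄ x y z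
  eta_add_left x x' y := fukayaEta_add_left x x' y
  eta_smul_left w x y := fukayaEta_smul_left w x y
  eta_degree x y h := fukaya_eta_of_ne (by omega) x y
  eta_symm {a b k l} x y := by
    have h := fukaya_eta_comm (obj := obj) (a := a) (b := b) (k := k) (l := l) x y
    by_cases hkl : k + l = 1
    · rw [neg_one_zpow_mul_of_add_eq_one hkl, one_mul]
      exact h
    · have h' := fukaya_eta_of_ne (obj := obj) (a := a) (b := b) hkl x y
      change fukayaEta (obj := obj) x y = _ * fukayaEta (obj := obj) y x
      rw [← h, h', mul_zero]
  eta_nondegenerate h x hx := fukaya_nondegenerate (by omega) x hx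
  cyclic {a b c k l m kl lm} h₁ h₂ x y z := by
    have h := fukaya_cyclic (obj := obj) τ h₁ h₂ x y z
    by_cases hklm : k + (l + m) = 1
    · rw [neg_one_zpow_mul_of_add_eq_one hklm, one_mul]
      exact h
    · have h' := fukaya_eta_of_ne (obj := obj) (a := a) (b := c) (k := kl) (l := m) (by omega)
        (fukayaComp (obj := obj) (m := kl) τ x y) z
      change fukayaEta (obj := obj) (fukayaComp (obj := obj) (m := kl) τ x y) z =
        _ * fukayaEta (obj := obj) (fukayaComp (obj := obj) (m := lm) τ y z) x
      rw [← h, h', mul_zero]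

/-! ### Transport of the laws along an equivalence -/

theorem IsCyclicGradedCategory.transport {Ob : Type*} {C D : CyclicGradedData Ob} {deg : ℤ}
    (hC : IsCyclicGradedCategory C deg) (F : CyclicGradedEquiv C D) :
    IsCyclicGradedCategory D deg := by
  have hcomp : ∀ {a b c : Ob} {k l m : ℤ} (h : k + l = m) (x : D.V a b k) (y : D.V b c l),
      D.comp h x y = F.toEquiv a c m
        (C.comp h ((F.toEquiv a b k).symm x) ((F.toEquiv b c l).symm y)) := by
    intro a b c k l m h x y
    rw [F.map_comp, LinearEquiv.apply_symm_apply, LinearEquiv.apply_symm_apply]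
  have heta : ∀ {a b : Ob} {k l : ℤ} (x : D.V a b k) (y : D.V b a l),
      D.eta x y = C.eta ((F.toEquiv a b k).symm x) ((F.toEquiv b a l).symm y) := by
    intro a b k l x y
    rw [F.map_eta, LinearEquiv.apply_symm_apply, LinearEquiv.apply_symm_apply]
  constructor
  · intro a b c k l m h x x' y
    simp only [hcomp, map_add, hC.comp_add_left]
  · intro a b c k l m h z x y
    simp only [hcomp, map_smul, hC.comp_smul_left]
  · intro a b c k l m h x y y'
    simp only [hcomp, map_add, hC.comp_add_right]
  · intro a b c k l m h x z y
    simp only [hcomp, map_smul, hC.comp_smul_right]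
  · intro a b c d k l m kl lm n h₁ h₂ h₃ h₄ x y z
    simp only [hcomp, LinearEquiv.symm_apply_apply]
    rw [hC.assoc h₁ h₂ h₃ h₄]
  · intro a b k l x x' y
    simp only [heta, map_add, hC.eta_add_left]
  · intro a b k l z x y
    simp only [heta, map_smul, hC.eta_smul_left]
  · intro a b k l x y h
    rw [heta, hC.eta_degree _ _ h]
  · intro a b k l x y
    rw [heta, heta, hC.eta_symm]
  · intro a b k l h x hx
    have h0 : (F.toEquiv a b k).symm x = 0 := by
      refine hC.eta_nondegenerate h _ fun y => ?_
      have := hx (F.toEquiv b a l y)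
      rwa [heta, LinearEquiv.symm_apply_apply] at this
    simpa using h0
  · intro a b c k l m kl lm h₁ h₂ x y z
    simp only [heta, hcomp, LinearEquiv.symm_apply_apply]
    rw [hC.cyclic h₁ h₂]

/-! ### Gaussians are Schwartz functions -/

section Gaussian

open Polynomial Filter Asymptotics
open scoped ContDiff

theorem exists_bound_polynomial_mul_cexp {A : ℂ} (hA : A.re < 0) (B C : ℂ) (P : ℂ[X]) :
    ∃ M : ℝ, ∀ x : ℝ, ‖P.eval (x : ℂ) * Complex.exp (A * x ^ 2 + B * x + C)‖ ≤ M := by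
  induction P using Polynomial.induction_on' with
  | add P Q hP hQ =>
    obtain ⟨M, hM⟩ := hP
    obtain ⟨M', hM'⟩ := hQ
    refine ⟨M + M', fun x => ?_⟩
    rw [eval_add, add_mul]
    exact (norm_add_le _ _).trans (add_le_add (hM x) (hM' x))
  | monomial n w =>
    have h := (cexp_neg_quadratic_isLittleO_abs_rpow_cocompact hA B (-(n : ℝ))).bound one_pos
    obtain ⟨K, hK, hKs⟩ := mem_cocompact.1 h
    obtain ⟨M, hM⟩ := hK.exists_bound_of_continuousOn (f := fun x : ℝ =>
      (monomial n w).eval (x : ℂ) * Complex.exp (A * x ^ 2 + B * x + C)) (by fun_prop)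
    refine ⟨max M (‖w‖ * ‖Complex.exp C‖), fun x => ?_⟩
    by_cases hx : x ∈ K
    · exact (hM x hx).trans (le_max_left _ _)
    · refine le_trans ?_ (le_max_right _ _)
      have h1 : ‖Complex.exp (A * x ^ 2 + B * x)‖ ≤ (|x| ^ n)⁻¹ := by
        have h2 : ‖Complex.exp (A * x ^ 2 + B * x)‖ ≤ 1 * ‖|x| ^ (-(n : ℝ))‖ := hKs hx
        rwa [one_mul, Real.rpow_neg (abs_nonneg x), Real.rpow_natCast, norm_inv, norm_pow,
          Real.norm_eq_abs, abs_abs] at h2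
      rw [eval_monomial, Complex.exp_add, norm_mul, norm_mul, norm_mul, norm_pow,
        Complex.norm_real, Real.norm_eq_abs]
      have h3 : |x| ^ n * ‖Complex.exp (A * x ^ 2 + B * x)‖ ≤ 1 :=
        (mul_le_mul_of_nonneg_left h1 (by positivity)).trans mul_inv_le_one
      calc ‖w‖ * |x| ^ n * (‖Complex.exp (A * x ^ 2 + B * x)‖ * ‖Complex.exp C‖)
          = (‖w‖ * ‖Complex.exp C‖) * (|x| ^ n * ‖Complex.exp (A * x ^ 2 + B * x)‖) := by ring
        _ ≤ (‖w‖ * ‖Complex.exp C‖) * 1 := by gcongr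
        _ = ‖w‖ * ‖Complex.exp C‖ := mul_one _

theorem hasDerivAt_cexp_quadratic (A B C : ℂ) (x : ℝ) :
    HasDerivAt (fun x : ℝ => Complex.exp (A * x ^ 2 + B * x + C))
      ((2 * A * x + B) * Complex.exp (A * x ^ 2 + B * x + C)) x := by
  have h : HasDerivAt (fun z : ℂ => Complex.exp (A * z ^ 2 + B * z + C))
      (Complex.exp (A * x ^ 2 + B * x + C) * (A * (2 * x) + B)) (x : ℂ) := by
    refine HasDerivAt.cexp ?_
    have h1 := ((hasDerivAt_pow 2 (x : ℂ)).const_mul A).add ((hasDerivAt_id (x : ℂ)).const_mul B)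
    convert! h1.add_const C using 1
    simp
  convert! h.comp_ofReal using 1
  ring

theorem exists_iteratedDeriv_cexp_quadratic (A B C : ℂ) (n : ℕ) : ∃ P : ℂ[X],
    iteratedDeriv n (fun x : ℝ => Complex.exp (A * x ^ 2 + B * x + C)) =
      fun x : ℝ => P.eval (x : ℂ) * Complex.exp (A * x ^ 2 + B * x + C) := by
  induction n with
  | zero => exact ⟨1, by simp⟩
  | succ n ih =>
    obtain ⟨P, hP⟩ := ih
    refine ⟨derivative P + P * (Polynomial.C (2 * A) * X + Polynomial.C B), ?_⟩
    rw [iteratedDeriv_succ, hP]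
    funext x
    have h1 : HasDerivAt (fun x : ℝ => P.eval (x : ℂ)) ((derivative P).eval (x : ℂ)) x :=
      (P.hasDerivAt (x : ℂ)).comp_ofReal
    refine (h1.mul (hasDerivAt_cexp_quadratic A B C x)).deriv.trans ?_
    simp only [eval_add, eval_mul, eval_C, eval_X]
    ring

/-- The derivatives of a Gaussian are polynomial multiples of it, and these are bounded. -/
theorem exists_schwartzMap_cexp_quadratic {A : ℂ} (hA : A.re < 0) (B C : ℂ) :
    ∃ φ : 𝓢(ℝ, ℂ), ∀ x : ℝ, φ x = Complex.exp (A * x ^ 2 + B * x + C) := by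
  refine ⟨⟨fun x : ℝ => Complex.exp (A * x ^ 2 + B * x + C), ?_, fun k n => ?_⟩, fun x => rfl⟩
  · have : ContDiff ℝ ∞ fun x : ℝ => (x : ℂ) := Complex.ofRealCLM.contDiff
    fun_prop
  · obtain ⟨P, hP⟩ := exists_iteratedDeriv_cexp_quadratic A B C n
    obtain ⟨M, hM⟩ := exists_bound_polynomial_mul_cexp hA B C (X ^ k * P)
    refine ⟨M, fun x => ?_⟩
    rw [norm_iteratedFDeriv_eq_norm_iteratedDeriv, hP]
    refine le_trans (le_of_eq ?_) (hM x)
    simp only [eval_mul, eval_pow, eval_X, norm_mul, norm_pow, Complex.norm_real, mul_assoc]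

end Gaussian

/-! ### Theta vectors and the kernels of the connections -/

/-- The Gaussian annihilated by `∇₁ + z ∇₂`, as a function of `x`. -/
def gaussian (z : ℂ) (a b : Brane θ) (x : ℝ) : ℂ :=
  ee (z * (edgeArea a b 0 0 (a.rank * x) : ℂ) + (edgePhase a b 0 0 (a.rank * x) : ℂ))

theorem crossX_zero (a b : Brane θ) :
    crossX a b 0 0 = -(αα a b / (b.slope - a.slope)) := by
  simp only [crossX, icpt, αα, add_zero]
  rw [← neg_div, neg_sub]

theorem gaussian_eq_cexp (z : ℂ) (a b : Brane θ) : ∃ B C : ℂ, ∀ x : ℝ, gaussian z a b x =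
    Complex.exp ((Real.pi * Complex.I * z * ((a.rank ^ 2 * (b.slope - a.slope) : ℝ) : ℂ)) * x ^ 2 +
      B * x + C) := by
  refine ⟨2 * Real.pi * Complex.I * (-z * ((b.slope - a.slope : ℝ) : ℂ) * a.rank *
      crossX a b 0 0 + ββ a b * a.rank), 2 * Real.pi * Complex.I *
      (z * ((b.slope - a.slope : ℝ) : ℂ) / 2 * crossX a b 0 0 ^ 2 - ββ a b * crossX a b 0 0),
    fun x => ?_⟩
  simp only [gaussian, ee, edgeArea, edgePhase]
  congr 1
  push_cast
  ring

theorem norm_gaussian (z : ℂ) (a b : Brane θ) (x : ℝ) : ‖gaussian z a b x‖ =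
    Real.exp (-(Real.pi * (z.im * (b.slope - a.slope))) * (a.rank * x - crossX a b 0 0) ^ 2) := by
  rw [gaussian, norm_ee]
  congr 1
  rw [Complex.add_im, Complex.ofReal_im, Complex.im_mul_ofReal, edgeArea]
  ring

theorem gaussian_ne_zero (z : ℂ) (a b : Brane θ) (x : ℝ) : gaussian z a b x ≠ 0 :=
  Complex.exp_ne_zero _

theorem exists_schwartzMap_gaussian {z : ℂ} {a b : Brane θ}
    (h : 0 < z.im * (b.slope - a.slope)) : ∃ φ : 𝓢(ℝ, ℂ), ∀ x, φ x = gaussian z a b x := by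
  obtain ⟨B, C, hBC⟩ := gaussian_eq_cexp z a b
  have hA : (Real.pi * Complex.I * z * ((a.rank ^ 2 * (b.slope - a.slope) : ℝ) : ℂ)).re < 0 := by
    have e : (Real.pi * Complex.I * z * ((a.rank ^ 2 * (b.slope - a.slope) : ℝ) : ℂ)).re =
        -(Real.pi * a.rank ^ 2 * (z.im * (b.slope - a.slope))) := by
      rw [Complex.re_mul_ofReal, mul_assoc, Complex.re_ofReal_mul, Complex.I_mul_re]
      ring
    rw [e]
    have := a.rank_pos
    have := Real.pi_pos
    exact neg_neg_of_pos (by positivity)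
  obtain ⟨φ, hφ⟩ := exists_schwartzMap_cexp_quadratic hA B C
  exact ⟨φ, fun x => by rw [hφ, hBC]⟩

/-- The factor of the first order operator `∇₁ + z ∇₂`. -/
def logDeriv (z : ℂ) (a b : Brane θ) (x : ℝ) : ℂ :=
  2 * Real.pi * Complex.I * a.rank *
    (z * ((b.slope - a.slope : ℝ) : ℂ) * (a.rank * x - crossX a b 0 0) + ββ a b)

theorem hasDerivAt_gaussian (z : ℂ) (a b : Brane θ) (x : ℝ) :
    HasDerivAt (gaussian z a b) (logDeriv z a b x * gaussian z a b x) x := by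
  have h1 : HasDerivAt (fun x : ℝ => edgeArea a b 0 0 (a.rank * x))
      ((b.slope - a.slope) * (a.rank * x - crossX a b 0 0) * a.rank) x := by
    have h := ((((hasDerivAt_id x).const_mul a.rank).sub_const (crossX a b 0 0)).pow 2).const_mul
      ((b.slope - a.slope) / 2)
    convert! h using 1
    simp
    ring
  have h2 : HasDerivAt (fun x : ℝ => edgePhase a b 0 0 (a.rank * x)) (ββ a b * a.rank) x := by
    have h := (((hasDerivAt_id x).const_mul a.rank).sub_const (crossX a b 0 0)).const_mul (ββ a b)
    convert! h using 1
    simp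
  have h3 := (((h1.ofReal_comp).const_mul z).add h2.ofReal_comp).const_mul
    (2 * Real.pi * Complex.I) |>.cexp
  refine h3.congr_deriv ?_
  simp only [gaussian, ee, logDeriv, Pi.add_apply]
  push_cast
  ring

/-- For `p_ab ≠ 0` the operator `∇₁ + z ∇₂` is `d/dx` minus the logarithmic derivative of the
Gaussian. -/
theorem nablaBar_fst {a b : Brane θ} (hp : pp a b ≠ 0) (z : ℂ) (f : Mor) (x : ℝ) (j : ℤ) :
    (nablaBar z a b f).1 x j =
      1 / (a.rank : ℂ) * (deriv (fun y : ℝ => f.1 y j) x - logDeriv z a b x * f.1 x j) := by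
  have ha : (a.rank : ℂ) ≠ 0 := by exact_mod_cast a.rank_ne
  have hd : ((b.slope - a.slope : ℝ) : ℂ) ≠ 0 := by exact_mod_cast slope_sub_ne hp
  have hmu : (pp a b : ℂ) / (rk a b : ℂ) = (a.rank : ℂ) ^ 2 * ((b.slope - a.slope : ℝ) : ℂ) := by
    exact_mod_cast congrArg (fun t : ℝ => (t : ℂ)) (mu_eq a b)
  have hX : ((crossX a b 0 0 : ℝ) : ℂ) * ((b.slope - a.slope : ℝ) : ℂ) = -(αα a b : ℂ) := by
    rw [crossX_zero]
    push_cast at hd ⊢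
    field_simp
  simp only [nablaBar, nabla₁, nabla₂, if_neg hp, logDeriv, Prod.fst_add, Prod.smul_fst,
    Pi.add_apply, Pi.smul_apply, smul_eq_mul]
  have e : 2 * Real.pi * Complex.I * (pp a b : ℂ) * (x : ℂ) / (rk a b : ℂ) =
      2 * Real.pi * Complex.I * x * ((a.rank : ℂ) ^ 2 * ((b.slope - a.slope : ℝ) : ℂ)) := by
    rw [← hmu]; ring
  rw [e]
  field_simp
  linear_combination (-(2 * Real.pi * Complex.I * a.rank * z * f.1 x j)) * hX

theorem nablaBar_snd {a b : Brane θ} (hp : pp a b ≠ 0) (z : ℂ) (f : Mor) :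
    (nablaBar z a b f).2 = 0 := by
  simp [nablaBar, nabla₁, nabla₂, if_neg hp]

/-- The elements of the kernel of `∇₁ + z ∇₂` are multiples of the Gaussian. -/
theorem exists_coeff_of_mem_kerNabla {a b : Brane θ} (hp : pp a b ≠ 0) {z : ℂ} {f : Mor}
    (hf : f ∈ kerNabla z a b) :
    ∃ w : ℤ → ℂ, (∀ i, w (i + pp a b) = w i) ∧ f = (fun x i => w i * gaussian z a b x, 0) := by
  obtain ⟨hh, hk⟩ := hf
  obtain ⟨⟨hper, hS⟩, h2⟩ := hh.1 hp
  have hconst : ∀ i x, f.1 x i / gaussian z a b x = f.1 0 i / gaussian z a b 0 := by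
    intro i x
    obtain ⟨φ, hφ⟩ := hS i
    have e : (fun y : ℝ => f.1 y i) = φ := funext fun y => (hφ y).symm
    have hd : ∀ x, HasDerivAt (fun y : ℝ => f.1 y i) (logDeriv z a b x * f.1 x i) x := by
      intro x
      have h1 : HasDerivAt (fun y : ℝ => f.1 y i) (deriv (fun y : ℝ => f.1 y i) x) x := by
        rw [e]; exact φ.differentiableAt.hasDerivAt
      have h3 : (nablaBar z a b f).1 x i = 0 := by rw [hk]; rfl
      rw [nablaBar_fst hp] at h3
      have ha : (1 / (a.rank : ℂ)) ≠ 0 := one_div_ne_zero (by exact_mod_cast a.rank_ne)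
      rwa [sub_eq_zero.1 ((mul_eq_zero.1 h3).resolve_left ha)] at h1
    have hq : ∀ x, HasDerivAt (fun y : ℝ => f.1 y i / gaussian z a b y) 0 x := by
      intro x
      have h4 := (hd x).div (hasDerivAt_gaussian z a b x) (gaussian_ne_zero z a b x)
      convert! h4 using 1
      rw [eq_comm, div_eq_zero_iff]
      left
      ring
    exact is_const_of_deriv_eq_zero (fun x => (hq x).differentiableAt) (fun x => (hq x).deriv) x 0
  refine ⟨fun i => f.1 0 i / gaussian z a b 0, fun i => by simp only [hper], Prod.ext ?_ h2⟩
  funext x i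
  change f.1 x i = f.1 0 i / gaussian z a b 0 * gaussian z a b x
  rw [← hconst i x, div_mul_cancel₀ _ (gaussian_ne_zero z a b x)]

theorem mem_kerNabla_of_coeff {a b : Brane θ} (hp : pp a b ≠ 0) {z : ℂ}
    (h : 0 < z.im * (b.slope - a.slope)) {w : ℤ → ℂ} (hw : ∀ i, w (i + pp a b) = w i) :
    ((fun x i => w i * gaussian z a b x, 0) : Mor) ∈ kerNabla z a b := by
  obtain ⟨φ, hφ⟩ := exists_schwartzMap_gaussian h
  refine ⟨⟨fun _ => ⟨⟨fun x j => by simp only [hw], fun j => ⟨w j • φ, fun x => by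
    simp [hφ]⟩⟩, rfl⟩, fun h => absurd h hp⟩, Prod.ext ?_ (nablaBar_snd hp z _)⟩
  funext x i
  rw [nablaBar_fst hp]
  have := (hasDerivAt_gaussian z a b x).const_mul (w i)
  rw [this.deriv]
  simp
  right
  ring

/-- If the Gaussian grows, then no nonzero multiple of it is a Schwartz function. -/
theorem eq_zero_of_mem_kerNabla {a b : Brane θ} (hp : pp a b ≠ 0) {z : ℂ}
    (h : z.im * (b.slope - a.slope) < 0) {f : Mor} (hf : f ∈ kerNabla z a b) : f = 0 := by
  obtain ⟨w, -, rfl⟩ := exists_coeff_of_mem_kerNabla hp hf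
  have hw : ∀ i, w i = 0 := by
    intro i
    obtain ⟨φ, hφ⟩ := (hf.1.1 hp).1.2 i
    have h1 := φ.tendsto_cocompact.norm
    rw [norm_zero] at h1
    have h2 : ∀ x, ‖w i‖ ≤ ‖φ x‖ := by
      intro x
      rw [hφ, norm_mul, norm_gaussian]
      refine le_mul_of_one_le_right (norm_nonneg _) (Real.one_le_exp ?_)
      have : 0 ≤ -(Real.pi * (z.im * (b.slope - a.slope))) := by nlinarith [Real.pi_pos]
      positivity
    have h3 := ge_of_tendsto' h1 h2
    simpa using h3
  refine Prod.ext ?_ rfl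
  funext x i
  simp [hw]

theorem nablaBar_of_pp_eq_zero {a b : Brane θ} (hp : pp a b = 0) (z : ℂ) (f : Mor) :
    nablaBar z a b f = (0, fun n => 2 * Real.pi * Complex.I *
      (((n.1 : ℝ) / a.rank - ββ a b : ℝ) + z * ((n.2 : ℝ) / a.rank - αα a b : ℝ)) * f.2 n) := by
  simp only [nablaBar, nabla₁, nabla₂, if_pos hp]
  refine Prod.ext (by simp) ?_
  funext n
  simp
  ring

theorem eq_zero_of_add_mul_ofReal_eq_zero {z : ℂ} (hz : z.im ≠ 0) {s t : ℝ}
    (h : (s : ℂ) + z * t = 0) :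
    s = 0 ∧ t = 0 := by
  have him := congrArg Complex.im h
  have hre := congrArg Complex.re h
  simp only [Complex.add_im, Complex.ofReal_im, Complex.im_mul_ofReal, Complex.add_re,
    Complex.ofReal_re, Complex.re_mul_ofReal, Complex.zero_im, Complex.zero_re, zero_add] at him hre
  have ht : t = 0 := (mul_eq_zero.1 him).resolve_left hz
  rw [ht, mul_zero, add_zero] at hre
  exact ⟨hre, ht⟩

/-- On the coefficient of `U₁^{n₁} U₂^{n₂}` the operator is a multiplication by a number that
vanishes only if `α_b - α_a = n₂` and `β_b - β_a = n₁`. -/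
theorem eq_zero_of_mem_kerNabla_of_not_same {a b : Brane θ} (hp : pp a b = 0)
    (hab : ¬a.Same b) {z : ℂ} (hz : z.im ≠ 0) {f : Mor} (hf : f ∈ kerNabla z a b) : f = 0 := by
  obtain ⟨h1, -⟩ := hf.1.2 hp
  refine Prod.ext h1 ?_
  funext n
  have h := congrFun (congrArg Prod.snd hf.2) n
  rw [nablaBar_of_pp_eq_zero hp] at h
  rcases mul_eq_zero.1 h with h | h
  · exfalso
    have hpi : 2 * (Real.pi : ℂ) * Complex.I ≠ 0 := by simp
    obtain ⟨e1, e2⟩ := eq_zero_of_add_mul_ofReal_eq_zero hz ((mul_eq_zero.1 h).resolve_left hpi)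
    have ha := a.rank_ne
    obtain ⟨hq, hp'⟩ := eq_of_pp_eq_zero hp
    simp only [ββ, αα, ← rank_eq_of_pp_eq_zero hp] at e1 e2
    field_simp at e1 e2
    exact hab ⟨hq, hp', ⟨n.2, by linarith⟩, ⟨n.1, by linarith⟩⟩
  · exact h

/-- The element `w` of the noncommutative torus, for a scalar `w`. -/
def scalarMor (w : ℂ) : Mor := (0, fun n => if n = 0 then w else 0)

/-- The holomorphic elements of the noncommutative torus are the scalars. -/
theorem mem_kerNabla_self {a : Brane θ} {z : ℂ} (hz : z.im ≠ 0) {f : Mor} :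
    f ∈ kerNabla z a a ↔ f = scalarMor (f.2 0) := by
  have ha := a.rank_ne
  constructor
  · intro hf
    obtain ⟨h1, -⟩ := hf.1.2 (pp_self a)
    refine Prod.ext h1 ?_
    funext n
    simp only [scalarMor]
    split_ifs with hn
    · rw [hn]
    have h := congrFun (congrArg Prod.snd hf.2) n
    rw [nablaBar_of_pp_eq_zero (pp_self a)] at h
    rcases mul_eq_zero.1 h with h | h
    · exfalso
      have hpi : 2 * (Real.pi : ℂ) * Complex.I ≠ 0 := by simp
      obtain ⟨e1, e2⟩ := eq_zero_of_add_mul_ofReal_eq_zero hz ((mul_eq_zero.1 h).resolve_left hpi)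
      simp only [ββ, αα, sub_self, sub_zero, div_eq_zero_iff, ha, or_false, Int.cast_eq_zero]
        at e1 e2
      exact hn (Prod.ext e1 e2)
    · exact h
  · intro h
    rw [h]
    refine ⟨⟨fun hp => absurd (pp_self a) hp, fun _ => ⟨rfl, fun N => ⟨‖f.2 0‖, fun n => ?_⟩⟩⟩, ?_⟩
    · simp only [scalarMor]
      split_ifs with hn
      · simp [hn]
      · simp
    · rw [nablaBar_of_pp_eq_zero (pp_self a)]
      refine Prod.ext rfl ?_
      funext n
      simp only [scalarMor]
      split_ifs with hn
      · simp [hn, ββ, αα]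
      · simp

/-! ### Theta vectors form bases of the harmonic spaces -/

/-- The parameter `z` for which the harmonic space of degree `k` is the kernel of `∇₁ + z ∇₂`. -/
def rhoDeg (τ : ℂ) (k : ℤ) : ℂ := if k = 0 then rhoHat τ else (starRingEnd ℂ) (rhoHat τ)

theorem harm_eq_kerNabla (τ : ℂ) (a b : Brane θ) {k : ℤ} (hk : k = 0 ∨ k = 1) :
    harm τ a b k = kerNabla (rhoDeg τ k) a b := by
  rcases hk with rfl | rfl <;> simp [harm, rhoDeg]

theorem rhoDeg_im_ne {τ : ℂ} (hτ : 0 < τ.im) (k : ℤ) : (rhoDeg τ k).im ≠ 0 := by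
  have := rhoHat_im_pos hτ
  rw [rhoDeg]
  split_ifs
  · exact this.ne'
  · simpa using this.ne'

/-- The normalization of the theta vectors in degree `k`. -/
def thetaNorm (τ : ℂ) (a b : Brane θ) (k : ℤ) : ℂ := if k = 0 then 1 else (normConst τ a b : ℂ)

theorem normConst_pos {τ : ℂ} (hτ : 0 < τ.im) (a b : Brane θ) : 0 < normConst τ a b := by
  have h1 := rhoHat_im_pos hτ
  have h2 := a.rank_pos
  have h3 := b.rank_pos
  rw [normConst]
  split_ifs with h
  · positivity
  · have : 0 < |(pp a b : ℝ)| := abs_pos.2 (by exact_mod_cast h)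
    positivity

theorem thetaNorm_ne_zero {τ : ℂ} (hτ : 0 < τ.im) (a b : Brane θ) (k : ℤ) :
    thetaNorm τ a b k ≠ 0 := by
  rw [thetaNorm]
  split_ifs
  · exact one_ne_zero
  · exact_mod_cast (normConst_pos hτ a b).ne'

theorem thetaVec_eq_smul (τ : ℂ) (a b : Brane θ) (k j : ℤ) :
    thetaVec τ a b k j = thetaNorm τ a b k • vacuum τ a b j := by
  rw [thetaVec, thetaNorm]
  split_ifs <;> simp

theorem vacuum_eq_scalarMor (τ : ℂ) {a b : Brane θ} (hp : pp a b = 0) (j : ℤ) :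
    vacuum τ a b j = scalarMor 1 := by
  rw [vacuum, if_pos hp, scalarMor]

theorem smul_scalarMor (w w' : ℂ) : w • scalarMor w' = scalarMor (w * w') := by
  simp only [scalarMor]
  refine Prod.ext (by simp) ?_
  funext n
  simp

section Labels

variable {Ob : Type*} {obj : Ob → Brane θ} {a b c : Ob} {k l m : ℤ}

/-- In the degree of `V^F_ab` the Gaussian decays. -/
theorem rhoDeg_mul_slope_pos {τ : ℂ} (hτ : 0 < τ.im) (h : HasDegree obj a b k)
    (hp : pp (obj a) (obj b) ≠ 0) :
    0 < (rhoDeg τ k).im * ((obj b).slope - (obj a).slope) := by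
  have h1 := rhoHat_im_pos hτ
  rw [hasDegree_iff hp, pp_pos_iff, pp_neg_iff] at h
  rcases h with ⟨h, rfl⟩ | ⟨h, rfl⟩
  · exact mul_pos (by simpa [rhoDeg] using h1) (sub_pos.2 h)
  · exact mul_pos_of_neg_of_neg (by simpa [rhoDeg] using h1) (sub_neg.2 h)

theorem rhoDeg_mul_slope_neg {τ : ℂ} (hτ : 0 < τ.im) (h : ¬HasDegree obj a b k)
    (hk : k = 0 ∨ k = 1) (hp : pp (obj a) (obj b) ≠ 0) :
    (rhoDeg τ k).im * ((obj b).slope - (obj a).slope) < 0 := by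
  have h1 := rhoHat_im_pos hτ
  rw [hasDegree_iff hp, not_or, not_and, not_and] at h
  rcases lt_or_gt_of_ne hp with h' | h'
  · obtain rfl : k = 0 := hk.resolve_right (h.2 h')
    exact mul_neg_of_pos_of_neg (by simpa [rhoDeg] using h1) (sub_neg.2 ((pp_neg_iff _ _).1 h'))
  · obtain rfl : k = 1 := hk.resolve_left (h.1 h')
    exact mul_neg_of_neg_of_pos (by simpa [rhoDeg] using h1) (sub_pos.2 ((pp_pos_iff _ _).1 h'))

/-- There is no cohomology in the degrees where the Fukaya category has no morphisms: the Gaussian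
grows, or, for `p_ab = 0`, the objects are different. -/
theorem harm_eq_bot {τ : ℂ} (hτ : 0 < τ.im)
    (hobj : ∀ a b : Ob, a ≠ b → ¬ (obj a).Same (obj b)) (h : ¬HasDegree obj a b k) :
    harm τ (obj a) (obj b) k = ⊥ := by
  by_cases hk : k = 0 ∨ k = 1
  · rw [harm_eq_kerNabla τ _ _ hk, Submodule.eq_bot_iff]
    intro f hf
    by_cases hp : pp (obj a) (obj b) = 0
    · have hab : a ≠ b := fun e => h (Or.inr (Or.inr ⟨e, hk⟩))
      exact eq_zero_of_mem_kerNabla_of_not_same hp (hobj a b hab) (rhoDeg_im_ne hτ k) hf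
    · exact eq_zero_of_mem_kerNabla hp (rhoDeg_mul_slope_neg hτ h hk hp) hf
  · rw [not_or] at hk
    simp [harm, hk]

theorem vacuum_eq_gaussian (τ : ℂ) (h : HasDegree obj a b k) (hp : pp (obj a) (obj b) ≠ 0)
    (j : ℤ) : vacuum τ (obj a) (obj b) j = (fun x i =>
      (if i ≡ j [ZMOD pp (obj a) (obj b)] then 1 else 0) *
        gaussian (rhoDeg τ k) (obj a) (obj b) x, 0) := by
  rw [vacuum, if_neg hp]
  refine Prod.ext ?_ rfl
  funext x i
  have hz : (if 0 < mu (obj a) (obj b) then rhoHat τ else (starRingEnd ℂ) (rhoHat τ)) =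
      rhoDeg τ k := by
    rw [hasDegree_iff hp] at h
    rw [rhoDeg]
    refine if_congr ?_ rfl rfl
    rw [mu_pos_iff]
    omega
  simp only [hz, ite_mul, one_mul, zero_mul]
  refine if_congr Iff.rfl ?_ rfl
  have ha := (obj a).rank_ne
  have hb := (obj b).rank_ne
  have hd := slope_sub_ne hp
  have hx : (obj b).rank / (pp (obj a) (obj b) : ℝ) =
      1 / ((obj a).rank * ((obj b).slope - (obj a).slope)) := by
    rw [pp_eq_slope]
    field_simp
  have e1 : edgeArea (obj a) (obj b) 0 0 ((obj a).rank * x) = mu (obj a) (obj b) *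
      ((x + (obj b).rank / (pp (obj a) (obj b) : ℝ) * αα (obj a) (obj b)) ^ 2 / 2) := by
    rw [hx, mu_eq, edgeArea, crossX_zero]
    field_simp
    ring
  have e2 : edgePhase (obj a) (obj b) 0 0 ((obj a).rank * x) = mu (obj a) (obj b) *
      ((obj b).rank / (pp (obj a) (obj b) : ℝ) * ββ (obj a) (obj b) *
        (x + (obj b).rank / (pp (obj a) (obj b) : ℝ) * αα (obj a) (obj b))) := by
    rw [hx, mu_eq, edgePhase, crossX_zero]
    field_simp
    ring
  rw [gaussian, e1, e2]
  congr 1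
  push_cast
  ring

open Classical in
/-- The combination `∑ x_j v_ab^j` of theta vectors, up to normalization, for `p_ab ≠ 0`. -/
theorem sum_smul_vacuum (τ : ℂ) (h : HasDegree obj a b k) (hp : pp (obj a) (obj b) ≠ 0)
    (x : Label obj a b k → ℂ) :
    ∑ j, x j • thetaVec τ (obj a) (obj b) k j.num =
      (fun y i => (∑ j, if i ≡ j.num [ZMOD pp (obj a) (obj b)] then
        x j * thetaNorm τ (obj a) (obj b) k else 0) *
        gaussian (rhoDeg τ k) (obj a) (obj b) y, 0) := by
  refine Prod.ext ?_ ?_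
  · funext y i
    simp only [thetaVec_eq_smul, vacuum_eq_gaussian τ h hp, Prod.fst_sum, Finset.sum_apply,
      Prod.smul_fst, Pi.smul_apply, smul_eq_mul, Finset.sum_mul]
    refine Finset.sum_congr rfl fun j _ => ?_
    split_ifs <;> ring
  · simp only [thetaVec_eq_smul, vacuum_eq_gaussian τ h hp, Prod.snd_sum, Prod.smul_snd,
      smul_zero, Finset.sum_const_zero]

theorem thetaVec_mem_harm {τ : ℂ} (hτ : 0 < τ.im) (j : Label obj a b k) :
    thetaVec τ (obj a) (obj b) k j.num ∈ harm τ (obj a) (obj b) k := by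
  rw [harm_eq_kerNabla τ _ _ j.2.eq_zero_or_one, thetaVec_eq_smul]
  refine Submodule.smul_mem _ _ ?_
  by_cases hp : pp (obj a) (obj b) = 0
  · obtain rfl := j.2.eq_of_pp_eq_zero hp
    rw [mem_kerNabla_self (rhoDeg_im_ne hτ k), vacuum_eq_scalarMor τ hp]
    simp [scalarMor]
  · rw [vacuum_eq_gaussian τ j.2 hp]
    refine mem_kerNabla_of_coeff hp (rhoDeg_mul_slope_pos hτ j.2 hp) fun i => ?_
    refine if_congr ?_ rfl rfl
    simp [Int.ModEq]

/-- The linear map `v_ab^j ↦ |0⟩_ab^j`. -/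
def thetaMap {τ : ℂ} (hτ : 0 < τ.im) (obj : Ob → Brane θ) (a b : Ob) (k : ℤ) :
    (Label obj a b k → ℂ) →ₗ[ℂ] harm τ (obj a) (obj b) k :=
  (Fintype.linearCombination ℂ fun j : Label obj a b k =>
    thetaVec τ (obj a) (obj b) k j.num).codRestrict _ fun x => by
      rw [Fintype.linearCombination_apply]
      exact Submodule.sum_mem _ fun j _ => Submodule.smul_mem _ _ (thetaVec_mem_harm hτ j)

theorem thetaMap_coe {τ : ℂ} (hτ : 0 < τ.im) (x : Label obj a b k → ℂ) :
    (thetaMap hτ obj a b k x : Mor) = ∑ j, x j • thetaVec τ (obj a) (obj b) k j.num := rfl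

theorem thetaMap_injective {τ : ℂ} (hτ : 0 < τ.im) :
    Function.Injective (thetaMap hτ obj a b k) := by
  classical
  rw [injective_iff_map_eq_zero]
  intro x hx
  have hx' : ∑ j, x j • thetaVec τ (obj a) (obj b) k j.num = 0 := by
    rw [← thetaMap_coe hτ, hx]; rfl
  funext j
  have hN := thetaNorm_ne_zero hτ (obj a) (obj b) k
  by_cases hp : pp (obj a) (obj b) = 0
  · have hsub : ∀ i : Label obj a b k, i = j := fun i =>
      Label.num_injective (by rw [Label.num_eq_zero hp, Label.num_eq_zero hp])
    rw [Finset.sum_eq_single j (fun i _ hne => absurd (hsub i) hne) (by simp)] at hx'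
    have := congrFun (congrArg Prod.snd hx') 0
    simpa [thetaVec_eq_smul, vacuum_eq_scalarMor τ hp, scalarMor, hN] using this
  · rw [sum_smul_vacuum τ j.2 hp] at hx'
    have h0 := congrFun (congrFun (congrArg Prod.fst hx') 0) j.num
    dsimp only at h0
    rw [Finset.sum_eq_single j] at h0
    · simpa [gaussian_ne_zero, hN] using h0
    · intro i _ hne
      refine if_neg fun h => hne ?_
      exact (existsUnique_num j.2 j.num fun h => absurd h hp).unique h rfl
    · simp

theorem thetaMap_surjective {τ : ℂ} (hτ : 0 < τ.im)
    (hobj : ∀ a b : Ob, a ≠ b → ¬ (obj a).Same (obj b)) :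
    Function.Surjective (thetaMap hτ obj a b k) := by
  classical
  rintro ⟨f, hf⟩
  by_cases h : HasDegree obj a b k
  swap
  · rw [harm_eq_bot hτ hobj h, Submodule.mem_bot] at hf
    exact ⟨0, Subtype.ext (by rw [map_zero]; exact hf.symm)⟩
  have hN := thetaNorm_ne_zero hτ (obj a) (obj b) k
  rw [harm_eq_kerNabla τ _ _ h.eq_zero_or_one] at hf
  by_cases hp : pp (obj a) (obj b) = 0
  · obtain rfl := h.eq_of_pp_eq_zero hp
    rw [mem_kerNabla_self (rhoDeg_im_ne hτ k)] at hf
    obtain ⟨j, -, -⟩ := existsUnique_num h 0 fun _ => rfl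
    have hsub : ∀ i : Label obj a a k, i = j := fun i =>
      Label.num_injective (by rw [Label.num_eq_zero hp, Label.num_eq_zero hp])
    refine ⟨fun _ => f.2 0 / thetaNorm τ (obj a) (obj a) k, Subtype.ext ?_⟩
    rw [thetaMap_coe, Finset.sum_eq_single j (fun i _ hne => absurd (hsub i) hne) (by simp),
      thetaVec_eq_smul, vacuum_eq_scalarMor τ hp, smul_smul, smul_scalarMor, mul_one,
      div_mul_cancel₀ _ hN]
    exact hf.symm
  · obtain ⟨w, hw, hfw⟩ := exists_coeff_of_mem_kerNabla hp hf
    have hper : ∀ i i', i ≡ i' [ZMOD pp (obj a) (obj b)] → w i = w i' := by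
      intro i i' hii
      obtain ⟨t, ht⟩ := hii.dvd
      have hw' : Function.Periodic w (pp (obj a) (obj b)) := hw
      have := hw'.int_mul t i
      rw [← this]
      congr 1
      simp only [Int.cast_id]
      linear_combination -ht
    refine ⟨fun j => w j.num / thetaNorm τ (obj a) (obj b) k, Subtype.ext ?_⟩
    rw [thetaMap_coe, sum_smul_vacuum τ h hp]
    simp only
    rw [hfw]
    refine Prod.ext ?_ rfl
    funext y i
    obtain ⟨j, hj, hu⟩ := existsUnique_num h i fun h => absurd h hp
    dsimp only
    rw [Finset.sum_eq_single j, if_pos hj, div_mul_cancel₀ _ hN, hper _ _ hj]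
    · exact fun i' _ hne => if_neg fun h' => hne (hu i' h')
    · simp

/-- The linear isomorphism `𝔣₁`. -/
def thetaEquiv {τ : ℂ} (hτ : 0 < τ.im) (obj : Ob → Brane θ)
    (hobj : ∀ a b : Ob, a ≠ b → ¬ (obj a).Same (obj b)) (a b : Ob) (k : ℤ) :
    (Label obj a b k → ℂ) ≃ₗ[ℂ] harm τ (obj a) (obj b) k :=
  LinearEquiv.ofBijective (thetaMap hτ obj a b k)
    ⟨thetaMap_injective hτ, thetaMap_surjective hτ hobj⟩

theorem thetaEquiv_coe {τ : ℂ} (hτ : 0 < τ.im)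
    (hobj : ∀ a b : Ob, a ≠ b → ¬ (obj a).Same (obj b)) (x : Label obj a b k → ℂ) :
    (thetaEquiv hτ obj hobj a b k x : Mor) =
      ∑ j, x j • thetaVec τ (obj a) (obj b) k j.num := rfl

end Labels

open MeasureTheory


/-! ### The hermitian inner product and the projection to the harmonic space -/

theorem rk_mul_rk (a b : Brane θ) : rk a b * rk b a = 1 := by
  have ha := a.rank_ne
  have hb := b.rank_ne
  rw [rk_eq, rk_eq]
  field_simp

theorem tensor_pairing_zero {a b : Brane θ} (hp : pp a b ≠ 0) (f f' : Mor) :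
    (tensor a b a f f').2 (0, 0) = ∑ j ∈ Finset.range (pp a b).natAbs,
      ∫ x : ℝ, f.1 x j * f'.1 (x / rk a b) (-(qq a b) * j) := by
  have hp' : pp b a ≠ 0 := by rw [pp_swap a b]; simpa using hp
  simp [tensor, if_neg hp, if_neg hp', if_pos (pp_self a), actU₁, actU₂, ee_zero]

/-- The hermitian inner product is the `L²` inner product on `ℝ × ℤ/|p_ab|`, up to the rank. Only
the periodicity of `f'` is used, so `f` may lie outside of the Heisenberg module. -/
theorem herm_of_pp_ne {a b : Brane θ} (hp : pp a b ≠ 0) {f f' : Mor}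
    (hf' : ∀ x j, f'.1 x (j + pp a b) = f'.1 x j) :
    herm a b f' f = a.rank * ∑ j ∈ Finset.range (pp a b).natAbs,
      ∫ x : ℝ, f.1 x j * (starRingEnd ℂ) (f'.1 x j) := by
  rw [herm, trace, tensor_pairing_zero hp, abs_of_pos a.rank_pos]
  congr 1
  refine Finset.sum_congr rfl fun j _ => ?_
  congr 1
  funext x
  congr 1
  obtain ⟨t, ht⟩ := qq_mul_rr a b
  have hx : x / rk a b / rk b a = x := by rw [div_div, rk_mul_rk, div_one]
  have hj : -(-(qq a b) * (j : ℤ) * qq b a) = j + (t * j) * pp a b := by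
    rw [qq_swap a b]
    linear_combination (j : ℤ) * ht
  simp only [dagger, if_neg hp, hx, hj]
  have hper : Function.Periodic (f'.1 x) (pp a b) := hf' x
  have := hper.int_mul (t * j) (j : ℤ)
  rw [Int.cast_id] at this
  rw [this]

theorem herm_self (a : Brane θ) (w : ℂ) (f : Mor) :
    herm a a (scalarMor w) f = a.rank * (f.2 0 * (starRingEnd ℂ) w) := by
  have hp := pp_self a
  rw [herm, trace, abs_of_pos a.rank_pos]
  congr 1
  simp only [tensor, if_pos hp, torusMul]
  rw [tsum_eq_single 0]
  · simp [dagger, if_pos hp, scalarMor, ee_zero]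
  · intro m hm
    have : ((0, 0) : ℤ × ℤ) - m ≠ 0 := by
      rwa [show ((0, 0) : ℤ × ℤ) = 0 from rfl, zero_sub, neg_ne_zero]
    simp [dagger, if_pos hp, scalarMor, this]

theorem integral_exp_neg_mul_sq_affine {κ A : ℝ} (hA : 0 < A) (ξ : ℝ) :
    ∫ x : ℝ, Real.exp (-κ * (A * x - ξ) ^ 2) = Real.sqrt (Real.pi / κ) / A := by
  have h1 := integral_sub_right_eq_self (μ := volume) (fun x : ℝ => Real.exp (-κ * x ^ 2)) ξ
  have h2 := Measure.integral_comp_mul_left (fun x : ℝ => Real.exp (-κ * (x - ξ) ^ 2)) A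
  rw [h2, h1, integral_gaussian, abs_of_pos (inv_pos.2 hA), smul_eq_mul, inv_mul_eq_div]

theorem integrable_exp_neg_mul_sq_affine {κ A : ℝ} (hκ : 0 < κ) (hA : 0 < A) (ξ : ℝ) :
    Integrable fun x : ℝ => Real.exp (-κ * (A * x - ξ) ^ 2) :=
  ((integrable_exp_neg_mul_sq hκ).comp_sub_right ξ).comp_mul_left' hA.ne'

theorem gaussian_mul_conj (z : ℂ) (a b : Brane θ) (x : ℝ) :
    gaussian z a b x * (starRingEnd ℂ) (gaussian z a b x) =
      (Real.exp (-(2 * Real.pi * (z.im * (b.slope - a.slope))) *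
        (a.rank * x - crossX a b 0 0) ^ 2) : ℝ) := by
  rw [Complex.mul_conj', norm_gaussian, ← Complex.ofReal_pow, ← Real.exp_nat_mul]
  congr 2
  push_cast
  ring

theorem integrable_gaussian_mul_conj {z : ℂ} {a b : Brane θ}
    (h : 0 < z.im * (b.slope - a.slope)) :
    Integrable fun x : ℝ => gaussian z a b x * (starRingEnd ℂ) (gaussian z a b x) := by
  simp only [gaussian_mul_conj]
  exact (integrable_exp_neg_mul_sq_affine (by have := Real.pi_pos; positivity)
    a.rank_pos _).ofReal

/-- The square of the norm of the Gaussian. -/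
def gaussianSq (z : ℂ) (a b : Brane θ) : ℂ :=
  ∫ x : ℝ, gaussian z a b x * (starRingEnd ℂ) (gaussian z a b x)

theorem gaussianSq_eq (z : ℂ) (a b : Brane θ) : gaussianSq z a b =
    ((Real.sqrt (Real.pi / (2 * Real.pi * (z.im * (b.slope - a.slope)))) / a.rank : ℝ) : ℂ) := by
  rw [gaussianSq]
  simp only [gaussian_mul_conj]
  rw [integral_complex_ofReal, integral_exp_neg_mul_sq_affine a.rank_pos]

theorem normConst_eq (τ : ℂ) {a b : Brane θ} (hp : pp a b ≠ 0) :
    normConst τ a b = Real.sqrt (2 * (rhoHat τ).im * |b.slope - a.slope|) := by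
  have ha := a.rank_pos
  have hb := b.rank_pos
  rw [normConst, if_neg hp]
  congr 1
  rw [pp_eq_slope, abs_mul, abs_of_pos (mul_pos ha hb)]
  field_simp

theorem sqrt_pi_div {t : ℝ} (n : ℝ) (hn : n = Real.sqrt (2 * t)) :
    Real.sqrt (Real.pi / (2 * Real.pi * t)) = 1 / n := by
  have hpi := Real.pi_ne_zero
  rw [hn, mul_right_comm, mul_comm _ Real.pi, div_mul_eq_div_div, div_self hpi,
    Real.sqrt_div zero_le_one, Real.sqrt_one]

theorem gaussianSq_ne_zero {z : ℂ} {a b : Brane θ} (h : 0 < z.im * (b.slope - a.slope)) :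
    gaussianSq z a b ≠ 0 := by
  have h1 := Real.pi_pos
  have h2 := a.rank_pos
  rw [gaussianSq_eq]
  have : 0 < Real.sqrt (Real.pi / (2 * Real.pi * (z.im * (b.slope - a.slope)))) / a.rank := by
    positivity
  exact_mod_cast this.ne'

theorem herm_gaussian_sub {a b : Brane θ} (hp : pp a b ≠ 0) {z : ℂ}
    (h : 0 < z.im * (b.slope - a.slope)) {f : Mor} {u v : ℤ → ℂ}
    (hu : ∀ i, u (i + pp a b) = u i)
    (hf : ∀ i, Integrable fun x : ℝ => f.1 x i * (starRingEnd ℂ) (gaussian z a b x)) :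
    herm a b (fun x i => u i * gaussian z a b x, 0)
        (f - (fun x i => v i * gaussian z a b x, 0)) =
      a.rank * ∑ j ∈ Finset.range (pp a b).natAbs, (starRingEnd ℂ) (u j) *
        ((∫ x : ℝ, f.1 x j * (starRingEnd ℂ) (gaussian z a b x)) - v j * gaussianSq z a b) := by
  rw [herm_of_pp_ne hp (by intro x j; simp only [hu])]
  congr 1
  refine Finset.sum_congr rfl fun j _ => ?_
  have hG := (integrable_gaussian_mul_conj h).const_mul (v j)
  rw [gaussianSq, ← integral_const_mul, ← integral_sub (hf j) hG, ← integral_const_mul]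
  congr 1
  funext x
  simp only [Prod.fst_sub, Pi.sub_apply, map_mul]
  ring

/-- The value of `proj` is a chosen solution of the orthogonality relations, so uniqueness of the
solution is needed as well. -/
theorem proj_eq_of_unique {τ : ℂ} {a b : Brane θ} {k : ℤ} {f : Mor} (f₀ : harm τ a b k)
    (h₁ : ∀ f' : harm τ a b k, herm a b f' (f - f₀) = 0)
    (h₂ : ∀ g : harm τ a b k, (∀ f' : harm τ a b k, herm a b f' (f - g) = 0) → g = f₀) :
    proj τ a b k f = f₀ := by
  have h : ∃ f₀ : harm τ a b k, ∀ f' : harm τ a b k, herm a b f' (f - f₀) = 0 := ⟨f₀, h₁⟩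
  rw [proj, dif_pos h]
  exact h₂ _ h.choose_spec

theorem eq_of_periodic {p : ℤ} (hp : p ≠ 0) {u : ℤ → ℂ} (hu : ∀ i, u (i + p) = u i)
    (h : ∀ j ∈ Finset.range p.natAbs, u j = 0) (i : ℤ) : u i = 0 := by
  obtain ⟨j, hj, -⟩ := existsUnique_label hp i
  obtain ⟨t, ht⟩ := hj.dvd
  have hu' : Function.Periodic u p := hu
  have e := hu'.int_mul t i
  rw [Int.cast_id] at e
  rw [← e, show i + t * p = ((j : ℕ) : ℤ) by linear_combination -ht]
  exact h j (Finset.mem_range.2 j.2)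

/-- The projection to the harmonic space in terms of integrals against the Gaussian. -/
theorem proj_eq_of_coeff {τ : ℂ} {a b : Brane θ} (hp : pp a b ≠ 0) {k : ℤ} (hk : k = 0 ∨ k = 1)
    (h : 0 < (rhoDeg τ k).im * (b.slope - a.slope)) {f : Mor} {w : ℤ → ℂ}
    (hw : ∀ i, w (i + pp a b) = w i)
    (hf : ∀ i, Integrable fun x : ℝ =>
      f.1 x i * (starRingEnd ℂ) (gaussian (rhoDeg τ k) a b x))
    (hfw : ∀ i, ∫ x : ℝ, f.1 x i * (starRingEnd ℂ) (gaussian (rhoDeg τ k) a b x) =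
      w i * gaussianSq (rhoDeg τ k) a b) :
    (proj τ a b k f : Mor) = (fun x i => w i * gaussian (rhoDeg τ k) a b x, 0) := by
  set z := rhoDeg τ k with hz
  have hharm : harm τ a b k = kerNabla z a b := harm_eq_kerNabla τ a b hk
  have hmem : ∀ {v : ℤ → ℂ}, (∀ i, v (i + pp a b) = v i) →
      ((fun x i => v i * gaussian z a b x, 0) : Mor) ∈ harm τ a b k := fun hv => by
    rw [hharm]; exact mem_kerNabla_of_coeff hp h hv
  have hform : ∀ g : harm τ a b k, ∃ v : ℤ → ℂ, (∀ i, v (i + pp a b) = v i) ∧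
      (g : Mor) = (fun x i => v i * gaussian z a b x, 0) := fun g =>
    exists_coeff_of_mem_kerNabla hp (hharm ▸ g.2)
  refine congrArg Subtype.val (proj_eq_of_unique ⟨_, hmem hw⟩ ?_ ?_)
  · intro f'
    obtain ⟨u, hu, hfu⟩ := hform f'
    rw [hfu, herm_gaussian_sub hp h hu hf]
    simp [hfw]
  · intro g hg
    obtain ⟨v, hv, hgv⟩ := hform g
    have hu : ∀ i, (w - v) (i + pp a b) = (w - v) i := fun i => by
      simp only [Pi.sub_apply, hw, hv]
    have e := hg ⟨_, hmem hu⟩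
    rw [hgv, herm_gaussian_sub hp h hu hf] at e
    have ha : (a.rank : ℂ) ≠ 0 := by exact_mod_cast a.rank_ne
    have hI := gaussianSq_ne_zero h
    have e1 : ∑ j ∈ Finset.range (pp a b).natAbs, ‖(w - v) (j : ℤ)‖ ^ 2 = 0 := by
      have e2 : (∑ j ∈ Finset.range (pp a b).natAbs, (‖(w - v) (j : ℤ)‖ ^ 2 : ℂ)) *
          gaussianSq z a b = 0 := by
        rw [Finset.sum_mul, ← (mul_eq_zero.1 e).resolve_left ha]
        refine Finset.sum_congr rfl fun j _ => ?_
        rw [hfw, ← Complex.conj_mul', Pi.sub_apply]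
        ring
      exact_mod_cast (mul_eq_zero.1 e2).resolve_right hI
    have e3 := (Finset.sum_eq_zero_iff_of_nonneg fun _ _ => by positivity).1 e1
    have e4 : ∀ i, (w - v) i = 0 := eq_of_periodic hp hu fun j hj => by
      simpa using e3 j hj
    refine Subtype.ext (hgv.trans ?_)
    refine Prod.ext ?_ rfl
    funext x i
    have := sub_eq_zero.1 (e4 i)
    simp only [this]

/-- The projection to the harmonic space of `Hom(E_a, E_a)` takes the constant coefficient. -/
theorem proj_self {τ : ℂ} (hτ : 0 < τ.im) (a : Brane θ) {k : ℤ} (hk : k = 0 ∨ k = 1) (f : Mor) :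
    (proj τ a a k f : Mor) = scalarMor (f.2 0) := by
  have hmem : ∀ {g : Mor}, g ∈ harm τ a a k ↔ g = scalarMor (g.2 0) := fun {g} => by
    rw [harm_eq_kerNabla τ a a hk]; exact mem_kerNabla_self (rhoDeg_im_ne hτ k)
  have hs : ∀ w : ℂ, scalarMor w ∈ harm τ a a k := fun w => hmem.2 (by simp [scalarMor])
  refine congrArg Subtype.val (proj_eq_of_unique ⟨scalarMor (f.2 0), hs _⟩ ?_ ?_)
  · intro f'
    rw [hmem.1 f'.2, herm_self]
    simp [scalarMor]
  · intro g hg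
    have e := hg ⟨scalarMor 1, hs _⟩
    have ha : (a.rank : ℂ) ≠ 0 := by exact_mod_cast a.rank_ne
    rw [herm_self, map_one, mul_one] at e
    have e' := (mul_eq_zero.1 e).resolve_left ha
    rw [Prod.snd_sub, Pi.sub_apply, sub_eq_zero] at e'
    exact Subtype.ext (by rw [hmem.1 g.2, e'])

section Labels

variable {Ob : Type*} {obj : Ob → Brane θ} {a b c : Ob} {k l m : ℤ}

theorem proj_of_mem {τ : ℂ} (hτ : 0 < τ.im) (h : HasDegree obj a b k) {f : Mor}
    (hf : f ∈ harm τ (obj a) (obj b) k) : (proj τ (obj a) (obj b) k f : Mor) = f := by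
  have hk := h.eq_zero_or_one
  by_cases hp : pp (obj a) (obj b) = 0
  · obtain rfl := h.eq_of_pp_eq_zero hp
    rw [proj_self hτ _ hk]
    rw [harm_eq_kerNabla τ _ _ hk, mem_kerNabla_self (rhoDeg_im_ne hτ k)] at hf
    exact hf.symm
  · rw [harm_eq_kerNabla τ _ _ hk] at hf
    obtain ⟨w, hw, rfl⟩ := exists_coeff_of_mem_kerNabla hp hf
    have hpos := rhoDeg_mul_slope_pos hτ h hp
    refine proj_eq_of_coeff hp hk hpos hw (fun i => ?_) (fun i => ?_)
    · simp only [mul_assoc]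
      exact (integrable_gaussian_mul_conj hpos).const_mul _
    · simp only [mul_assoc]
      rw [integral_const_mul, gaussianSq]

end Labels

/-! ### Products of three Gaussians -/

/-- The arguments of the two factors in the tensor product are such that the shift by `w` becomes
the index `w` of a line of `b`, at the same base point `X = A_a x`. -/
theorem gaussian_shift_left {a b : Brane θ} (hab : pp a b ≠ 0) (z : ℂ) (x w : ℝ) :
    gaussian z a b (x + 1 / (pp a b : ℝ) * w) =
      ee (z * (edgeArea a b 0 w (a.rank * x) : ℂ) + (edgePhase a b 0 w (a.rank * x) : ℂ)) := by
  have ha := a.rank_ne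
  have hb := b.rank_ne
  have hs := slope_sub_ne hab
  have e : a.rank * (x + 1 / (pp a b : ℝ) * w) - crossX a b 0 0 =
      a.rank * x - crossX a b 0 w := by
    simp only [crossX, icpt, pp_eq_slope]
    field_simp
    ring
  simp only [gaussian, edgeArea, edgePhase, e]

/-- The scaling of the argument by `q_ab + p_ab θ_a = A_b / A_a` makes the base point `A_a x`
independent of the pair of objects. -/
theorem gaussian_shift_right {b c : Brane θ} (hbc : pp b c ≠ 0) (a : Brane θ) (z : ℂ) (x w : ℝ) :
    gaussian z b c (x / rk a b - rk b c / (pp b c : ℝ) * w) =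
      ee (z * (edgeArea b c w 0 (a.rank * x) : ℂ) + (edgePhase b c w 0 (a.rank * x) : ℂ)) := by
  have ha := a.rank_ne
  have hb := b.rank_ne
  have hc := c.rank_ne
  have hs := slope_sub_ne hbc
  have e : b.rank * (x / rk a b - rk b c / (pp b c : ℝ) * w) - crossX b c 0 0 =
      a.rank * x - crossX b c w 0 := by
    simp only [crossX, icpt, pp_eq_slope, rk_eq]
    field_simp
    ring
  simp only [gaussian, edgeArea, edgePhase, e]

theorem conj_ee (z : ℂ) : (starRingEnd ℂ) (ee z) = ee (-(starRingEnd ℂ) z) := by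
  have h2 : (starRingEnd ℂ) 2 = 2 := map_ofNat _ 2
  simp only [ee]
  rw [← Complex.exp_conj]
  simp [h2]

/-- Conjugation reverses the edge and conjugates `z`. -/
theorem conj_gaussian (z : ℂ) (a c : Brane θ) (x : ℝ) :
    (starRingEnd ℂ) (gaussian z a c x) = ee ((starRingEnd ℂ) z *
      (edgeArea c a 0 0 (a.rank * x) : ℂ) + (edgePhase c a 0 0 (a.rank * x) : ℂ)) := by
  rw [gaussian, conj_ee, edgeArea_swap a c, edgePhase_swap a c]
  congr 1
  simp
  ring

/-- The real translation of the triangle with indices `i`, `n`, `0` that moves the first index to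
`0` fixes the line of `c`. -/
theorem disc_eq_of_ne {a c : Brane θ} (hac : pp a c ≠ 0) (b : Brane θ) (i n : ℝ) :
    disc a b c 0 (n - (pp b c : ℝ) / (pp a c : ℝ) * i) 0 = disc a b c i n 0 := by
  have h : (pp a c : ℝ) ≠ 0 := by exact_mod_cast hac
  simp only [disc, pp_swap a c, Int.cast_neg]
  field_simp
  ring

/-- Conjugation of `ρ̂` at one edge produces a real Gaussian. -/
theorem ee_conj_sub_mul (ρ : ℂ) (a b : Brane θ) (m n X : ℝ) :
    ee (((starRingEnd ℂ) ρ - ρ) * (edgeArea a b m n X : ℂ)) =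
      (Real.exp (-(2 * Real.pi * (ρ.im * (a.slope - b.slope))) *
        (X - crossX a b m n) ^ 2) : ℝ) := by
  have h : (starRingEnd ℂ) ρ - ρ = -(2 * ρ.im * Complex.I) := by
    refine Complex.ext ?_ ?_ <;> simp
    ring
  rw [ee, h, edgeArea, Complex.ofReal_exp]
  congr 1
  push_cast
  linear_combination (-2 * Real.pi * ρ.im * (b.slope - a.slope) * (X - crossX a b m n) ^ 2) *
    Complex.I_sq

/-- The product of three Gaussians is the weight of a triangle times the contribution of the edges
at which `ρ̂` is replaced by its complex conjugate. -/
theorem gaussian_mul_gaussian_mul_conj (τ : ℂ) {a b c : Brane θ} (hab : pp a b ≠ 0)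
    (hbc : pp b c ≠ 0) (hac : pp a c ≠ 0) (z₁ z₂ z₃ : ℂ) (i n x : ℝ) :
    gaussian z₁ a b (x + 1 / (pp a b : ℝ) * (n - (pp b c : ℝ) / (pp a c : ℝ) * i)) *
      gaussian z₂ b c (x / rk a b - rk b c / (pp b c : ℝ) *
        (n - (pp b c : ℝ) / (pp a c : ℝ) * i)) *
      (starRingEnd ℂ) (gaussian z₃ a c x) =
    triWeight τ a b c (disc a b c i n 0) *
      (ee ((z₁ - rhoHat τ) * (edgeArea a b 0 (n - (pp b c : ℝ) / (pp a c : ℝ) * i)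
        (a.rank * x) : ℂ)) *
      ee ((z₂ - rhoHat τ) * (edgeArea b c (n - (pp b c : ℝ) / (pp a c : ℝ) * i) 0
        (a.rank * x) : ℂ)) *
      ee (((starRingEnd ℂ) z₃ - rhoHat τ) * (edgeArea c a 0 0 (a.rank * x) : ℂ))) := by
  rw [gaussian_shift_left hab, gaussian_shift_right hbc, conj_gaussian, ← disc_eq_of_ne hac,
    triWeight_eq_edges τ hab hbc hac _ _ _ (a.rank * x), ← ee_add, ← ee_add, ← ee_add, ← ee_add,
    ← ee_add]
  congr 1
  push_cast
  ring

/-! ### Sums of translates of a Gaussian -/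

theorem integrable_and_integral_tsum_gaussian {κ A : ℝ} (hκ : 0 < κ) (hA : 0 < A) {C : ℤ → ℂ}
    (hC : Summable fun n => ‖C n‖) (ξ : ℤ → ℝ) :
    Integrable (fun x : ℝ => ∑' n, C n * (Real.exp (-κ * (A * x - ξ n) ^ 2) : ℝ)) ∧
    ∫ x : ℝ, ∑' n, C n * (Real.exp (-κ * (A * x - ξ n) ^ 2) : ℝ) =
      (∑' n, C n) * (Real.sqrt (Real.pi / κ) / A : ℝ) := by
  set F : ℤ → ℝ → ℂ := fun n x => C n * (Real.exp (-κ * (A * x - ξ n) ^ 2) : ℝ) with hF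
  have hint : ∀ n, Integrable (F n) := fun n =>
    ((integrable_exp_neg_mul_sq_affine hκ hA (ξ n)).ofReal (𝕜 := ℂ)).const_mul (C n)
  have hnorm : ∀ n x, ‖F n x‖ = ‖C n‖ * Real.exp (-κ * (A * x - ξ n) ^ 2) := fun n x => by
    rw [hF, norm_mul, Complex.norm_real, Real.norm_eq_abs, Real.abs_exp]
  have hle : ∀ n x, ‖F n x‖ ≤ ‖C n‖ := fun n x => by
    rw [hnorm]
    refine mul_le_of_le_one_right (norm_nonneg _) (Real.exp_le_one_iff.2 ?_)
    have := sq_nonneg (A * x - ξ n)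
    nlinarith
  have hsum : Summable fun n => ∫ x, ‖F n x‖ := by
    simp only [hnorm, integral_const_mul, integral_exp_neg_mul_sq_affine hA]
    exact hC.mul_right _
  have hcont : Continuous fun x => ∑' n, F n x :=
    continuous_tsum (fun n => by simp only [hF]; fun_prop) hC hle
  constructor
  · refine ⟨hcont.aestronglyMeasurable, ?_⟩
    have hfin : ∫⁻ x, ∑' n, ‖F n x‖ₑ < ⊤ := by
      rw [lintegral_tsum fun n => (hint n).1.enorm]
      have e : ∀ n, ∫⁻ x, ‖F n x‖ₑ = ENNReal.ofReal (∫ x, ‖F n x‖) := fun n => by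
        rw [← ofReal_integral_norm_eq_lintegral_enorm (hint n)]
      simp only [e]
      rw [← ENNReal.ofReal_tsum_of_nonneg (fun n => integral_nonneg fun x => norm_nonneg _) hsum]
      exact ENNReal.ofReal_lt_top
    exact (lintegral_mono fun x => enorm_tsum_le_tsum_enorm).trans_lt hfin
  · rw [← integral_tsum_of_summable_integral_norm hint hsum, ← tsum_mul_right]
    refine tsum_congr fun n => ?_
    simp only [hF, integral_const_mul, integral_complex_ofReal,
      integral_exp_neg_mul_sq_affine hA]

section Labels

variable {Ob : Type*} {obj : Ob → Brane θ} {a b c : Ob} {k l m : ℤ}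

/-- The periodic function on `ℤ` with the value `x_j` on the residue class of the label `j`. -/
def labelFun (x : Label obj a b k → ℂ) (i : ℤ) : ℂ :=
  ∑ j, if i ≡ j.num [ZMOD pp (obj a) (obj b)] then x j else 0

theorem labelFun_congr (x : Label obj a b k → ℂ) {i i' : ℤ}
    (h : i ≡ i' [ZMOD pp (obj a) (obj b)]) : labelFun x i = labelFun x i' :=
  Finset.sum_congr rfl fun _ _ => if_congr ⟨h.symm.trans, h.trans⟩ rfl rfl

theorem labelFun_add (x : Label obj a b k → ℂ) (i : ℤ) :
    labelFun x (i + pp (obj a) (obj b)) = labelFun x i :=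
  labelFun_congr x (by simp [Int.ModEq])

theorem labelFun_eq (x : Label obj a b k → ℂ) {i : ℤ} {j : Label obj a b k}
    (hp : pp (obj a) (obj b) ≠ 0) (h : i ≡ j.num [ZMOD pp (obj a) (obj b)]) :
    labelFun x i = x j := by
  rw [labelFun, Finset.sum_eq_single j, if_pos h]
  · exact fun j' _ hne => if_neg fun h' => hne
      ((existsUnique_num j.2 i fun h => absurd h hp).unique h' h)
  · simp

theorem norm_labelFun_le (x : Label obj a b k → ℂ) (i : ℤ) : ‖labelFun x i‖ ≤ ∑ j, ‖x j‖ := by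
  refine (norm_sum_le _ _).trans (Finset.sum_le_sum fun j _ => ?_)
  split_ifs
  · exact le_rfl
  · rw [norm_zero]; exact norm_nonneg _

theorem thetaEquiv_eq_labelFun {τ : ℂ} (hτ : 0 < τ.im)
    (hobj : ∀ a b : Ob, a ≠ b → ¬ (obj a).Same (obj b)) (h : HasDegree obj a b k)
    (hp : pp (obj a) (obj b) ≠ 0) (x : Label obj a b k → ℂ) :
    (thetaEquiv hτ obj hobj a b k x : Mor) = (fun y i =>
      labelFun x i * thetaNorm τ (obj a) (obj b) k * gaussian (rhoDeg τ k) (obj a) (obj b) y,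
      0) := by
  rw [thetaEquiv_coe, sum_smul_vacuum τ h hp]
  refine Prod.ext ?_ rfl
  funext y i
  simp only [labelFun, Finset.sum_mul, ite_mul, zero_mul]

/-- The composition of the Fukaya category as a single sum over the integers. -/
theorem labelFun_fukayaComp {τ : ℂ} (hτ : 0 < τ.im) (hab : pp (obj a) (obj b) ≠ 0)
    (hbc : pp (obj b) (obj c) ≠ 0) (hac : pp (obj a) (obj c) ≠ 0)
    (hP : pppCyc (obj a) (obj b) (obj c) < 0) (hm : HasDegree obj a c m)
    (x : Label obj a b k → ℂ) (y : Label obj b c l → ℂ) (i : ℤ) :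
    labelFun (fukayaComp (m := m) τ x y) i = ∑' n : ℤ,
      labelFun x (-(rr (obj a) (obj b)) * n + i) * labelFun y n *
        triWeight τ (obj a) (obj b) (obj c) (disc (obj a) (obj b) (obj c) i n 0) := by
  have hca : pp (obj c) (obj a) ≠ 0 := by rw [pp_swap (obj a)]; simpa using hac
  obtain ⟨j₃, hj₃, -⟩ := existsUnique_num hm i fun h => absurd h hac
  rw [labelFun_eq _ hac hj₃, fukayaComp]
  set T : ℤ → ℂ := fun n => triWeight τ (obj a) (obj b) (obj c)
    (disc (obj a) (obj b) (obj c) i n 0) with hT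
  have hTs : Summable fun n => ‖T n‖ := by
    have h := summable_triWeight hτ hca (a := obj c) (b := obj a) (c := obj b)
      (by rwa [← pppCyc_rotate]) 0 i
    refine h.congr fun n => ?_
    rw [hT, ← triWeight_rotate τ (obj c) (obj a) (obj b), ← disc_rotate (obj c) (obj a) (obj b)]
  have hinc : Inc (obj c) (obj a) (-(qq (obj a) (obj c)) * j₃.num) 0 i :=
    inc_swap (inc_iff_modEq.2 (by simpa using hj₃)) rfl
  have hS : ∀ (j₁ : Label obj a b k) (j₂ : Label obj b c l),
      x j₁ * y j₂ * structureConst τ (obj a) (obj b) (obj c) j₁.num j₂.num j₃.num =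
      ∑' n : ℤ, (if -(rr (obj a) (obj b)) * n + i ≡ j₁.num [ZMOD pp (obj a) (obj b)] then x j₁
        else 0) * (if n ≡ j₂.num [ZMOD pp (obj b) (obj c)] then y j₂ else 0) * T n := by
    classical
    intro j₁ j₂
    rw [structureConst_eq_thetaSum τ hab hbc hac hP, ← thetaSum_rotate, ← thetaSum_rotate,
      thetaSum_eq_tsum τ hca _ _ hinc, ← tsum_mul_left]
    refine (tsum_subtype_eq_tsum_ite (fun n : ℤ => Inc (obj a) (obj b) j₁.num i n ∧
      Inc (obj b) (obj c) j₂.num n 0) fun n => x j₁ * y j₂ * triWeight τ (obj c) (obj a) (obj b)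
        (disc (obj c) (obj a) (obj b) (0 : ℤ) i n)).trans (tsum_congr fun n => ?_)
    have e1 : Inc (obj a) (obj b) j₁.num i n ↔
        -(rr (obj a) (obj b)) * n + i ≡ j₁.num [ZMOD pp (obj a) (obj b)] := by
      rw [inc_iff_modEq, show i - rr (obj a) (obj b) * n = -(rr (obj a) (obj b)) * n + i by ring]
    have e2 : Inc (obj b) (obj c) j₂.num n 0 ↔ n ≡ j₂.num [ZMOD pp (obj b) (obj c)] := by
      rw [inc_iff_modEq, mul_zero, sub_zero]
    have e3 : triWeight τ (obj c) (obj a) (obj b)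
        (disc (obj c) (obj a) (obj b) (0 : ℤ) i n) = T n := by
      rw [hT, ← triWeight_rotate τ (obj c) (obj a) (obj b),
        ← disc_rotate (obj c) (obj a) (obj b), Int.cast_zero]
    rw [e3, e1, e2]
    by_cases h1 : -(rr (obj a) (obj b)) * n + i ≡ j₁.num [ZMOD pp (obj a) (obj b)] <;>
      by_cases h2 : n ≡ j₂.num [ZMOD pp (obj b) (obj c)] <;> simp [*]
  have hSs : ∀ (j₁ : Label obj a b k) (j₂ : Label obj b c l), Summable fun n : ℤ =>
      (if -(rr (obj a) (obj b)) * n + i ≡ j₁.num [ZMOD pp (obj a) (obj b)] then x j₁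
        else 0) * (if n ≡ j₂.num [ZMOD pp (obj b) (obj c)] then y j₂ else 0) * T n := by
    intro j₁ j₂
    refine (hTs.mul_left (‖x j₁‖ * ‖y j₂‖)).of_norm_bounded fun n => ?_
    split_ifs <;> simp <;> positivity
  simp only [hS]
  simp only [← Summable.tsum_finsetSum fun j _ => hSs _ j]
  rw [← Summable.tsum_finsetSum fun j _ => summable_sum fun j' _ => hSs j j']
  refine tsum_congr fun n => ?_
  simp only [labelFun]
  rw [Finset.sum_mul_sum, Finset.sum_mul]
  exact Finset.sum_congr rfl fun j _ => (Finset.sum_mul _ _ _).symm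

theorem summable_labelFun_mul_triWeight {τ : ℂ} (hτ : 0 < τ.im)
    (hac : pp (obj a) (obj c) ≠ 0) (hP : pppCyc (obj a) (obj b) (obj c) < 0)
    (x : Label obj a b k → ℂ) (y : Label obj b c l → ℂ) (i r : ℤ) :
    Summable fun n : ℤ => ‖labelFun x (r * n + i) * labelFun y n *
        triWeight τ (obj a) (obj b) (obj c) (disc (obj a) (obj b) (obj c) i n 0)‖ := by
  have hca : pp (obj c) (obj a) ≠ 0 := by rw [pp_swap (obj a)]; simpa using hac
  have h := (summable_triWeight hτ hca (a := obj c) (b := obj a) (c := obj b)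
      (by rwa [← pppCyc_rotate]) 0 i).mul_left ((∑ j, ‖x j‖) * ∑ j, ‖y j‖)
  refine h.of_nonneg_of_le (fun _ => norm_nonneg _) fun n => ?_
  rw [← triWeight_rotate τ (obj c) (obj a) (obj b), ← disc_rotate (obj c) (obj a) (obj b),
    norm_mul, norm_mul]
  gcongr
  · exact norm_labelFun_le x _
  · exact norm_labelFun_le y _

end Labels

/-! ### The composition of theta vectors -/

/-- The normalization of a theta vector of degree `1` is the inverse of the square of the norm of
its Gaussian, up to the rank. -/
theorem normConst_mul_sqrt {τ : ℂ} (hτ : 0 < τ.im) {a b : Brane θ} (h : b.slope < a.slope) :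
    normConst τ a b * Real.sqrt (Real.pi / (2 * Real.pi * ((rhoHat τ).im * (a.slope - b.slope)))) =
      1 := by
  have hp : pp a b ≠ 0 := ((pp_neg_iff a b).2 h).ne
  rw [sqrt_pi_div (normConst τ a b), mul_one_div_cancel (normConst_pos hτ a b).ne']
  rw [normConst_eq τ hp, abs_of_neg (sub_neg.2 h), neg_sub, mul_assoc]

section Labels

variable {Ob : Type*} {obj : Ob → Brane θ} {a b c : Ob} {k l m : ℤ}

/-- In each of the three possible distributions of degrees, `ρ̂` is conjugated at exactly one edge
of the triangle, and the norm of the resulting Gaussian is the quotient of the normalizations. -/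
theorem exists_gaussian_mul_gaussian_mul_conj {τ : ℂ} (hτ : 0 < τ.im)
    (hab : pp (obj a) (obj b) ≠ 0) (hbc : pp (obj b) (obj c) ≠ 0) (hac : pp (obj a) (obj c) ≠ 0)
    (h₁ : HasDegree obj a b k) (h₂ : HasDegree obj b c l) (h₃ : HasDegree obj a c m)
    (hm : k + l = m) : ∃ κ : ℝ, 0 < κ ∧ ∃ ξ : ℝ → ℝ → ℝ, (∀ i n x : ℝ,
      gaussian (rhoDeg τ k) (obj a) (obj b) (x + 1 / (pp (obj a) (obj b) : ℝ) *
          (n - (pp (obj b) (obj c) : ℝ) / (pp (obj a) (obj c) : ℝ) * i)) *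
        gaussian (rhoDeg τ l) (obj b) (obj c) (x / rk (obj a) (obj b) -
          rk (obj b) (obj c) / (pp (obj b) (obj c) : ℝ) *
          (n - (pp (obj b) (obj c) : ℝ) / (pp (obj a) (obj c) : ℝ) * i)) *
        (starRingEnd ℂ) (gaussian (rhoDeg τ m) (obj a) (obj c) x) =
      triWeight τ (obj a) (obj b) (obj c) (disc (obj a) (obj b) (obj c) i n 0) *
        (Real.exp (-κ * ((obj a).rank * x - ξ i n) ^ 2) : ℝ)) ∧
    thetaNorm τ (obj a) (obj b) k * thetaNorm τ (obj b) (obj c) l *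
        (Real.sqrt (Real.pi / κ) / (obj a).rank : ℝ) =
      thetaNorm τ (obj a) (obj c) m * gaussianSq (rhoDeg τ m) (obj a) (obj c) := by
  have hρ := rhoHat_im_pos hτ
  have hpi := Real.pi_pos
  subst hm
  have h3' := h₃
  rw [hasDegree_iff hab, pp_pos_iff, pp_neg_iff] at h₁
  rw [hasDegree_iff hbc, pp_pos_iff, pp_neg_iff] at h₂
  rw [hasDegree_iff hac, pp_pos_iff, pp_neg_iff] at h₃
  rcases h₁ with ⟨s₁, rfl⟩ | ⟨s₁, rfl⟩ <;> rcases h₂ with ⟨s₂, rfl⟩ | ⟨s₂, rfl⟩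
  · have s₃ : (obj a).slope < (obj c).slope := s₁.trans s₂
    refine ⟨2 * Real.pi * ((rhoHat τ).im * ((obj c).slope - (obj a).slope)), ?_, fun i n =>
      crossX (obj c) (obj a) 0 0, fun i n x => ?_, ?_⟩
    · have := sub_pos.2 s₃
      positivity
    · rw [gaussian_mul_gaussian_mul_conj τ hab hbc hac, ← ee_conj_sub_mul]
      simp [rhoDeg, ee_zero]
    · rw [gaussianSq_eq]
      simp [thetaNorm, rhoDeg]
  · have s₃ : (obj c).slope < (obj a).slope := by
      rcases h₃ with ⟨-, h⟩ | ⟨h, -⟩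
      · exact absurd h (by norm_num)
      · exact h
    refine ⟨2 * Real.pi * ((rhoHat τ).im * ((obj b).slope - (obj c).slope)), ?_, fun i n =>
      crossX (obj b) (obj c) (n - (pp (obj b) (obj c) : ℝ) / (pp (obj a) (obj c) : ℝ) * i) 0,
      fun i n x => ?_, ?_⟩
    · have := sub_pos.2 s₂
      positivity
    · rw [gaussian_mul_gaussian_mul_conj τ hab hbc hac, ← ee_conj_sub_mul]
      simp [rhoDeg, ee_zero]
    · have e₂ := normConst_mul_sqrt hτ s₂
      have e₃ := normConst_mul_sqrt hτ s₃
      rw [gaussianSq_eq]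
      simp only [thetaNorm, rhoDeg, zero_add, one_ne_zero, if_false, if_true, one_mul,
        Complex.conj_im, neg_mul, ← mul_neg, neg_sub]
      norm_cast
      rw [← mul_div_assoc, ← mul_div_assoc, e₂, e₃]
  · have s₃ : (obj c).slope < (obj a).slope := by
      rcases h₃ with ⟨-, h⟩ | ⟨h, -⟩
      · exact absurd h (by norm_num)
      · exact h
    refine ⟨2 * Real.pi * ((rhoHat τ).im * ((obj a).slope - (obj b).slope)), ?_, fun i n =>
      crossX (obj a) (obj b) 0 (n - (pp (obj b) (obj c) : ℝ) / (pp (obj a) (obj c) : ℝ) * i),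
      fun i n x => ?_, ?_⟩
    · have := sub_pos.2 s₁
      positivity
    · rw [gaussian_mul_gaussian_mul_conj τ hab hbc hac, ← ee_conj_sub_mul]
      simp [rhoDeg, ee_zero]
    · have e₁ := normConst_mul_sqrt hτ s₁
      have e₃ := normConst_mul_sqrt hτ s₃
      rw [gaussianSq_eq]
      simp only [thetaNorm, rhoDeg, add_zero, one_ne_zero, if_false, if_true, mul_one,
        Complex.conj_im, neg_mul, ← mul_neg, neg_sub]
      norm_cast
      rw [← mul_div_assoc, ← mul_div_assoc, e₁, e₃]
  · exact absurd h3'.eq_zero_or_one (by norm_num)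

/-- The composition for three objects with pairwise different slopes. -/
theorem proj_tensor_thetaEquiv {τ : ℂ} (hτ : 0 < τ.im)
    (hobj : ∀ a b : Ob, a ≠ b → ¬ (obj a).Same (obj b))
    (hab : pp (obj a) (obj b) ≠ 0) (hbc : pp (obj b) (obj c) ≠ 0) (hac : pp (obj a) (obj c) ≠ 0)
    (h₁ : HasDegree obj a b k) (h₂ : HasDegree obj b c l) (h₃ : HasDegree obj a c m)
    (hm : k + l = m) (x : Label obj a b k → ℂ) (y : Label obj b c l → ℂ) :
    (proj τ (obj a) (obj c) m (tensor (obj a) (obj b) (obj c)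
      (thetaEquiv hτ obj hobj a b k x : Mor) (thetaEquiv hτ obj hobj b c l y : Mor)) : Mor) =
    thetaEquiv hτ obj hobj a c m (fukayaComp (m := m) τ x y) := by
  have hP : pppCyc (obj a) (obj b) (obj c) < 0 := by
    have hca : pp (obj c) (obj a) ≠ 0 := by rw [pp_swap (obj a)]; simpa using hac
    exact pppCyc_neg h₁ h₂ (h₃.swap (l := 1 - m) (by omega)) (by omega) hab hbc hca
  obtain ⟨κ, hκ, ξ, hG, hN⟩ :=
    exists_gaussian_mul_gaussian_mul_conj hτ hab hbc hac h₁ h₂ h₃ hm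
  rw [thetaEquiv_eq_labelFun hτ hobj h₁ hab, thetaEquiv_eq_labelFun hτ hobj h₂ hbc,
    thetaEquiv_eq_labelFun hτ hobj h₃ hac]
  set N₁ := thetaNorm τ (obj a) (obj b) k
  set N₂ := thetaNorm τ (obj b) (obj c) l
  set C : ℤ → ℤ → ℂ := fun i n =>
    labelFun x (-(rr (obj a) (obj b)) * n + i) * labelFun y n *
      triWeight τ (obj a) (obj b) (obj c) (disc (obj a) (obj b) (obj c) i n 0) with hC
  have hform : ∀ (i : ℤ) (t : ℝ), (tensor (obj a) (obj b) (obj c)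
      (fun y i => labelFun x i * N₁ * gaussian (rhoDeg τ k) (obj a) (obj b) y, 0)
      (fun z i => labelFun y i * N₂ * gaussian (rhoDeg τ l) (obj b) (obj c) z, 0)).1 t i *
        (starRingEnd ℂ) (gaussian (rhoDeg τ m) (obj a) (obj c) t) =
      N₁ * N₂ * ∑' n, C i n * (Real.exp (-κ * ((obj a).rank * t - ξ i n) ^ 2) : ℝ) := by
    intro i t
    simp only [tensor, if_neg hab, if_neg hbc, if_neg hac]
    rw [← tsum_mul_right, ← tsum_mul_left]
    refine tsum_congr fun n => ?_
    rw [hC]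
    dsimp only
    rw [mul_assoc (labelFun x (-(rr (obj a) (obj b)) * n + i) * labelFun y n), ← hG]
    ring
  have key : ∀ i : ℤ, _ := fun i => integrable_and_integral_tsum_gaussian hκ (obj a).rank_pos
    (C := C i) (summable_labelFun_mul_triWeight hτ hac hP x y i _) (fun n => ξ i n)
  refine proj_eq_of_coeff hac h₃.eq_zero_or_one (rhoDeg_mul_slope_pos hτ h₃ hac)
    (w := fun i => labelFun (fukayaComp (m := m) τ x y) i * thetaNorm τ (obj a) (obj c) m)
    (fun i => by simp only [labelFun_add]) (fun i => ?_) (fun i => ?_)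
  · simp only [hform]
    exact (key i).1.const_mul _
  · simp only [hform]
    rw [integral_const_mul, (key i).2, labelFun_fukayaComp hτ hab hbc hac hP h₃, mul_assoc _ _
      (gaussianSq _ _ _), ← hN]
    ring

/-! ### The pairing of theta vectors -/

theorem sum_label_eq_sum_range (h : HasDegree obj a b k) (hp : pp (obj a) (obj b) ≠ 0)
    (f : ℤ → ℂ) :
    ∑ j : Label obj a b k, f j.num = ∑ j ∈ Finset.range (pp (obj a) (obj b)).natAbs, f j := by
  have h1 : numLabels (obj a) (obj b) = (pp (obj a) (obj b)).natAbs := if_neg hp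
  refine Finset.sum_nbij (fun j => (j.1 : ℕ)) (fun j _ => ?_) (fun j _ j' _ e => ?_)
    (fun n hn => ?_) fun j _ => rfl
  · rw [Finset.mem_range, ← h1]
    exact j.1.2
  · exact Subtype.ext (Fin.ext e)
  · rw [Finset.mem_coe, Finset.mem_range, ← h1] at hn
    exact ⟨⟨⟨n, hn⟩, h⟩, by simp, rfl⟩

theorem rhoDeg_eq_conj (τ : ℂ) (hk : k = 0 ∨ k = 1) (hkl : k + l = 1) :
    rhoDeg τ l = (starRingEnd ℂ) (rhoDeg τ k) := by
  rcases hk with rfl | rfl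
  · obtain rfl : l = 1 := by omega
    simp [rhoDeg]
  · obtain rfl : l = 0 := by omega
    simp [rhoDeg]

theorem thetaNorm_mul_gaussianSq {τ : ℂ} (hτ : 0 < τ.im) (h : HasDegree obj a b k)
    (hp : pp (obj a) (obj b) ≠ 0) (hkl : k + l = 1) :
    thetaNorm τ (obj a) (obj b) k * thetaNorm τ (obj b) (obj a) l *
      gaussianSq (rhoDeg τ k) (obj a) (obj b) = ((1 / (obj a).rank : ℝ) : ℂ) := by
  rw [hasDegree_iff hp, pp_pos_iff, pp_neg_iff] at h
  rw [gaussianSq_eq]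
  rcases h with ⟨h, rfl⟩ | ⟨h, rfl⟩
  · obtain rfl : l = 1 := by omega
    have e := normConst_mul_sqrt hτ h
    simp only [thetaNorm, rhoDeg, one_ne_zero, if_false, if_true, one_mul]
    norm_cast
    rw [← mul_div_assoc, e]
  · obtain rfl : l = 0 := by omega
    have e := normConst_mul_sqrt hτ h
    simp only [thetaNorm, rhoDeg, one_ne_zero, if_false, if_true, mul_one, Complex.conj_im, neg_mul,
      ← mul_neg, neg_sub]
    norm_cast
    rw [← mul_div_assoc, e]

/-- The pairing of theta vectors. The Gaussians of `ab` and `ba` are complex conjugates of each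
other, so that the integrals are norms of Gaussians. -/
theorem tensor_thetaEquiv_zero {τ : ℂ} (hτ : 0 < τ.im)
    (hobj : ∀ a b : Ob, a ≠ b → ¬ (obj a).Same (obj b)) (hp : pp (obj a) (obj b) ≠ 0)
    (h : HasDegree obj a b k) (hkl : k + l = 1) (x : Label obj a b k → ℂ)
    (y : Label obj b a l → ℂ) :
    (tensor (obj a) (obj b) (obj a) (thetaEquiv hτ obj hobj a b k x : Mor)
      (thetaEquiv hτ obj hobj b a l y : Mor)).2 0 =
    fukayaEta x y * ((1 / (obj a).rank : ℝ) : ℂ) := by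
  have hp' : pp (obj b) (obj a) ≠ 0 := by rw [pp_swap (obj a)]; simpa using hp
  rw [thetaEquiv_eq_labelFun hτ hobj h hp, thetaEquiv_eq_labelFun hτ hobj (h.swap hkl) hp']
  refine (tensor_pairing_zero hp _ _).trans ?_
  have hG : ∀ t : ℝ, gaussian (rhoDeg τ l) (obj b) (obj a) (t / rk (obj a) (obj b)) =
      (starRingEnd ℂ) (gaussian (rhoDeg τ k) (obj a) (obj b) t) := by
    intro t
    have e := gaussian_shift_right hp' (obj a) (rhoDeg τ l) t 0
    rw [mul_zero, sub_zero] at e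
    rw [e, conj_gaussian, rhoDeg_eq_conj τ h.eq_zero_or_one hkl]
  have hI : ∀ j : ℤ, ∫ t : ℝ, labelFun x j * thetaNorm τ (obj a) (obj b) k *
        gaussian (rhoDeg τ k) (obj a) (obj b) t *
      (labelFun y (-(qq (obj a) (obj b)) * j) * thetaNorm τ (obj b) (obj a) l *
        gaussian (rhoDeg τ l) (obj b) (obj a) (t / rk (obj a) (obj b))) =
      labelFun x j * labelFun y (-(qq (obj a) (obj b)) * j) * ((1 / (obj a).rank : ℝ) : ℂ) := by
    intro j
    rw [← thetaNorm_mul_gaussianSq hτ h hp hkl, gaussianSq, ← integral_const_mul,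
      ← integral_const_mul]
    congr 1
    funext t
    rw [hG]
    ring
  dsimp only
  simp only [hI]
  rw [← Finset.sum_mul, ← sum_label_eq_sum_range h hp fun j =>
    labelFun x j * labelFun y (-(qq (obj a) (obj b)) * j), fukayaEta]
  congr 1
  refine Finset.sum_congr rfl fun j _ => ?_
  rw [labelFun_eq x hp rfl, labelFun, Finset.mul_sum]
  refine Finset.sum_congr rfl fun j' _ => ?_
  rw [mul_ite, mul_zero, mul_ite, mul_one, mul_zero]
  refine if_congr ?_ rfl rfl
  rw [pp_swap (obj a), Int.modEq_neg, Int.modEq_comm, and_iff_right hkl]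

/-! ### Units and compositions with equal objects -/

theorem tensor_scalarMor_left (w : ℂ) {a c : Brane θ} {f : Mor} (hf : f ∈ homSpace a c) :
    tensor a a c (scalarMor w) f = w • f := by
  have h0 : ∀ g : ℤ × ℤ → ℂ, ∑' n : ℤ × ℤ, (scalarMor w).2 n * g n = w * g 0 := fun g => by
    rw [tsum_eq_single 0 fun n hn => by simp [scalarMor, hn]]
    simp [scalarMor]
  by_cases hp : pp a c = 0
  · obtain ⟨h1, -⟩ := hf.2 hp
    simp only [tensor, pp_self, if_true, if_pos hp]
    refine Prod.ext (by simp [h1]) ?_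
    funext n
    simp only [torusMul, mul_assoc, h0]
    simp [ee_zero]
  · obtain ⟨-, h2⟩ := hf.1 hp
    simp only [tensor, pp_self, if_true, if_neg hp]
    refine Prod.ext ?_ (by simp [h2])
    funext x j
    dsimp only
    rw [h0]
    simp [actU₁, actU₂, ee_zero]

theorem tensor_scalarMor_right (w : ℂ) {a b : Brane θ} (hp : pp a b ≠ 0) {f : Mor}
    (hf : f ∈ homSpace a b) : tensor a b b f (scalarMor w) = w • f := by
  obtain ⟨-, h2⟩ := hf.1 hp
  simp only [tensor, pp_self, if_true, if_neg hp]
  refine Prod.ext ?_ (by simp [h2])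
  funext x j
  dsimp only
  rw [tsum_eq_single 0 fun n hn => by simp [scalarMor, hn]]
  simp [scalarMor, actZ₁, actZ₂, ee_zero]

theorem tensor_zero_left (a b c : Brane θ) (f : Mor) : tensor a b c 0 f = 0 := by
  rw [tensor]
  split_ifs
  · refine Prod.ext rfl ?_
    funext n; simp [torusMul]
  · refine Prod.ext ?_ rfl
    funext x j; simp
  · refine Prod.ext ?_ rfl
    funext x j; simp [actZ₁, actZ₂]
  · refine Prod.ext rfl ?_
    funext n; simp [actU₁, actU₂]
  · refine Prod.ext ?_ rfl
    funext x j; simp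

theorem tensor_zero_right (a b c : Brane θ) (f : Mor) : tensor a b c f 0 = 0 := by
  rw [tensor]
  split_ifs
  · refine Prod.ext rfl ?_
    funext n; simp [torusMul]
  · refine Prod.ext ?_ rfl
    funext x j; simp [actU₁, actU₂]
  · refine Prod.ext ?_ rfl
    funext x j; simp
  · refine Prod.ext rfl ?_
    funext n; simp
  · refine Prod.ext ?_ rfl
    funext x j; simp

theorem mem_homSpace_of_mem_harm {τ : ℂ} {a b : Brane θ} (hk : k = 0 ∨ k = 1) {f : Mor}
    (hf : f ∈ harm τ a b k) : f ∈ homSpace a b := by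
  rw [harm_eq_kerNabla τ a b hk] at hf
  exact hf.1

theorem thetaEquiv_self {τ : ℂ} (hτ : 0 < τ.im)
    (hobj : ∀ a b : Ob, a ≠ b → ¬ (obj a).Same (obj b)) (x : Label obj a a k → ℂ) :
    (thetaEquiv hτ obj hobj a a k x : Mor) =
      scalarMor ((∑ j, x j) * thetaNorm τ (obj a) (obj a) k) := by
  rw [thetaEquiv_coe, Finset.sum_mul, ← mul_one (∑ j, x j * thetaNorm τ (obj a) (obj a) k),
    ← smul_scalarMor, Finset.sum_smul]
  simp only [thetaVec_eq_smul, vacuum_eq_scalarMor τ (pp_self (obj a)), smul_smul]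

theorem thetaNorm_self_mul {τ : ℂ} (a : Brane θ) (hm : k + l = m) (hk : k = 0 ∨ k = 1)
    (hl : l = 0 ∨ l = 1) (hm' : m = 0 ∨ m = 1) :
    thetaNorm τ a a k * thetaNorm τ a a l = thetaNorm τ a a m := by
  rcases hk with rfl | rfl <;> rcases hl with rfl | rfl <;> rcases hm' with rfl | rfl <;>
    first | omega | simp [thetaNorm]

theorem normConst_self (τ : ℂ) (a : Brane θ) : normConst τ a a = 1 / a.rank := by
  rw [normConst, if_pos (pp_self a)]

theorem degree_unique (hp : pp (obj a) (obj b) ≠ 0) (h : HasDegree obj a b k)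
    (h' : HasDegree obj a b l) : k = l := by
  rw [hasDegree_iff hp] at h h'
  omega

/-- The isomorphism `𝔣₁` preserves the compositions. -/
theorem thetaEquiv_fukayaComp {τ : ℂ} (hτ : 0 < τ.im)
    (hobj : ∀ a b : Ob, a ≠ b → ¬ (obj a).Same (obj b)) (hm : k + l = m)
    (x : Label obj a b k → ℂ) (y : Label obj b c l → ℂ) :
    thetaEquiv hτ obj hobj a c m (fukayaComp (m := m) τ x y) =
      proj τ (obj a) (obj c) m (tensor (obj a) (obj b) (obj c)
        (thetaEquiv hτ obj hobj a b k x : Mor) (thetaEquiv hτ obj hobj b c l y : Mor)) := by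
  refine Subtype.ext ?_
  by_cases h₃ : HasDegree obj a c m
  swap
  · have hbot := harm_eq_bot hτ hobj h₃
    have hz : ∀ f : harm τ (obj a) (obj c) m, (f : Mor) = 0 := fun f =>
      (Submodule.eq_bot_iff _).1 hbot f f.2
    rw [hz, hz]
  by_cases h₁ : HasDegree obj a b k
  swap
  · rw [eq_zero_of_not_hasDegree h₁ x, fukayaComp_zero_left, map_zero, map_zero,
      Submodule.coe_zero, Submodule.coe_zero, tensor_zero_left,
      proj_of_mem hτ h₃ (zero_mem _)]
  by_cases h₂ : HasDegree obj b c l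
  swap
  · rw [eq_zero_of_not_hasDegree h₂ y, fukayaComp_zero_right, map_zero, map_zero,
      Submodule.coe_zero, Submodule.coe_zero, tensor_zero_right,
      proj_of_mem hτ h₃ (zero_mem _)]
  by_cases hab : pp (obj a) (obj b) = 0
  · obtain rfl := h₁.eq_of_pp_eq_zero hab
    have hy : (thetaEquiv hτ obj hobj a c l y : Mor) ∈ homSpace (obj a) (obj c) :=
      mem_homSpace_of_mem_harm h₂.eq_zero_or_one (thetaEquiv hτ obj hobj a c l y).2
    rw [thetaEquiv_self hτ hobj x, tensor_scalarMor_left _ hy]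
    by_cases hac : pp (obj a) (obj c) = 0
    · obtain rfl := h₃.eq_of_pp_eq_zero hac
      rw [proj_self hτ _ h₃.eq_zero_or_one, thetaEquiv_self, thetaEquiv_self, smul_scalarMor,
        ← thetaNorm_self_mul (obj a) hm h₁.eq_zero_or_one h₂.eq_zero_or_one h₃.eq_zero_or_one]
      obtain ⟨j₀, -, hu⟩ := existsUnique_num h₃ 0 fun _ => rfl
      have e : ∑ j : Label obj a a m, fukayaComp (m := m) τ x y j = (∑ j, x j) * ∑ j, y j := by
        rw [Finset.sum_eq_single j₀ (fun j _ hne => absurd (Label.num_injective (by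
          rw [Label.num_eq_zero hab, Label.num_eq_zero hab])) hne) (by simp), Finset.sum_mul_sum]
        simp [fukayaComp, structureConst, hab, Label.num_eq_zero hab]
      rw [e]
      simp only [scalarMor, if_true]
      congr 1
      funext n
      refine if_congr Iff.rfl ?_ rfl
      ring
    · obtain rfl := degree_unique hac h₂ h₃
      obtain rfl : k = 0 := by omega
      have e : fukayaComp (m := l) τ x y = (∑ j, x j) • y := by
        funext j
        simp only [fukayaComp, structureConst, if_pos hab, Pi.smul_apply, smul_eq_mul,
          Finset.sum_mul]
        refine Finset.sum_congr rfl fun i _ => ?_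
        rw [Finset.sum_eq_single j, if_pos rfl, mul_one]
        · intro j' _ hne
          rw [if_neg fun h => hne (Label.num_injective h), mul_zero]
        · simp
      rw [e, map_smul, proj_of_mem hτ h₃ (Submodule.smul_mem _ _ (Subtype.mem _))]
      simp [thetaNorm]
  by_cases hbc : pp (obj b) (obj c) = 0
  · obtain rfl := h₂.eq_of_pp_eq_zero hbc
    obtain rfl := degree_unique hab h₁ h₃
    obtain rfl : l = 0 := by omega
    have hx : (thetaEquiv hτ obj hobj a b k x : Mor) ∈ homSpace (obj a) (obj b) :=
      mem_homSpace_of_mem_harm h₁.eq_zero_or_one (thetaEquiv hτ obj hobj a b k x).2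
    rw [thetaEquiv_self hτ hobj y, tensor_scalarMor_right _ hab hx]
    have e : fukayaComp (m := k) τ x y = (∑ j, y j) • x := by
      funext j
      simp only [fukayaComp, structureConst, if_neg hab, if_pos hbc, Pi.smul_apply, smul_eq_mul]
      rw [Finset.sum_eq_single j, Finset.sum_mul]
      · exact Finset.sum_congr rfl fun i _ => by rw [if_pos rfl]; ring
      · intro j' _ hne
        exact Finset.sum_eq_zero fun i _ => by
          rw [if_neg fun h => hne (Label.num_injective h), mul_zero]
      · simp
    rw [e, map_smul, proj_of_mem hτ h₃ (Submodule.smul_mem _ _ (Subtype.mem _))]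
    simp [thetaNorm]
  by_cases hac : pp (obj a) (obj c) = 0
  · obtain rfl := h₃.eq_of_pp_eq_zero hac
    have hkl : k + l = 1 := by
      have := degree_unique (by rwa [pp_swap (obj a), neg_ne_zero]) h₂
        (h₁.swap (l := 1 - k) (by omega))
      omega
    obtain rfl : m = 1 := by omega
    rw [proj_self hτ _ h₃.eq_zero_or_one, tensor_thetaEquiv_zero hτ hobj hab h₁ hkl,
      thetaEquiv_self]
    obtain ⟨j₀, -, hu⟩ := existsUnique_num h₃ 0 fun _ => rfl
    have e : ∑ j : Label obj a a 1, fukayaComp (m := 1) τ x y j = fukayaEta x y := by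
      rw [Finset.sum_eq_single j₀ (fun j _ hne => absurd (Label.num_injective (by
        rw [Label.num_eq_zero hac, Label.num_eq_zero hac])) hne) (by simp)]
      simp only [fukayaComp, fukayaEta, structureConst, if_neg hab, if_neg hbc, if_pos hac, hkl,
        true_and]
    rw [e]
    simp [thetaNorm, normConst_self]
  · exact (proj_tensor_thetaEquiv hτ hobj hab hbc hac h₁ h₂ h₃ hm x y).symm

/-- The isomorphism `𝔣₁` preserves the pairings. -/
theorem fukayaEta_eq_trace {τ : ℂ} (hτ : 0 < τ.im)
    (hobj : ∀ a b : Ob, a ≠ b → ¬ (obj a).Same (obj b)) (x : Label obj a b k → ℂ)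
    (y : Label obj b a l → ℂ) :
    fukayaEta x y = if k + l = 1 then trace (obj a) (tensor (obj a) (obj b) (obj a)
      (thetaEquiv hτ obj hobj a b k x : Mor) (thetaEquiv hτ obj hobj b a l y : Mor)) else 0 := by
  split_ifs with hkl
  swap
  · exact fukaya_eta_of_ne hkl x y
  by_cases h : HasDegree obj a b k
  swap
  · rw [eq_zero_of_not_hasDegree h x, fukayaEta_zero_left, map_zero, Submodule.coe_zero,
      tensor_zero_left]
    simp [trace]
  have ha : ((obj a).rank : ℂ) ≠ 0 := by exact_mod_cast (obj a).rank_ne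
  rw [trace, abs_of_pos (obj a).rank_pos]
  by_cases hp : pp (obj a) (obj b) = 0
  · obtain rfl := h.eq_of_pp_eq_zero hp
    have hy : (thetaEquiv hτ obj hobj a a l y : Mor) ∈ homSpace (obj a) (obj a) :=
      mem_homSpace_of_mem_harm (h.swap hkl).eq_zero_or_one (thetaEquiv hτ obj hobj a a l y).2
    rw [thetaEquiv_self hτ hobj x, tensor_scalarMor_left _ hy, thetaEquiv_self, smul_scalarMor,
      mul_mul_mul_comm, thetaNorm_self_mul (obj a) hkl h.eq_zero_or_one
        (h.swap hkl).eq_zero_or_one (Or.inr rfl), Finset.sum_mul_sum]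
    simp only [fukayaEta, hkl, Label.num_eq_zero hp, mul_zero, true_and]
    simp only [Int.ModEq.refl, if_true, mul_one, scalarMor, thetaNorm, one_ne_zero, if_false,
      normConst_self, Prod.mk_zero_zero]
    push_cast
    field_simp
  · have e := tensor_thetaEquiv_zero hτ hobj hp h hkl x y
    rw [Prod.mk_zero_zero, e]
    push_cast
    field_simp

theorem thetaEquiv_basisVec {τ : ℂ} (hτ : 0 < τ.im)
    (hobj : ∀ a b : Ob, a ≠ b → ¬ (obj a).Same (obj b)) (j : Label obj a b k) :
    (thetaEquiv hτ obj hobj a b k (basisVec obj j) : Mor) =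
      thetaVec τ (obj a) (obj b) k j.num := by
  classical
  rw [thetaEquiv_coe, Finset.sum_eq_single j]
  · simp [basisVec]
  · intro i _ hne
    simp [basisVec, Pi.single_eq_of_ne hne]
  · simp

end Labels

/-- Theta vectors define an equivalence of cyclic graded categories. -/
def thetaCatEquiv {τ : ℂ} (hτ : 0 < τ.im) {Ob : Type*} (obj : Ob → Brane θ)
    (hobj : ∀ a b : Ob, a ≠ b → ¬ (obj a).Same (obj b)) :
    CyclicGradedEquiv (fukayaCat τ obj) (heisenbergCat τ obj) where
  toEquiv a b k := thetaEquiv hτ obj hobj a b k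
  map_comp h x y := thetaEquiv_fukayaComp hτ hobj h x y
  map_eta x y := fukayaEta_eq_trace hτ hobj x y

end NCTorus

end

theorem theorem3p1 (θ : ℝ) (τ : ℂ) (hτ : 0 < τ.im) {Ob : Type*} (obj : Ob → Brane θ)
    (hobj : ∀ a b : Ob, a ≠ b → ¬ (obj a).Same (obj b)) :
    IsCyclicGradedCategory (NCTorus.fukayaCat τ obj) (-1) ∧
    IsCyclicGradedCategory (NCTorus.heisenbergCat τ obj) (-1) ∧
    ∃ F : CyclicGradedEquiv (NCTorus.fukayaCat τ obj) (NCTorus.heisenbergCat τ obj),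
      ∀ (a b : Ob) (k : ℤ) (j : NCTorus.Label obj a b k),
        NCTorus.toMor (F.toEquiv a b k (NCTorus.basisVec obj j)) =
          NCTorus.thetaVec τ (obj a) (obj b) k j.num :=
  ⟨NCTorus.fukayaCat_isCyclic hτ obj,
    NCTorus.IsCyclicGradedCategory.transport (NCTorus.fukayaCat_isCyclic hτ obj)
      (NCTorus.thetaCatEquiv hτ obj hobj),
    NCTorus.thetaCatEquiv hτ obj hobj, fun _ _ _ j => NCTorus.thetaEquiv_basisVec hτ hobj j⟩
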